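/- **Theorem (Regret bounds for APSEE-G).** *Setting.* Let $1\le H\le d$, let $\mathcal X\subset\mathbb R^d$ be closed and bounded with $0\in\mathcal X$, and let $\mathcal X$ be strongly convex of radius $R>0$, i.e. an intersection of closed Euclidean balls of radius $R$. Put $L_{\max}=\max_{x\in\mathcal X}\|x\|_2$ and, for $S\subseteq[d]$, $h(S;\theta)=\max\{\theta^\top x: x\in\mathcal X,\ \mathrm{supp}(x)\subseteq S\}$. Let $b_1,\dots,b_d\in\mathcal X$ have at most $H$ nonzero entries each, with $B=\sum_k b_kb_k^\top$ invertible; put $\lambda_0=\lambda_{\min}(B)$ and $h_1=2\sigma^2\mathrm{Tr}(B)/\lambda_0^2$. Playing $x_t$ gives the reward $Y_t=\theta_*^\top x_t+\eta_t$, where, given $x_1,\dots,x_t,\eta_1,\dots,\eta_{t-1}$, the noise $\eta_t$ has mean $0$ and is $\sigma$-sub-Gaussian, $\sigma>0$. *Greedy.* For a parameter $\theta$, Greedy starts with $G_0=\emptyset$ and for $k=1,\dots,H$ puts $G_k=G_{k-1}\cup\{g_k\}$, where $g_k$ maximizes the gain $h(G_{k-1}\cup\{v\};\theta)-h(G_{k-1};\theta)$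 over $v\notin G_{k-1}$ (ties broken arbitrarily). The minimum greedy gap is the minimum over $k$ of the best minus the second best gain in step $k$ ($+\infty$ in a step with one candidate). Assume that the minimum greedy gap of $\theta_*$ is a number $\Delta_{\min}>0$. *Algorithm APSEE-G.* Let $\delta\in(0,1)$ and $\varepsilon_c=\sqrt{h_1\ln(2dc^2/\delta)/c}$. In cycle $c=1,2,\dots$ the algorithm plays $b_1,\dots,b_d$, with rewards $Y_1(c),\dots,Y_d(c)$, and computes $\hat\theta_c=(cB)^{-1}\sum_{s=1}^{c}\sum_{k=1}^{d}b_kY_k(s)$. As long as no support has been fixed, it runs Greedy on $\hat\theta_c$, and if the minimum greedy gap of $\hat\theta_c$ exceeds $2L_{\max}\varepsilon_c$ it fixes $S_{est}=G_H$ for good. If $S_{est}$ is fixed, it then plays for $c$ steps a maximizer $a_c$ of $\hat\theta_c^\top x$ over $x\in\mathcal X$, $\mathrm{supp}(x)\subseteq S_{est}$. Let $C_0$ be the duration of the warm-up phase, i.e. the cycle in which $S_{est}$ is fixed. *Regret.* Let $\gamma$ be the submodularity ratio of $h(\cdot\,;\theta_*)$, i.e. the largest real number with $\sum_{\omega\in\Omega\setminus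 S}\big(h(S\cup\{\omega\};\theta_*)-h(S;\theta_*)\big)\ge\gamma\big(h(S\cup\Omega;\theta_*)-h(S;\theta_*)\big)$ for all $S,\Omega\subseteq[d]$. Put $\alpha=1-e^{-\gamma}$ and $$\alpha\text{-}R_T=\alpha\,T\max_{x\in\mathcal X,\ |\mathrm{supp}(x)|\le H}\theta_*^\top x-\sum_{t=1}^T\theta_*^\top x_t .$$ *Claim.* There are an absolute constant $C$ and a constant $C_1$ depending only on $L_{\max}$ and $R$ such that, with $q=\max\{1,L_{\max}^2h_1/\Delta_{\min}^2\}$, the following holds with probability at least $1-\delta$. The warm-up ends and $C_0\le C\,q\ln(2dq/\delta)$, and for all $T\ge1$ simultaneously: * if $T>dC_0$, then $$\alpha\text{-}R_T\le C_1\Big(d\sqrt T\Big(\|\theta_*\|_2+\frac{h_1}{\|\theta_*\|_2}\Big)+\frac{d\,\|\theta_*\|_2\,h_1}{\Delta_{\min}^2}\Big)\ln\frac{2dT^2}{\delta};$$ * if $T\le dC_0$, then $$\alpha\text{-}R_T\le C\,d\,L_{\max}\|\theta_*\|_2\;q\;\ln\frac{2dT^2}{\delta}.$$ In particular, for $T>dC_0$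 with $\sqrt T\ge h_1/\Delta_{\min}^2$ the $\alpha$-regret is $\tilde{\mathcal O}\big(d\sqrt T(\|\theta_*\|_2+1/\|\theta_*\|_2)\big)$, where $\tilde{\mathcal O}$ hides the logarithm and constants depending on $L_{\max},R,h_1$. -/

import Mathlib

open MeasureTheory

noncomputable section

namespace SparseBandit

/-- `ℝ^d` with the Euclidean norm and inner product. -/
abbrev Vec (d : ℕ) := EuclideanSpace ℝ (Fin d)

variable {d : ℕ}

/-- `x` vanishes outside `S`, that is `supp x ⊆ S`. -/
def SupportedOn (x : Vec d) (S : Finset (Fin d)) : Prop := ∀ i, i ∉ S → x i = 0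

/-- `x` has at most `H` nonzero entries. -/
def IsSparse (H : ℕ) (x : Vec d) : Prop := ∃ S : Finset (Fin d), S.card ≤ H ∧ SupportedOn x S

/-- The actions of `X` whose support lies in `S`. -/
def restrict (X : Set (Vec d)) (S : Finset (Fin d)) : Set (Vec d) := {x ∈ X | SupportedOn x S}

/-- `X` is strongly convex of radius `R`: it is an intersection of closed balls of radius `R`. -/
def IsStronglyConvexSet (R : ℝ) (X : Set (Vec d)) : Prop :=
  ∃ A : Set (Vec d), X = ⋂ z ∈ A, Metric.closedBall z R

/-- `L_max = max_{x ∈ X} ‖x‖`. -/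
def lmax (X : Set (Vec d)) : ℝ := sSup ((fun x => ‖x‖) '' X)

/-- The value function `h(S; θ) = max {θᵀ x : x ∈ X, supp x ⊆ S}`. -/
def value (X : Set (Vec d)) (S : Finset (Fin d)) (θ : Vec d) : ℝ :=
  sSup ((fun x => inner ℝ θ x) '' restrict X S)

/-- `a` maximizes `θᵀ x` over the `x ∈ X` with `supp x ⊆ S`. -/
def IsBestAction (X : Set (Vec d)) (S : Finset (Fin d)) (θ a : Vec d) : Prop :=
  a ∈ restrict X S ∧ ∀ x ∈ restrict X S, inner ℝ θ x ≤ inner ℝ θ a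

/-- The optimal `H`-sparse reward `max {θᵀ x : x ∈ X, x is H-sparse}`. -/
def opt (X : Set (Vec d)) (H : ℕ) (θ : Vec d) : ℝ :=
  sSup ((fun x => inner ℝ θ x) '' {x ∈ X | IsSparse H x})

/-- The submodularity ratio of a set function `f`: the largest `γ` such that
`∑_{ω ∈ Ω \ S} (f (S ∪ {ω}) - f S) ≥ γ (f (S ∪ Ω) - f S)` for all `S`, `Ω`. -/
def submodularityRatio (f : Finset (Fin d) → ℝ) : ℝ :=
  sSup {γ : ℝ | ∀ S W : Finset (Fin d),
    γ * (f (S ∪ W) - f S) ≤ ∑ w ∈ W \ S, (f (insert w S) - f S)}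

/-! ### The greedy choice of a support -/

/-- The set `G_k` of the first `k` elements `g 0, …, g (k - 1)` that were picked. -/
def picked (g : ℕ → Fin d) (k : ℕ) : Finset (Fin d) := (Finset.range k).image g

/-- The marginal gain of adding `v` to `G`. -/
def gain (X : Set (Vec d)) (θ : Vec d) (G : Finset (Fin d)) (v : Fin d) : ℝ :=
  value X (insert v G) θ - value X G θ

/-- `g 0, …, g (H - 1)` is an outcome of the greedy algorithm on the parameter `θ`: each pick is
new and has the largest marginal gain among all elements not picked so far. Ties may be broken
in any way. -/
def IsGreedy (X : Set (Vec d)) (H : ℕ) (θ : Vec d) (g : ℕ → Fin d) : Prop :=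
  ∀ k < H, g k ∉ picked g k ∧
    ∀ v, v ∉ picked g k → gain X θ (picked g k) v ≤ gain X θ (picked g k) (g k)

/-- Best minus second best marginal gain at a step; it is `⊤` if there is no second candidate. -/
def stepGap (X : Set (Vec d)) (θ : Vec d) (g : ℕ → Fin d) (k : ℕ) : EReal :=
  (gain X θ (picked g k) (g k) : EReal) -
    ⨆ v : {v : Fin d // v ∉ picked g k ∧ v ≠ g k}, (gain X θ (picked g k) v : EReal)

/-- The minimum greedy gap over the `H` steps. -/
def greedyGap (X : Set (Vec d)) (H : ℕ) (θ : Vec d) (g : ℕ → Fin d) : EReal :=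
  ⨅ k : Fin H, stepGap X θ g k

/-! ### Exploration, estimation and the algorithm -/

/-- `B = ∑_k b_k b_kᵀ`. -/
def gram (b : Fin d → Vec d) : Matrix (Fin d) (Fin d) ℝ :=
  ∑ k, Matrix.vecMulVec (b k).ofLp (b k).ofLp

/-- `λ₀`, the smallest eigenvalue of `B`. -/
def lambdaZero (b : Fin d → Vec d) : ℝ := sInf (spectrum ℝ (gram b))

/-- `h₁ = 2 σ² Tr(B) / λ₀²`. -/
def hOne (b : Fin d → Vec d) (σ : ℝ) : ℝ := 2 * σ ^ 2 * (gram b).trace / lambdaZero b ^ 2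

/-- The error bound `ε_c = √(h₁ ln(2 d c² / δ) / c)`. -/
def errBound (b : Fin d → Vec d) (σ δ : ℝ) (c : ℕ) : ℝ :=
  Real.sqrt (hOne b σ * Real.log (2 * d * (c : ℝ) ^ 2 / δ) / c)

/-- The least squares estimate `(c B)⁻¹ ∑_{s=1}^c ∑_k b_k Y_k(s)`, where the reward `Y_k(s)` is
observed at time `start s + k`. -/
def olsEstimate (b : Fin d → Vec d) (Y : ℕ → ℝ) (start : ℕ → ℕ) (c : ℕ) : Vec d :=
  WithLp.toLp 2 (((c : ℝ) • gram b)⁻¹.mulVec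
    (∑ s ∈ Finset.Icc 1 c, ∑ k : Fin d, Y (start s + k) • (b k).ofLp))

/-- An (infinite) run of APSEE-G which plays the action `x t` and observes the reward `Y t` at the
times `t = 0, 1, 2, …`. The cycles are `c = 1, 2, …`. -/
structure APSEEGRun (X : Set (Vec d)) (b : Fin d → Vec d) (H : ℕ) (σ δ : ℝ)
    (x : ℕ → Vec d) (Y : ℕ → ℝ) where
  /-- the time at which cycle `c` starts -/
  start : ℕ → ℕ
  /-- the estimate `θ̂_c` computed in cycle `c` -/
  est : ℕ → Vec d
  /-- the greedy picks for the parameter `θ̂_c` -/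
  pick : ℕ → ℕ → Fin d
  /-- `S_est` after the verification step of cycle `c`; `none` as long as it is not found -/
  supp : ℕ → Option (Finset (Fin d))
  /-- the action exploited in cycle `c` (irrelevant as long as the support is not found) -/
  action : ℕ → Vec d
  start_one : start 1 = 0
  /-- a cycle has `d` exploration steps, then `c` exploitation steps if the support is found -/
  start_succ : ∀ c, 1 ≤ c → start (c + 1) = start c + d + (if (supp c).isSome then c else 0)
  explore : ∀ c, 1 ≤ c → ∀ k : Fin d, x (start c + k) = b k
  est_eq : ∀ c, 1 ≤ c → est c = olsEstimate b Y start c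
  pick_greedy : ∀ c, 1 ≤ c → IsGreedy X H (est c) (pick c)
  supp_zero : supp 0 = none
  /-- once found, the support is kept -/
  supp_locked : ∀ c S, supp c = some S → supp (c + 1) = some S
  /-- the stopping condition holds: the greedy support becomes `S_est` -/
  supp_found : ∀ c, supp c = none →
    ((2 * lmax X * errBound b σ δ (c + 1) : ℝ) : EReal)
        < greedyGap X H (est (c + 1)) (pick (c + 1)) →
      supp (c + 1) = some (picked (pick (c + 1)) H)
  /-- the stopping condition fails: the warm-up goes on -/
  supp_not_found : ∀ c, supp c = none →
    ¬ (((2 * lmax X * errBound b σ δ (c + 1) : ℝ) : EReal)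
        < greedyGap X H (est (c + 1)) (pick (c + 1))) →
      supp (c + 1) = none
  action_best : ∀ c, 1 ≤ c → ∀ S, supp c = some S → IsBestAction X S (est c) (action c)
  exploit : ∀ c, 1 ≤ c → (supp c).isSome → ∀ j < c, x (start c + d + j) = action c

/-- `C₀` is the duration (in cycles) of the warm-up phase: the first cycle in which the stopping
condition is met. -/
def APSEEGRun.IsWarmUp {X : Set (Vec d)} {b : Fin d → Vec d} {H : ℕ} {σ δ : ℝ}
    {x : ℕ → Vec d} {Y : ℕ → ℝ} (run : APSEEGRun X b H σ δ x Y) (C₀ : ℕ) : Prop :=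
  IsLeast {c | (run.supp c).isSome} C₀

/-- The cumulative `α`-regret of the first `T` actions. -/
def alphaRegret (X : Set (Vec d)) (H : ℕ) (θ : Vec d) (α : ℝ) (x : ℕ → Vec d) (T : ℕ) : ℝ :=
  α * (∑ _t ∈ Finset.range T, opt X H θ) - ∑ t ∈ Finset.range T, inner ℝ θ (x t)

/-- `α = 1 - e^{-γ}` with `γ` the submodularity ratio of `S ↦ h(S; θ)`. -/
def greedyAlpha (X : Set (Vec d)) (θ : Vec d) : ℝ :=
  1 - Real.exp (-submodularityRatio fun S => value X S θ)

/-- `max {1, L_max² h₁ / Δ²}`, the order of the warm-up duration up to a logarithm. -/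
def hardness (X : Set (Vec d)) (b : Fin d → Vec d) (σ Δ : ℝ) : ℝ :=
  max 1 (lmax X ^ 2 * hOne b σ / Δ ^ 2)

/-! ### The noise -/

/-- The `σ`-algebra generated by the actions up to time `t` and the noise before time `t`. -/
abbrev history {Ω : Type*} (x : ℕ → Ω → Vec d) (η : ℕ → Ω → ℝ) (t : ℕ) : MeasurableSpace Ω :=
  (⨆ s ∈ Set.Iic t, MeasurableSpace.comap (x s) inferInstance) ⊔
    (⨆ s ∈ Set.Iio t, MeasurableSpace.comap (η s) inferInstance)

/-- Given the history, `η t` has mean zero and is `σ`-sub-Gaussian. -/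
structure IsCondSubGaussian {Ω : Type*} [MeasurableSpace Ω] (μ : Measure Ω)
    (x : ℕ → Ω → Vec d) (η : ℕ → Ω → ℝ) (σ : ℝ) : Prop where
  integrable_exp : ∀ t (l : ℝ), Integrable (fun ω => Real.exp (l * η t ω)) μ
  mean_zero : ∀ t, μ[η t | history x η t] =ᵐ[μ] 0
  mgf_le : ∀ t (l : ℝ), μ[fun ω => Real.exp (l * η t ω) | history x η t]
    ≤ᵐ[μ] fun _ => Real.exp (l ^ 2 * σ ^ 2 / 2)

end SparseBandit

end

noncomputable section

namespace SparseBandit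

variable {d : ℕ}

/-! ### The action set and the value function -/

/-! The argument has a probabilistic half and a deterministic half, joined by the event that every
estimate satisfies `‖θ̂_c - θ‖ ≤ (24/25) ε_c`.

Probability. Cycle lengths depend on when the support is fixed, so exploration times are random.
They are however predictable: whether the support is known after cycle `c` is a function of the
estimates of a hypothetical run that only explores, hence of data before time `c * d`
(`APSEEGRun.isSome_supp_iff`, `measurableSet_start_add_eq`). Noise sampled at distinct predictable
times is jointly sub-Gaussian (`lintegral_exp_sampled_le`), so the estimation error is a
sub-Gaussian vector with variance proxy `σ² / (c λ₀)`. Integrating its moment generating function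
against a Gaussian gives a norm tail (`measure_norm_sq_gt_le`), and a union bound over the cycles
yields `exists_good_event`.

Support. Differences of gains are `2 L_max`-Lipschitz in the parameter, so a gap exceeding `2 L_max
ε_c` forces the greedy picks for the estimate and for `θ` to agree (`IsGreedy.eq_of_gap`). The test
is passed once `4 L_max ε_c < Δ`, which bounds `C₀`. Conversely, the slack `1/25` in the error gives
`L_max ε_{C₀} ≤ (25/2) Δ` when the test is passed.

Exploitation. Strong convexity makes the loss on the support `S` quadratic in the error: `‖θ_S‖ *
loss ≤ 4 R ‖θ̂ - θ‖²` (`norm_proj_mul_regret_le`). The bound requires `‖θ‖` in place of `‖θ_S‖`. If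
`‖θ_S‖` is at least a fixed multiple of `‖θ‖ / d`, this costs a factor `d`. Otherwise a large
coordinate lies outside `S`; since greedy passed it over, the values along the greedy path, and with
them `Δ`, must be tiny, and the loss is at most `Δ / 2`. For `H ≥ 2` the gap also improves the `1 -
e^{-γ}` guarantee by `Δ / 2` (`greedyAlpha_mul_opt_add_le`), so the `α`-regret of such a block is
nonpositive (`exploit_of_small_proj`). For `H = 1` only the sign of one coordinate matters, and it
is estimated correctly.

Summation. After warm-up, the growing blocks allow only `O(√T)` cycles up to time `T`. Exploration
costs `O(d L_max ‖θ‖)` per cycle and exploitation `O(d h₁ / ‖θ‖)` up to a logarithm. -/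

lemma bddAbove_norm_image {X : Set (Vec d)} (hb : Bornology.IsBounded X) :
    BddAbove ((fun x => ‖x‖) '' X) := by
  obtain ⟨C, hC⟩ := hb.exists_norm_le
  exact ⟨C, by rintro _ ⟨x, hx, rfl⟩; exact hC x hx⟩

lemma norm_le_lmax {X : Set (Vec d)} (hb : Bornology.IsBounded X) {x : Vec d} (hx : x ∈ X) :
    ‖x‖ ≤ lmax X :=
  le_csSup (bddAbove_norm_image hb) ⟨x, hx, rfl⟩

lemma lmax_nonneg (X : Set (Vec d)) : 0 ≤ lmax X :=
  Real.sSup_nonneg (by rintro _ ⟨x, -, rfl⟩; exact norm_nonneg x)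

lemma inner_le_lmax_mul {X : Set (Vec d)} (hb : Bornology.IsBounded X) {x : Vec d} (hx : x ∈ X)
    (θ : Vec d) : inner ℝ θ x ≤ lmax X * ‖θ‖ := by
  calc inner ℝ θ x ≤ ‖θ‖ * ‖x‖ := real_inner_le_norm θ x
    _ ≤ ‖θ‖ * lmax X := by gcongr; exact norm_le_lmax hb hx
    _ = _ := mul_comm _ _

lemma neg_lmax_mul_le_inner {X : Set (Vec d)} (hb : Bornology.IsBounded X) {x : Vec d}
    (hx : x ∈ X) (θ : Vec d) : -(lmax X * ‖θ‖) ≤ inner ℝ θ x := by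
  have := inner_le_lmax_mul hb hx (-θ)
  rw [inner_neg_left, norm_neg] at this
  linarith

lemma zero_mem_restrict {X : Set (Vec d)} (h0 : (0 : Vec d) ∈ X) (S : Finset (Fin d)) :
    (0 : Vec d) ∈ restrict X S :=
  ⟨h0, fun _ _ => rfl⟩

lemma restrict_mono (X : Set (Vec d)) {S T : Finset (Fin d)} (h : S ⊆ T) :
    restrict X S ⊆ restrict X T :=
  fun _ hx => ⟨hx.1, fun i hi => hx.2 i fun h' => hi (h h')⟩

lemma isCompact_restrict {X : Set (Vec d)} (hc : IsClosed X) (hb : Bornology.IsBounded X)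
    (S : Finset (Fin d)) : IsCompact (restrict X S) := by
  have : restrict X S = X ∩ ⋂ i, ⋂ (_ : i ∉ S), {x : Vec d | x i = 0} := by
    ext x; simp [restrict, SupportedOn]
  rw [this]
  refine (Metric.isCompact_of_isClosed_isBounded hc hb).inter_right ?_
  refine isClosed_iInter fun i => isClosed_iInter fun _ => ?_
  exact isClosed_eq (by fun_prop) continuous_const

lemma exists_isBestAction {X : Set (Vec d)} (hc : IsClosed X) (hb : Bornology.IsBounded X)
    (h0 : (0 : Vec d) ∈ X) (S : Finset (Fin d)) (θ : Vec d) : ∃ a, IsBestAction X S θ a := by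
  obtain ⟨a, ha, hmax⟩ := (isCompact_restrict hc hb S).exists_isMaxOn
    ⟨0, zero_mem_restrict h0 S⟩ (f := fun x => inner ℝ θ x) (by fun_prop)
  exact ⟨a, ha, fun x hx => hmax hx⟩

lemma IsBestAction.value_eq {X : Set (Vec d)} {S : Finset (Fin d)} {θ a : Vec d}
    (h : IsBestAction X S θ a) : value X S θ = inner ℝ θ a := by
  have : IsGreatest ((fun x => inner ℝ θ x) '' restrict X S) (inner ℝ θ a) :=
    ⟨⟨a, h.1, rfl⟩, by rintro _ ⟨x, hx, rfl⟩; exact h.2 x hx⟩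
  exact this.csSup_eq

lemma inner_le_value {X : Set (Vec d)} (hb : Bornology.IsBounded X) {S : Finset (Fin d)}
    {x : Vec d} (hx : x ∈ restrict X S) (θ : Vec d) : inner ℝ θ x ≤ value X S θ :=
  le_csSup ⟨lmax X * ‖θ‖, by rintro _ ⟨y, hy, rfl⟩; exact inner_le_lmax_mul hb hy.1 θ⟩
    ⟨x, hx, rfl⟩

lemma value_le {X : Set (Vec d)} (h0 : (0 : Vec d) ∈ X) {S : Finset (Fin d)} {θ : Vec d} {r : ℝ}
    (h : ∀ x ∈ restrict X S, inner ℝ θ x ≤ r) : value X S θ ≤ r :=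
  csSup_le ⟨_, 0, zero_mem_restrict h0 S, rfl⟩ (by rintro _ ⟨x, hx, rfl⟩; exact h x hx)

lemma value_mono {X : Set (Vec d)} (hb : Bornology.IsBounded X) (h0 : (0 : Vec d) ∈ X)
    {S T : Finset (Fin d)} (h : S ⊆ T) (θ : Vec d) : value X S θ ≤ value X T θ :=
  value_le h0 fun _ hx => inner_le_value hb (restrict_mono X h hx) θ

lemma value_nonneg {X : Set (Vec d)} (hb : Bornology.IsBounded X) (h0 : (0 : Vec d) ∈ X)
    (S : Finset (Fin d)) (θ : Vec d) : 0 ≤ value X S θ := by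
  simpa using inner_le_value hb (zero_mem_restrict h0 S) θ

lemma value_empty {X : Set (Vec d)} (hb : Bornology.IsBounded X) (h0 : (0 : Vec d) ∈ X)
    (θ : Vec d) : value X ∅ θ = 0 := by
  refine le_antisymm (value_le h0 fun x hx => ?_) (value_nonneg hb h0 _ θ)
  have : x = 0 := by ext i; exact hx.2 i (by simp)
  simp [this]

lemma gain_nonneg {X : Set (Vec d)} (hb : Bornology.IsBounded X) (h0 : (0 : Vec d) ∈ X)
    (θ : Vec d) (G : Finset (Fin d)) (v : Fin d) : 0 ≤ gain X θ G v :=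
  sub_nonneg.2 (value_mono hb h0 (Finset.subset_insert v G) θ)

/-- Each feasible action changes its reward by at most `lmax X * ‖θ' - θ‖`, hence so does the
maximum. Every stability statement about greedy rests on this. -/
lemma value_le_value_add {X : Set (Vec d)} (hb : Bornology.IsBounded X) (h0 : (0 : Vec d) ∈ X)
    (S : Finset (Fin d)) (θ θ' : Vec d) :
    value X S θ ≤ value X S θ' + lmax X * ‖θ' - θ‖ := by
  refine value_le h0 fun x hx => ?_
  have h1 := inner_le_value hb hx θ'
  have h2 := neg_lmax_mul_le_inner hb hx.1 (θ' - θ)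
  rw [inner_sub_left] at h2
  linarith

lemma continuous_value {X : Set (Vec d)} (hb : Bornology.IsBounded X) (h0 : (0 : Vec d) ∈ X)
    (S : Finset (Fin d)) : Continuous (value X S) := by
  refine (LipschitzWith.of_dist_le_mul (K := (lmax X).toNNReal) fun θ θ' => ?_).continuous
  rw [Real.coe_toNNReal _ (lmax_nonneg X), Real.dist_eq, dist_eq_norm, abs_sub_le_iff]
  have h1 := value_le_value_add hb h0 S θ θ'
  have h2 := value_le_value_add hb h0 S θ' θ
  rw [norm_sub_rev] at h1
  constructor <;> linarith

lemma continuous_gain {X : Set (Vec d)} (hb : Bornology.IsBounded X) (h0 : (0 : Vec d) ∈ X)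
    (G : Finset (Fin d)) (v : Fin d) : Continuous fun θ => gain X θ G v :=
  (continuous_value hb h0 _).sub (continuous_value hb h0 _)

/-! ### Sparse optimum -/

lemma bddAbove_sparse {X : Set (Vec d)} (hb : Bornology.IsBounded X) (H : ℕ) (θ : Vec d) :
    BddAbove ((fun x => inner ℝ θ x) '' {x ∈ X | IsSparse H x}) :=
  ⟨lmax X * ‖θ‖, by rintro _ ⟨y, hy, rfl⟩; exact inner_le_lmax_mul hb hy.1 θ⟩

lemma opt_nonneg {X : Set (Vec d)} (hb : Bornology.IsBounded X) (h0 : (0 : Vec d) ∈ X)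
    (H : ℕ) (θ : Vec d) : 0 ≤ opt X H θ := by
  have : inner ℝ θ (0 : Vec d) ≤ opt X H θ :=
    le_csSup (bddAbove_sparse hb H θ) ⟨0, ⟨h0, ∅, by simp, fun _ _ => rfl⟩, rfl⟩
  simpa using this

lemma opt_le {X : Set (Vec d)} (hb : Bornology.IsBounded X) (h0 : (0 : Vec d) ∈ X) {H : ℕ}
    {θ : Vec d} {r : ℝ} (h : ∀ W : Finset (Fin d), W.card ≤ H → value X W θ ≤ r) :
    opt X H θ ≤ r := by
  refine csSup_le ⟨_, 0, ⟨h0, ∅, by simp, fun _ _ => rfl⟩, rfl⟩ ?_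
  rintro _ ⟨x, ⟨hx, W, hW, hs⟩, rfl⟩
  exact (inner_le_value hb ⟨hx, hs⟩ θ).trans (h W hW)

lemma opt_le_lmax_mul {X : Set (Vec d)} (hb : Bornology.IsBounded X) (h0 : (0 : Vec d) ∈ X)
    (H : ℕ) (θ : Vec d) : opt X H θ ≤ lmax X * ‖θ‖ :=
  opt_le hb h0 fun _ _ => value_le h0 fun _ hx => inner_le_lmax_mul hb hx.1 θ

/-! ### Strong convexity -/

/-- In each ball of radius `R` the parallelogram law puts the midpoint at distance at most `√(R² -
D²/4) ≤ R - D²/(8R)` from the centre, where `D = ‖x - y‖`. This leaves room for `w`. -/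
lemma IsStronglyConvexSet.midpoint_add_mem {R : ℝ} {X : Set (Vec d)}
    (h : IsStronglyConvexSet R X) (hR : 0 < R) {x y w : Vec d} (hx : x ∈ X) (hy : y ∈ X)
    (hw : ‖w‖ ≤ ‖x - y‖ ^ 2 / (8 * R)) : (1 / 2 : ℝ) • (x + y) + w ∈ X := by
  obtain ⟨A, rfl⟩ := h
  simp only [Set.mem_iInter, Metric.mem_closedBall, dist_eq_norm] at hx hy ⊢
  intro z hz
  have hx := hx z hz
  have hy := hy z hz
  have hpar := parallelogram_law_with_norm ℝ (x - z) (y - z)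
  have e1 : x - z - (y - z) = x - y := by abel
  have e2 : x - z + (y - z) = (2 : ℝ) • ((1 / 2 : ℝ) • (x + y) - z) := by module
  rw [e1, e2, norm_smul, Real.norm_eq_abs, abs_of_pos (by norm_num : (0 : ℝ) < 2)] at hpar
  set m := ‖(1 / 2 : ℝ) • (x + y) - z‖
  set D := ‖x - y‖
  have hD : D ≤ 2 * R := by
    calc D = ‖(x - z) - (y - z)‖ := by rw [e1]
      _ ≤ ‖x - z‖ + ‖y - z‖ := norm_sub_le _ _
      _ ≤ 2 * R := by linarith
  have hD0 : 0 ≤ D := norm_nonneg _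
  have hm : m ^ 2 ≤ R ^ 2 - D ^ 2 / 4 := by
    nlinarith [norm_nonneg (x - z), norm_nonneg (y - z)]
  have hm' : m ≤ R - D ^ 2 / (8 * R) := by
    have h2 : D ^ 2 / (8 * R) ≤ R := by
      rw [div_le_iff₀ (by positivity)]; nlinarith
    refine abs_le_of_sq_le_sq' ?_ (by linarith) |>.2
    have h3 : D ^ 2 / (8 * R) * R = D ^ 2 / 8 := by field_simp
    nlinarith [sq_nonneg (D ^ 2 / (8 * R))]
  calc ‖(1 / 2 : ℝ) • (x + y) + w - z‖ = ‖((1 / 2 : ℝ) • (x + y) - z) + w‖ := by congr 1; abel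
    _ ≤ m + ‖w‖ := norm_add_le _ _
    _ ≤ R := by linarith

lemma IsStronglyConvexSet.lmax_le {R : ℝ} {X : Set (Vec d)} (h : IsStronglyConvexSet R X)
    (hd : 0 < d) (hb : Bornology.IsBounded X) (h0 : (0 : Vec d) ∈ X) (hR : 0 < R) :
    lmax X ≤ 2 * R := by
  obtain ⟨A, rfl⟩ := h
  have hA : A.Nonempty := by
    rw [Set.nonempty_iff_ne_empty]
    rintro rfl
    have : Nonempty (Fin d) := ⟨⟨0, hd⟩⟩
    simp only [Set.mem_empty_iff_false, Set.iInter_of_empty, Set.iInter_univ] at hb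
    exact NormedSpace.unbounded_univ ℝ (Vec d) hb
  obtain ⟨z, hz⟩ := hA
  simp only [Set.mem_iInter, Metric.mem_closedBall, dist_eq_norm] at h0
  refine Real.sSup_le ?_ (by positivity)
  rintro _ ⟨x, hx, rfl⟩
  simp only [Set.mem_iInter, Metric.mem_closedBall, dist_eq_norm] at hx
  have h1 := hx z hz
  have h2 := h0 z hz
  calc ‖x‖ = ‖(x - z) - (0 - z)‖ := by congr 1; abel
    _ ≤ ‖x - z‖ + ‖0 - z‖ := norm_sub_le _ _
    _ ≤ 2 * R := by linarith

/-! ### Coordinate projections and the quadratic loss of a perturbed maximizer -/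

/-- The restriction of `θ` to the coordinates in `S`. -/
def proj (S : Finset (Fin d)) (θ : Vec d) : Vec d := WithLp.toLp 2 fun i => if i ∈ S then θ i else 0

lemma proj_apply (S : Finset (Fin d)) (θ : Vec d) (i : Fin d) :
    proj S θ i = if i ∈ S then θ i else 0 := rfl

lemma supportedOn_proj (S : Finset (Fin d)) (θ : Vec d) : SupportedOn (proj S θ) S :=
  fun i hi => by simp [proj_apply, hi]

lemma inner_eq_inner_proj {S : Finset (Fin d)} {x : Vec d} (hx : SupportedOn x S) (θ : Vec d) :
    inner ℝ θ x = inner ℝ (proj S θ) x := by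
  simp only [PiLp.inner_apply]
  refine Finset.sum_congr rfl fun i _ => ?_
  by_cases hi : i ∈ S
  · simp [proj_apply, hi]
  · simp [hx i hi]

lemma norm_proj_sq (S : Finset (Fin d)) (θ : Vec d) :
    ‖proj S θ‖ ^ 2 = ∑ i ∈ S, θ i ^ 2 := by
  rw [EuclideanSpace.norm_sq_eq]
  simp [proj_apply, apply_ite, Finset.sum_ite_mem]

lemma inner_proj_self (S : Finset (Fin d)) (θ : Vec d) :
    inner ℝ θ (proj S θ) = ‖proj S θ‖ ^ 2 := by
  rw [inner_eq_inner_proj (supportedOn_proj S θ), real_inner_self_eq_norm_sq]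

lemma inner_le_lmax_mul_proj {X : Set (Vec d)} (hb : Bornology.IsBounded X)
    {S : Finset (Fin d)} {x : Vec d} (hx : x ∈ restrict X S) (θ : Vec d) :
    inner ℝ θ x ≤ lmax X * ‖proj S θ‖ := by
  rw [inner_eq_inner_proj hx.2]
  exact inner_le_lmax_mul hb hx.1 _

/-- Playing the best action for an estimate costs at most a multiple of the squared error. -/
lemma norm_proj_mul_regret_le {R : ℝ} {X : Set (Vec d)} (h : IsStronglyConvexSet R X)
    (hR : 0 < R) {S : Finset (Fin d)} {θ θ' x a : Vec d} (hx : IsBestAction X S θ x)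
    (ha : IsBestAction X S θ' a) :
    ‖proj S θ‖ * inner ℝ θ (x - a) ≤ 4 * R * ‖θ' - θ‖ ^ 2 := by
  set r := inner ℝ θ (x - a) with hr
  set s := ‖proj S θ‖ with hs
  set D := ‖x - a‖ with hD
  have hs0 : 0 ≤ s := norm_nonneg _
  have hr0 : 0 ≤ r := by rw [hr, inner_sub_right]; linarith [hx.2 a ha.1]
  have h1 : r ≤ ‖θ' - θ‖ * D := by
    have h2 := ha.2 x hx.1
    have h3 : inner ℝ (θ - θ') (x - a) ≤ ‖θ - θ'‖ * ‖x - a‖ := real_inner_le_norm _ _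
    rw [norm_sub_rev] at h3
    rw [inner_sub_left, inner_sub_right θ'] at h3
    linarith
  -- The midpoint of `x` and `a` can be pushed by `D²/(8R)` in the direction of `proj S θ` while
  -- staying feasible. Optimality of `x` against that point bounds `D²` by the loss `r`; with `r ≤
  -- ‖θ' - θ‖ * D` this gives the quadratic bound.
  have h2 : s * D ^ 2 ≤ 4 * R * r := by
    rcases hs0.eq_or_lt with h0 | hpos
    · rw [← h0]; simp; positivity
    set w : Vec d := (D ^ 2 / (8 * R) / s) • proj S θ with hw
    have hwn : ‖w‖ = D ^ 2 / (8 * R) := by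
      rw [hw, norm_smul, Real.norm_eq_abs, abs_of_nonneg (by positivity), ← hs]
      field_simp
    have hmem : (1 / 2 : ℝ) • (x + a) + w ∈ restrict X S := by
      refine ⟨h.midpoint_add_mem hR hx.1.1 ha.1.1 hwn.le, fun i hi => ?_⟩
      simp [hx.1.2 i hi, ha.1.2 i hi, hw, proj_apply, hi]
    have h3 := hx.2 _ hmem
    rw [inner_add_right, inner_smul_right, inner_add_right, hw, inner_smul_right,
      inner_proj_self, ← hs] at h3
    have h4 : D ^ 2 / (8 * R) / s * s ^ 2 = D ^ 2 * s / (8 * R) := by field_simp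
    rw [h4] at h3
    have h5 : D ^ 2 * s / (8 * R) ≤ r / 2 := by rw [hr, inner_sub_right]; linarith
    rw [div_le_iff₀ (by positivity)] at h5
    linarith
  rcases hr0.eq_or_lt with h0 | hpos
  · rw [← h0]; simp; positivity
  refine le_of_mul_le_mul_right ?_ hpos
  have h3 : r ^ 2 ≤ ‖θ' - θ‖ ^ 2 * D ^ 2 := by
    rw [← mul_pow]; exact pow_le_pow_left₀ hr0 h1 2
  calc s * r * r = s * r ^ 2 := by ring
    _ ≤ s * (‖θ' - θ‖ ^ 2 * D ^ 2) := by gcongr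
    _ = ‖θ' - θ‖ ^ 2 * (s * D ^ 2) := by ring
    _ ≤ ‖θ' - θ‖ ^ 2 * (4 * R * r) := by gcongr
    _ = _ := by ring

/-- A long section of a strongly convex set makes room in every further direction. -/
lemma abs_coord_mul_le_value {R : ℝ} {X : Set (Vec d)} (h : IsStronglyConvexSet R X)
    (hb : Bornology.IsBounded X) (h0 : (0 : Vec d) ∈ X) (hR : 0 < R) {S : Finset (Fin d)}
    {θ p : Vec d} (hp : p ∈ restrict X S) (hpos : 0 ≤ inner ℝ θ p) (i : Fin d) :
    |θ i| * ‖p‖ ^ 2 ≤ 8 * R * value X (insert i S) θ := by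
  -- The midpoint of `p` and `0` is moved along axis `i` with the sign of `θ i`; the contribution of
  -- `p / 2` is nonnegative and is dropped.
  set w : Vec d := EuclideanSpace.single i (SignType.sign (θ i) * (‖p‖ ^ 2 / (8 * R)) : ℝ) with hw
  have hwn : ‖w‖ ≤ ‖p - 0‖ ^ 2 / (8 * R) := by
    rw [hw, PiLp.norm_single, sub_zero, norm_mul, Real.norm_eq_abs, Real.norm_eq_abs,
      abs_of_nonneg (by positivity : 0 ≤ ‖p‖ ^ 2 / (8 * R))]
    refine mul_le_of_le_one_left (by positivity) ?_
    rcases lt_trichotomy (θ i) 0 with h | h | h <;> simp [h]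
  have hmem : (1 / 2 : ℝ) • (p + 0) + w ∈ restrict X (insert i S) := by
    refine ⟨h.midpoint_add_mem hR hp.1 h0 hwn, fun j hj => ?_⟩
    rw [Finset.mem_insert, not_or] at hj
    simp [hp.2 j hj.2, hw, hj.1]
  have h1 := inner_le_value hb hmem θ
  rw [add_zero, inner_add_right, inner_smul_right, hw, EuclideanSpace.inner_single_right] at h1
  have h2 : (SignType.sign (θ i) : ℝ) * θ i = |θ i| := sign_mul_self _
  have h3 : |θ i| * (‖p‖ ^ 2 / (8 * R)) ≤ value X (insert i S) θ := by
    rw [← h2]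
    simp only [conj_trivial] at h1
    nlinarith
  rw [mul_div_assoc', div_le_iff₀ (by positivity)] at h3
  linarith

/-! ### Greedy gaps as real numbers -/

/-- The supremum runs over a finite family: it is attained by a runner-up, or it is `⊥` when there
is none. This reduces extended-real gaps to inequalities between real gains. -/
lemma stepGap_cases (X : Set (Vec d)) (θ : Vec d) (g : ℕ → Fin d) (k : ℕ) :
    ((∀ v, v ∉ picked g k → v = g k) ∧ stepGap X θ g k = ⊤) ∨
      ∃ v, v ∉ picked g k ∧ v ≠ g k ∧
        stepGap X θ g k =
          ((gain X θ (picked g k) (g k) - gain X θ (picked g k) v : ℝ) : EReal) ∧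
        ∀ w, w ∉ picked g k → w ≠ g k → gain X θ (picked g k) w ≤ gain X θ (picked g k) v := by
  rcases isEmpty_or_nonempty {v : Fin d // v ∉ picked g k ∧ v ≠ g k} with hE | hN
  · left
    refine ⟨fun v hv => by_contra fun hne => hE.elim ⟨v, hv, hne⟩, ?_⟩
    rw [stepGap, iSup_of_empty, EReal.coe_sub_bot]
  · right
    obtain ⟨⟨v, hv⟩, hmax⟩ := exists_eq_ciSup_of_finite
      (f := fun v : {v : Fin d // v ∉ picked g k ∧ v ≠ g k} =>
        (gain X θ (picked g k) v : EReal))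
    refine ⟨v, hv.1, hv.2, ?_, fun w hw hw' => ?_⟩
    · rw [stepGap, ← hmax, EReal.coe_sub]
    · have := le_iSup (fun v : {v : Fin d // v ∉ picked g k ∧ v ≠ g k} =>
        (gain X θ (picked g k) v : EReal)) ⟨w, hw, hw'⟩
      rw [← hmax] at this
      exact EReal.coe_le_coe_iff.1 this

lemma lt_greedyGap_iff {X : Set (Vec d)} {H : ℕ} {θ : Vec d} {g : ℕ → Fin d} {r : ℝ} :
    (r : EReal) < greedyGap X H θ g ↔ ∀ k < H, ∀ v, v ∉ picked g k → v ≠ g k →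
      gain X θ (picked g k) v + r < gain X θ (picked g k) (g k) := by
  constructor
  · intro h k hk v hv hne
    have h1 : (r : EReal) < stepGap X θ g k := h.trans_le (iInf_le _ (⟨k, hk⟩ : Fin H))
    rcases stepGap_cases X θ g k with ⟨h2, -⟩ | ⟨w, -, -, h2, h3⟩
    · exact absurd (h2 v hv) hne
    · rw [h2, EReal.coe_lt_coe_iff] at h1
      linarith [h3 v hv hne]
  · intro h
    rcases isEmpty_or_nonempty (Fin H) with hE | hN
    · rw [greedyGap, iInf_of_empty]; exact EReal.coe_lt_top r
    obtain ⟨k, hk⟩ := exists_eq_ciInf_of_finite (f := fun k : Fin H => stepGap X θ g k)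
    rw [greedyGap, ← hk]
    rcases stepGap_cases X θ g k with ⟨-, h2⟩ | ⟨w, hw, hw', h2, -⟩
    · rw [h2]; exact EReal.coe_lt_top r
    · rw [h2, EReal.coe_lt_coe_iff]
      linarith [h k k.2 w hw hw']

lemma greedyGap_eq_coe {X : Set (Vec d)} {H : ℕ} {θ : Vec d} {g : ℕ → Fin d} {r : ℝ}
    (h : greedyGap X H θ g = r) :
    (∀ k < H, ∀ v, v ∉ picked g k → v ≠ g k →
      gain X θ (picked g k) v + r ≤ gain X θ (picked g k) (g k)) ∧
    ∃ k < H, ∃ v, v ∉ picked g k ∧ v ≠ g k ∧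
      gain X θ (picked g k) v + r = gain X θ (picked g k) (g k) := by
  constructor
  · intro k hk v hv hne
    have h1 : (r : EReal) ≤ stepGap X θ g k := h ▸ iInf_le _ (⟨k, hk⟩ : Fin H)
    rcases stepGap_cases X θ g k with ⟨h2, -⟩ | ⟨w, -, -, h2, h3⟩
    · exact absurd (h2 v hv) hne
    · rw [h2, EReal.coe_le_coe_iff] at h1
      linarith [h3 v hv hne]
  · rcases isEmpty_or_nonempty (Fin H) with hE | hN
    · rw [greedyGap, iInf_of_empty] at h
      exact absurd h.symm (EReal.coe_ne_top r)
    obtain ⟨k, hk⟩ := exists_eq_ciInf_of_finite (f := fun k : Fin H => stepGap X θ g k)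
    rw [greedyGap, ← hk] at h
    rcases stepGap_cases X θ g k with ⟨-, h2⟩ | ⟨w, hw, hw', h2, -⟩
    · rw [h2] at h
      exact absurd h.symm (EReal.coe_ne_top r)
    · rw [h2, EReal.coe_eq_coe_iff] at h
      exact ⟨k, k.2, w, hw, hw', by linarith⟩

/-! ### Greedy picks -/

lemma picked_succ (g : ℕ → Fin d) (k : ℕ) : picked g (k + 1) = insert (g k) (picked g k) := by
  rw [picked, Finset.range_add_one, Finset.image_insert, picked]

lemma picked_zero (g : ℕ → Fin d) : picked g 0 = ∅ := by simp [picked]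

lemma picked_mono (g : ℕ → Fin d) {k l : ℕ} (h : k ≤ l) : picked g k ⊆ picked g l :=
  Finset.image_subset_image (Finset.range_mono h)

lemma picked_congr {g g' : ℕ → Fin d} {k : ℕ} (h : ∀ j < k, g j = g' j) :
    picked g k = picked g' k :=
  Finset.image_congr fun j hj => h j (by simpa using hj)

lemma value_picked_succ (X : Set (Vec d)) (θ : Vec d) (g : ℕ → Fin d) (k : ℕ) :
    value X (picked g (k + 1)) θ = value X (picked g k) θ + gain X θ (picked g k) (g k) := by
  rw [picked_succ, gain]; ring

/-- The common term `value X G` cancels in the difference, so only two values move and the factor is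
`2` instead of `4`. -/
lemma gain_sub_gain_le {X : Set (Vec d)} (hb : Bornology.IsBounded X) (h0 : (0 : Vec d) ∈ X)
    (θ θ' : Vec d) (G : Finset (Fin d)) (v w : Fin d) :
    gain X θ G v - gain X θ G w ≤ gain X θ' G v - gain X θ' G w + 2 * lmax X * ‖θ' - θ‖ := by
  have h1 := value_le_value_add hb h0 (insert v G) θ θ'
  have h2 := value_le_value_add hb h0 (insert w G) θ' θ
  rw [norm_sub_rev θ θ'] at h2
  simp only [gain]
  linarith

/-- If the greedy picks for `θ'` have a gap exceeding the estimation error, then they are the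
greedy picks for `θ`. -/
lemma IsGreedy.eq_of_gap {X : Set (Vec d)} (hb : Bornology.IsBounded X) (h0 : (0 : Vec d) ∈ X)
    {H : ℕ} {θ θ' : Vec d} {g g' : ℕ → Fin d} (hg : IsGreedy X H θ g)
    (hg' : IsGreedy X H θ' g') {r : ℝ} (hr : 2 * lmax X * ‖θ' - θ‖ ≤ r)
    (hgap : ∀ k < H, ∀ v, v ∉ picked g' k → v ≠ g' k →
      gain X θ' (picked g' k) v + r < gain X θ' (picked g' k) (g' k)) :
    ∀ k < H, g' k = g k := by
  intro k
  induction k using Nat.strong_induction_on with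
  | _ k ih =>
    intro hk
    have hp : picked g' k = picked g k := picked_congr fun j hj => ih j hj (hj.trans hk)
    by_contra hne
    have h1 := hgap k hk (g k) (hp ▸ (hg k hk).1) (Ne.symm hne)
    have h2 := (hg k hk).2 (g' k) (hp ▸ (hg' k hk).1)
    have h3 := gain_sub_gain_le hb h0 θ' θ (picked g k) (g' k) (g k)
    rw [norm_sub_rev] at h3
    rw [hp] at h1
    linarith

lemma IsGreedy.gap_transfer {X : Set (Vec d)} (hb : Bornology.IsBounded X)
    (h0 : (0 : Vec d) ∈ X) {H : ℕ} {θ θ' : Vec d} {g g' : ℕ → Fin d} (hg' : IsGreedy X H θ' g')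
    {r : ℝ} (hr : 2 * lmax X * ‖θ' - θ‖ < r)
    (hgap : ∀ k < H, ∀ v, v ∉ picked g k → v ≠ g k →
      gain X θ (picked g k) v + r ≤ gain X θ (picked g k) (g k))
    (hg : IsGreedy X H θ g) :
    ∀ k < H, ∀ v, v ∉ picked g' k → v ≠ g' k →
      gain X θ' (picked g' k) v + (r - 2 * lmax X * ‖θ' - θ‖)
        ≤ gain X θ' (picked g' k) (g' k) := by
  have heq : ∀ k < H, g k = g' k := by
    -- The roles of the two parameters are swapped. The threshold lies halfway between the error and
    -- `r`, because a strict gap is needed while `hgap` is not strict.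
    refine IsGreedy.eq_of_gap hb h0 hg' hg (r := (2 * lmax X * ‖θ' - θ‖ + r) / 2)
      (by rw [norm_sub_rev]; linarith) fun k hk v hv hne => ?_
    linarith [hgap k hk v hv hne]
  intro k hk v hv hne
  have hp : picked g' k = picked g k := picked_congr fun j hj => (heq j (hj.trans hk)).symm
  rw [hp] at hv ⊢
  rw [← heq k hk] at hne ⊢
  have h1 := hgap k hk v hv hne
  have h2 := gain_sub_gain_le hb h0 θ θ' (picked g k) (g k) v
  linarith

/-! ### Parameters with a large greedy gap -/

/-- The set of parameters on which some greedy run has a gap exceeding `r`. -/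
def gapSet (X : Set (Vec d)) (H : ℕ) (r : ℝ) : Set (Vec d) :=
  {θ | ∃ g, IsGreedy X H θ g ∧ (r : EReal) < greedyGap X H θ g}

/-- A nonnegative gap threshold that is strictly exceeded leaves no ties, so the test depends on the
parameter alone. The picks of a run need not be measurable in the outcome; the test nevertheless is.
-/
lemma mem_gapSet_iff {X : Set (Vec d)} (hb : Bornology.IsBounded X) (h0 : (0 : Vec d) ∈ X)
    {H : ℕ} {r : ℝ} (hr : 0 ≤ r) {θ : Vec d} {g : ℕ → Fin d} (hg : IsGreedy X H θ g) :
    θ ∈ gapSet X H r ↔ (r : EReal) < greedyGap X H θ g := by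
  refine ⟨fun ⟨g', hg', hgap⟩ => ?_, fun h => ⟨g, hg, h⟩⟩
  rw [lt_greedyGap_iff] at hgap ⊢
  have heq := IsGreedy.eq_of_gap hb h0 hg hg' (r := r) (by simpa using hr) hgap
  intro k hk v hv hne
  have hp : picked g' k = picked g k := picked_congr fun j hj => heq j (hj.trans hk)
  have := hgap k hk v (hp ▸ hv) (heq k hk ▸ hne)
  rwa [hp, heq k hk] at this

lemma isOpen_gapSet {X : Set (Vec d)} (hb : Bornology.IsBounded X) (h0 : (0 : Vec d) ∈ X)
    (hd : 0 < d) (H : ℕ) {r : ℝ} (hr : 0 ≤ r) : IsOpen (gapSet X H r) := by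
  -- Only the first `H` picks matter, so the union over runs is finite; the padding value beyond `H`
  -- plays no role.
  let ext : (Fin H → Fin d) → ℕ → Fin d := fun f k => if h : k < H then f ⟨k, h⟩ else ⟨0, hd⟩
  have : gapSet X H r = ⋃ f : Fin H → Fin d, {θ | ∀ k : Fin H, ext f k ∉ picked (ext f) k ∧
      ∀ v, v ∉ picked (ext f) k → v ≠ ext f k →
        gain X θ (picked (ext f) k) v + r < gain X θ (picked (ext f) k) (ext f k)} := by
    ext θ
    simp only [Set.mem_iUnion, Set.mem_ofPred_eq]
    constructor
    · rintro ⟨g, hg, hgap⟩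
      rw [lt_greedyGap_iff] at hgap
      refine ⟨fun k => g k, fun k => ?_⟩
      have he : ∀ j < H, ext (fun k => g k) j = g j := fun j hj => by simp [ext, hj]
      have hp : picked (ext fun k => g k) k = picked g k :=
        picked_congr fun j hj => he j (hj.trans k.2)
      rw [hp, he k k.2]
      exact ⟨(hg k k.2).1, hgap k k.2⟩
    · rintro ⟨f, hf⟩
      refine ⟨ext f, fun k hk => ⟨(hf ⟨k, hk⟩).1, fun v hv => ?_⟩,
        lt_greedyGap_iff.2 fun k hk => (hf ⟨k, hk⟩).2⟩
      by_cases hne : v = ext f k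
      · rw [hne]
      · linarith [(hf ⟨k, hk⟩).2 v hv hne]
  rw [this]
  refine isOpen_iUnion fun f => ?_
  simp only [Set.ofPred_forall]
  refine isOpen_iInter_of_finite fun k => ?_
  rw [Set.ofPred_and]
  refine isOpen_const.inter ?_
  rw [Set.ofPred_forall]
  refine isOpen_iInter_of_finite fun v => ?_
  by_cases h1 : v ∈ picked (ext f) k
  · simp [h1]
  by_cases h2 : v = ext f k
  · simp [h2]
  simp only [h1, h2, not_false_eq_true, ne_eq, forall_const]
  exact isOpen_lt ((continuous_gain hb h0 _ _).add continuous_const) (continuous_gain hb h0 _ _)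

/-! ### The greedy guarantee -/

/-- Monotonicity makes `0` admissible, testing on `W = {v}` with a positive gain caps every
admissible number at `1`, and the admissible set is closed. Hence its supremum is attained. -/
lemma submodularityRatio_spec {X : Set (Vec d)} (hb : Bornology.IsBounded X)
    (h0 : (0 : Vec d) ∈ X) {θ : Vec d} {G : Finset (Fin d)} {v : Fin d}
    (hv : 0 < gain X θ G v) :
    0 ≤ submodularityRatio (fun S => value X S θ) ∧
    submodularityRatio (fun S => value X S θ) ≤ 1 ∧
    ∀ S W : Finset (Fin d), submodularityRatio (fun S => value X S θ) *
      (value X (S ∪ W) θ - value X S θ) ≤ ∑ w ∈ W \ S, gain X θ S w := by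
  set A := {γ : ℝ | ∀ S W : Finset (Fin d),
    γ * (value X (S ∪ W) θ - value X S θ) ≤ ∑ w ∈ W \ S, gain X θ S w} with hA
  have hγ : submodularityRatio (fun S => value X S θ) = sSup A := rfl
  have hzero : (0 : ℝ) ∈ A := fun S W => by
    rw [zero_mul]; exact Finset.sum_nonneg fun w _ => gain_nonneg hb h0 θ S w
  have hone : ∀ γ ∈ A, γ ≤ 1 := fun γ h => by
    have hvG : v ∉ G := fun h' => by simp [gain, Finset.insert_eq_of_mem h'] at hv
    have h1 := h G {v}
    have h2 : ({v} : Finset (Fin d)) \ G = {v} := by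
      rw [Finset.sdiff_eq_self_iff_disjoint]; simpa using hvG
    have h3 : G ∪ {v} = insert v G := by rw [Finset.union_comm]; rfl
    rw [h2, Finset.sum_singleton, h3] at h1
    change γ * gain X θ G v ≤ _ at h1
    by_contra hlt
    push Not at hlt
    nlinarith
  have hbdd : BddAbove A := ⟨1, hone⟩
  have hclosed : IsClosed A := by
    simp only [hA, Set.ofPred_forall]
    exact isClosed_iInter fun S => isClosed_iInter fun W =>
      isClosed_le (by fun_prop) continuous_const
  rw [hγ]
  exact ⟨le_csSup hbdd hzero, csSup_le ⟨0, hzero⟩ hone, hclosed.csSup_mem ⟨0, hzero⟩ hbdd⟩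

/-- One greedy step closes a `γ / H` fraction of the distance to any competitor of size `H`. -/
lemma ratio_mul_le_mul_gain {X : Set (Vec d)} (hb : Bornology.IsBounded X) (h0 : (0 : Vec d) ∈ X)
    {H : ℕ} {θ : Vec d} {γ : ℝ} (hγ0 : 0 ≤ γ)
    (hγ : ∀ S W : Finset (Fin d), γ * (value X (S ∪ W) θ - value X S θ)
      ≤ ∑ w ∈ W \ S, gain X θ S w)
    {G : Finset (Fin d)} {v : Fin d} (hmax : ∀ w, w ∉ G → gain X θ G w ≤ gain X θ G v)
    {W : Finset (Fin d)} (hW : W.card ≤ H) :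
    γ * (value X W θ - value X G θ) ≤ H * gain X θ G v := by
  have h1 : value X W θ ≤ value X (G ∪ W) θ := value_mono hb h0 Finset.subset_union_right θ
  calc γ * (value X W θ - value X G θ) ≤ γ * (value X (G ∪ W) θ - value X G θ) := by gcongr
    _ ≤ ∑ w ∈ W \ G, gain X θ G w := hγ G W
    _ ≤ ∑ _w ∈ W \ G, gain X θ G v :=
        Finset.sum_le_sum fun w hw => hmax w (Finset.mem_sdiff.1 hw).2
    _ = ((W \ G).card : ℝ) * gain X θ G v := by rw [Finset.sum_const, nsmul_eq_mul]
    _ ≤ H * gain X θ G v := by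
        gcongr
        · exact gain_nonneg hb h0 θ G v
        · exact (Finset.card_le_card Finset.sdiff_subset).trans hW

/-- With a gap `Δ` at a step, the greedy pick gains more than the competitor argument gives. -/
lemma ratio_mul_le_mul_gain_sub {X : Set (Vec d)} (hb : Bornology.IsBounded X)
    (h0 : (0 : Vec d) ∈ X) {H : ℕ} {θ : Vec d} {γ Δ : ℝ} (hγ0 : 0 ≤ γ)
    (hγ : ∀ S W : Finset (Fin d), γ * (value X (S ∪ W) θ - value X S θ)
      ≤ ∑ w ∈ W \ S, gain X θ S w) (hΔ : 0 ≤ Δ)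
    {G : Finset (Fin d)} {v u : Fin d} (hu : u ∉ G) (huv : u ≠ v)
    (hmax : ∀ w, w ∉ G → w ≠ v → gain X θ G w + Δ ≤ gain X θ G v)
    {W : Finset (Fin d)} (hW : W.card ≤ H) :
    γ * (value X W θ - value X G θ) ≤ H * (gain X θ G v - Δ) + Δ := by
  have h1 : value X W θ ≤ value X (G ∪ W) θ := value_mono hb h0 Finset.subset_union_right θ
  have h2 : 0 ≤ gain X θ G v - Δ := by linarith [hmax u hu huv, gain_nonneg hb h0 θ G u]
  calc γ * (value X W θ - value X G θ) ≤ γ * (value X (G ∪ W) θ - value X G θ) := by gcongr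
    _ ≤ ∑ w ∈ W \ G, gain X θ G w := hγ G W
    -- Every competitor other than `v` gains at most the best gain minus `Δ`, and `v` itself occurs
    -- at most once.
    _ ≤ ∑ w ∈ W \ G, ((gain X θ G v - Δ) + if w = v then Δ else 0) := by
        refine Finset.sum_le_sum fun w hw => ?_
        split_ifs with h
        · rw [h]; linarith
        · linarith [hmax w (Finset.mem_sdiff.1 hw).2 h]
    _ ≤ ((W \ G).card : ℝ) * (gain X θ G v - Δ) + Δ := by
        rw [Finset.sum_add_distrib, Finset.sum_const, nsmul_eq_mul, Finset.sum_ite_eq']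
        split_ifs <;> linarith
    _ ≤ H * (gain X θ G v - Δ) + Δ := by
        gcongr
        exact (Finset.card_le_card Finset.sdiff_subset).trans hW

/-- Dividing by `γ` passes from single supports to the optimum; the hypothesis `hr` covers `γ = 0`.
-/
lemma ratio_mul_opt_le {X : Set (Vec d)} (hb : Bornology.IsBounded X) (h0 : (0 : Vec d) ∈ X)
    {H : ℕ} {θ : Vec d} {γ c r : ℝ} (hγ0 : 0 ≤ γ) (hr : 0 ≤ r + γ * c)
    (h : ∀ W : Finset (Fin d), W.card ≤ H → γ * (value X W θ - c) ≤ r) :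
    γ * (opt X H θ - c) ≤ r := by
  rcases hγ0.eq_or_lt with h1 | h1
  · rw [← h1] at hr ⊢; linarith
  have : opt X H θ ≤ r / γ + c := opt_le hb h0 fun W hW => by
    have := h W hW
    rw [mul_comm, ← le_div_iff₀ h1] at this
    linarith
  rw [mul_comm, ← le_div_iff₀ h1]
  linarith

/-- Each pick closes at least a `γ / H` fraction of the distance to the optimum, so the residual
contracts geometrically. -/
lemma greedy_value_ge {X : Set (Vec d)} (hb : Bornology.IsBounded X) (h0 : (0 : Vec d) ∈ X)
    {H : ℕ} (hH : 1 ≤ H) {θ : Vec d} {g : ℕ → Fin d} (hg : IsGreedy X H θ g) {γ : ℝ}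
    (hγ0 : 0 ≤ γ) (hγ1 : γ ≤ 1)
    (hγ : ∀ S W : Finset (Fin d), γ * (value X (S ∪ W) θ - value X S θ)
      ≤ ∑ w ∈ W \ S, gain X θ S w) {k : ℕ} (hk : k ≤ H) :
    (1 - (1 - γ / H) ^ k) * opt X H θ ≤ value X (picked g k) θ := by
  have hH' : (1 : ℝ) ≤ H := by exact_mod_cast hH
  induction k with
  | zero => simp [picked_zero, value_empty hb h0]
  | succ k ih =>
    have h1 := ih (by omega)
    have h2 : γ * (opt X H θ - value X (picked g k) θ)
        ≤ H * gain X θ (picked g k) (g k) := by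
      refine ratio_mul_opt_le hb h0 hγ0 ?_ fun W hW =>
        ratio_mul_le_mul_gain hb h0 hγ0 hγ (hg k (by omega)).2 hW
      have := gain_nonneg hb h0 θ (picked g k) (g k)
      have := value_nonneg hb h0 (picked g k) θ
      positivity
    have h3 : γ / H * (opt X H θ - value X (picked g k) θ) ≤ gain X θ (picked g k) (g k) := by
      rw [div_mul_eq_mul_div, div_le_iff₀ (by linarith)]
      linarith
    have h4 : 0 ≤ 1 - γ / H := by
      rw [sub_nonneg, div_le_one (by linarith)]; linarith
    rw [value_picked_succ, pow_succ]
    nlinarith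

lemma one_sub_exp_mul_le {γ a : ℝ} {H : ℕ} (hH : 1 ≤ H) (hγ1 : γ ≤ 1) (ha : 0 ≤ a) :
    (1 - Real.exp (-γ)) * a ≤ (1 - (1 - γ / H) ^ H) * a := by
  have hH' : (1 : ℝ) ≤ H := by exact_mod_cast hH
  have := Real.one_sub_div_pow_le_exp_neg (n := H) (t := γ) (by linarith)
  gcongr

/-- The greedy support is an `α`-approximation of the best sparse support. -/
lemma greedyAlpha_mul_opt_le {X : Set (Vec d)} (hb : Bornology.IsBounded X)
    (h0 : (0 : Vec d) ∈ X) {H : ℕ} (hH : 1 ≤ H) {θ : Vec d} {g : ℕ → Fin d}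
    (hg : IsGreedy X H θ g) {G : Finset (Fin d)} {v : Fin d} (hv : 0 < gain X θ G v) :
    greedyAlpha X θ * opt X H θ ≤ value X (picked g H) θ := by
  obtain ⟨hγ0, hγ1, hγ⟩ := submodularityRatio_spec hb h0 hv
  exact (one_sub_exp_mul_le hH hγ1 (opt_nonneg hb h0 H θ)).trans
    (greedy_value_ge hb h0 hH hg hγ0 hγ1 hγ le_rfl)

/-- A positive greedy gap makes the approximation guarantee of the greedy support strict. -/
lemma greedyAlpha_mul_opt_add_le {X : Set (Vec d)} (hb : Bornology.IsBounded X)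
    (h0 : (0 : Vec d) ∈ X) {H : ℕ} (hH : 2 ≤ H) {θ : Vec d} {g : ℕ → Fin d}
    (hg : IsGreedy X H θ g) {Δ : ℝ} (hΔ : 0 < Δ)
    (hgap : ∀ k < H, ∀ v, v ∉ picked g k → v ≠ g k →
      gain X θ (picked g k) v + Δ ≤ gain X θ (picked g k) (g k))
    {i : Fin d} (hi : i ∉ picked g H) :
    greedyAlpha X θ * opt X H θ + Δ / 2 ≤ value X (picked g H) θ := by
  -- Only the last pick is sharpened. The element `i` is still available at that step, so the gap
  -- there is not vacuous.
  obtain ⟨K, rfl⟩ : ∃ K, H = K + 1 := ⟨H - 1, by omega⟩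
  have hK : (2 : ℝ) ≤ ((K + 1 : ℕ) : ℝ) := by exact_mod_cast hH
  have hi1 : i ∉ picked g K := fun h => hi (picked_mono g (Nat.le_succ K) h)
  have hi2 : i ≠ g K := fun h => hi (by rw [picked_succ, h]; exact Finset.mem_insert_self _ _)
  have hgi := hgap K (by omega) i hi1 hi2
  have hge := gain_nonneg hb h0 θ (picked g K) i
  obtain ⟨hγ0, hγ1, hγ⟩ := submodularityRatio_spec (θ := θ) hb h0
    (show 0 < gain X θ (picked g K) (g K) by linarith)
  have h1 := one_sub_exp_mul_le (H := K + 1) (by omega) hγ1 (opt_nonneg hb h0 (K + 1) θ)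
  have h2 := greedy_value_ge hb h0 (by omega) hg hγ0 hγ1 hγ (Nat.le_succ K)
  set γ := submodularityRatio fun S => value X S θ with hγdef
  set n : ℝ := ((K + 1 : ℕ) : ℝ) with hn
  have h3 : γ * (opt X (K + 1) θ - value X (picked g K) θ)
      ≤ n * (gain X θ (picked g K) (g K) - Δ) + Δ := by
    refine ratio_mul_opt_le hb h0 hγ0 ?_ fun W hW =>
      ratio_mul_le_mul_gain_sub hb h0 hγ0 hγ hΔ.le hi1 hi2 (hgap K (by omega)) hW
    have := value_nonneg hb h0 (picked g K) θ
    have : 0 ≤ gain X θ (picked g K) (g K) - Δ := by linarith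
    positivity
  have h4 : γ / n * (opt X (K + 1) θ - value X (picked g K) θ) + Δ / 2
      ≤ gain X θ (picked g K) (g K) := by
    have : γ / n * (opt X (K + 1) θ - value X (picked g K) θ)
        ≤ gain X θ (picked g K) (g K) - Δ + Δ / n := by
      rw [div_mul_eq_mul_div, div_le_iff₀ (by linarith), add_mul, div_mul_cancel₀ _ (by linarith)]
      linarith
    -- Averaged over `n` competitors, of which at most one misses the saving, the saving is `Δ - Δ /
    -- n`; here `H ≥ 2` enters.
    have : Δ / n ≤ Δ / 2 := by gcongr
    linarith
  have h5 : 0 ≤ 1 - γ / n := by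
    rw [sub_nonneg, div_le_one (by linarith)]; linarith
  rw [value_picked_succ]
  have h6 : greedyAlpha X θ = 1 - Real.exp (-γ) := rfl
  rw [h6]
  rw [pow_succ] at h1
  nlinarith

/-! ### Gaussian integration -/

lemma lintegral_exp_mul_gaussianReal (τ : NNReal) (z : ℝ) :
    ∫⁻ x, ENNReal.ofReal (Real.exp (z * x)) ∂(ProbabilityTheory.gaussianReal 0 τ)
      = ENNReal.ofReal (Real.exp (τ * z ^ 2 / 2)) := by
  rw [← ofReal_integral_eq_lintegral_ofReal (ProbabilityTheory.integrable_exp_mul_gaussianReal z)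
    (Filter.Eventually.of_forall fun x => (Real.exp_pos _).le)]
  congr 1
  have := ProbabilityTheory.mgf_gaussianReal (p := ProbabilityTheory.gaussianReal 0 τ)
    (X := id) (μ := 0) (v := τ) (by simp) z
  simpa [ProbabilityTheory.mgf] using this

lemma lintegral_exp_sq_gaussianReal {τ : NNReal} (hτ : 0 < τ) {v : ℝ} (hv : v * τ < 1) :
    ∫⁻ x, ENNReal.ofReal (Real.exp (v * x ^ 2 / 2)) ∂(ProbabilityTheory.gaussianReal 0 τ)
      = ENNReal.ofReal ((1 - v * τ) ^ (-(1 / 2) : ℝ)) := by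
  have hτ' : (0 : ℝ) < τ := hτ
  -- The factor `exp (v x² / 2)` lowers the Gaussian exponent from `1 / (2τ)` to `b`; the ratio of
  -- the normalizations is the claimed power.
  set b : ℝ := (1 - v * τ) / (2 * τ) with hb
  have hb0 : 0 < b := div_pos (by linarith) (by positivity)
  rw [ProbabilityTheory.gaussianReal_of_var_ne_zero 0 hτ.ne',
    lintegral_withDensity_eq_lintegral_mul _ (ProbabilityTheory.measurable_gaussianPDF _ _)
      (by fun_prop)]
  have h1 : ∀ x : ℝ, (ProbabilityTheory.gaussianPDF 0 τ * fun x =>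
      ENNReal.ofReal (Real.exp (v * x ^ 2 / 2))) x
      = ENNReal.ofReal ((Real.sqrt (2 * Real.pi * τ))⁻¹ * Real.exp (-b * x ^ 2)) := by
    intro x
    rw [Pi.mul_apply, ProbabilityTheory.gaussianPDF, ← ENNReal.ofReal_mul
      (ProbabilityTheory.gaussianPDFReal_nonneg _ _ _), ProbabilityTheory.gaussianPDFReal,
      mul_assoc, ← Real.exp_add]
    congr 3
    rw [hb]; field_simp; ring
  simp_rw [h1]
  rw [← ofReal_integral_eq_lintegral_ofReal ((integrable_exp_neg_mul_sq hb0).const_mul _)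
    (Filter.Eventually.of_forall fun x => by positivity), integral_const_mul, integral_gaussian]
  congr 1
  rw [← Real.sqrt_inv, ← Real.sqrt_mul (by positivity), Real.rpow_neg (by linarith),
    ← Real.sqrt_eq_rpow, ← Real.sqrt_inv]
  congr 1
  rw [hb]
  have : (1 - v * τ) ≠ 0 := by linarith
  field_simp

lemma lintegral_pi_exp_sum {ν : Measure ℝ} [IsProbabilityMeasure ν] {f : Fin d → ℝ → ℝ}
    (hf : ∀ i, Measurable (f i)) :
    ∫⁻ u, ENNReal.ofReal (Real.exp (∑ i, f i (u i))) ∂(Measure.pi fun _ : Fin d => ν)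
      = ∏ i, ∫⁻ x, ENNReal.ofReal (Real.exp (f i x)) ∂ν := by
  have h1 : ∀ u : Fin d → ℝ, ENNReal.ofReal (Real.exp (∑ i, f i (u i)))
      = ∏ i, ENNReal.ofReal (Real.exp (f i (u i))) := fun u => by
    rw [Real.exp_sum, ENNReal.ofReal_prod_of_nonneg fun i _ => (Real.exp_pos _).le]
  simp_rw [h1]
  have hm : ∀ i, Measurable fun x => ENNReal.ofReal (Real.exp (f i x)) := fun i => by
    have := hf i; fun_prop
  have h2 := ProbabilityTheory.lintegral_prod_eq_prod_lintegral_of_indepFun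
    (μ := Measure.pi fun _ : Fin d => ν) Finset.univ
    (fun i (u : Fin d → ℝ) => ENNReal.ofReal (Real.exp (f i (u i))))
    (ProbabilityTheory.iIndepFun_pi (μ := fun _ : Fin d => ν)
      (X := fun i x => ENNReal.ofReal (Real.exp (f i x))) fun i => (hm i).aemeasurable)
    (fun i => (hm i).comp (measurable_pi_apply i))
  rw [h2]
  refine Finset.prod_congr rfl fun i _ => ?_
  exact (measurePreserving_eval (fun _ : Fin d => ν) i).lintegral_comp (hm i)

/-- The exponential moment of the squared norm of a sub-Gaussian vector. -/
lemma lintegral_exp_norm_sq_le {Ω : Type*} [MeasurableSpace Ω] {μ : Measure Ω}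
    [IsProbabilityMeasure μ] {Z : Ω → Vec d} (hZ : Measurable Z) {v : ℝ}
    (hmgf : ∀ u : Vec d, ∫⁻ ω, ENNReal.ofReal (Real.exp (inner ℝ u (Z ω))) ∂μ
      ≤ ENNReal.ofReal (Real.exp (v * ‖u‖ ^ 2 / 2)))
    {τ : NNReal} (hτ : 0 < τ) (hv : v * τ < 1) :
    ∫⁻ ω, ENNReal.ofReal (Real.exp (τ * ‖Z ω‖ ^ 2 / 2)) ∂μ
      ≤ ENNReal.ofReal ((1 - v * τ) ^ (-(d / 2) : ℝ)) := by
  set ν := ProbabilityTheory.gaussianReal 0 τ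
  -- The exponential of the square is linearized: it is the moment generating function at `z` of a
  -- centred Gaussian vector with covariance `τ I`. After exchanging the integrals, `hmgf` applies
  -- for each fixed `u`.
  have h1 : ∀ z : Vec d, ENNReal.ofReal (Real.exp (τ * ‖z‖ ^ 2 / 2))
      = ∫⁻ u, ENNReal.ofReal (Real.exp (∑ i, z i * u i)) ∂(Measure.pi fun _ : Fin d => ν) := by
    intro z
    rw [lintegral_pi_exp_sum (f := fun i x => z i * x) fun i => by fun_prop]
    simp_rw [ν, lintegral_exp_mul_gaussianReal]
    rw [← ENNReal.ofReal_prod_of_nonneg fun i _ => (Real.exp_pos _).le, ← Real.exp_sum,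
      EuclideanSpace.norm_sq_eq, ← Finset.sum_div, ← Finset.mul_sum]
    simp
  have h2 : ∀ u : Fin d → ℝ, ∫⁻ ω, ENNReal.ofReal (Real.exp (∑ i, Z ω i * u i)) ∂μ
      ≤ ENNReal.ofReal (Real.exp (∑ i, v * u i ^ 2 / 2)) := by
    intro u
    have := hmgf (WithLp.toLp 2 u)
    simp only [PiLp.inner_apply, EuclideanSpace.norm_sq_eq] at this
    simpa [Finset.mul_sum, Finset.sum_div] using this
  simp_rw [h1]
  rw [lintegral_lintegral_swap]
  · calc ∫⁻ u, ∫⁻ ω, ENNReal.ofReal (Real.exp (∑ i, Z ω i * u i)) ∂μ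
          ∂(Measure.pi fun _ : Fin d => ν)
        ≤ ∫⁻ u, ENNReal.ofReal (Real.exp (∑ i, v * u i ^ 2 / 2))
            ∂(Measure.pi fun _ : Fin d => ν) := lintegral_mono h2
      _ = ∏ i : Fin d, ENNReal.ofReal ((1 - v * τ) ^ (-(1 / 2) : ℝ)) := by
          rw [lintegral_pi_exp_sum (f := fun i x => v * x ^ 2 / 2) fun i => by fun_prop]
          exact Finset.prod_congr rfl fun i _ => lintegral_exp_sq_gaussianReal hτ hv
      _ = _ := by
          rw [Finset.prod_const, Finset.card_univ, Fintype.card_fin, ← ENNReal.ofReal_pow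
            (Real.rpow_nonneg (by linarith) _), ← Real.rpow_mul_natCast (by linarith)]
          congr 2; ring
  · refine Measurable.aemeasurable ?_
    refine ENNReal.measurable_ofReal.comp (Real.measurable_exp.comp ?_)
    refine Finset.measurable_sum _ fun i _ => ?_
    have : Measurable fun ω => Z ω i := by fun_prop
    exact (this.comp measurable_fst).mul ((measurable_pi_apply i).comp measurable_snd)

/-- A tail bound for the norm of a sub-Gaussian vector in dimension at least two. -/
lemma measure_norm_sq_gt_le {Ω : Type*} [MeasurableSpace Ω] {μ : Measure Ω}
    [IsProbabilityMeasure μ] (hd : 2 ≤ d) {Z : Ω → Vec d} (hZ : Measurable Z) {v : ℝ}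
    (hv : 0 < v)
    (hmgf : ∀ u : Vec d, ∫⁻ ω, ENNReal.ofReal (Real.exp (inner ℝ u (Z ω))) ∂μ
      ≤ ENNReal.ofReal (Real.exp (v * ‖u‖ ^ 2 / 2))) (l : ℝ) :
    μ {ω | 2 * d * v * l < 11 / 10 * ‖Z ω‖ ^ 2}
      ≤ ENNReal.ofReal (20 / 9 * Real.exp (-l)) := by
  have hd' : (2 : ℝ) ≤ d := by exact_mod_cast hd
  -- The factor `11 / 10` produces the slack in the error bound that the end of warm-up requires,
  -- while `v * τ ≤ 11 / 20` stays below `1`.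
  set τ : NNReal := ⟨11 / 10 / (d * v), by positivity⟩ with hτ
  have hτr : (τ : ℝ) = 11 / 10 / (d * v) := rfl
  have hvτ : v * τ = 11 / 10 / d := by rw [hτr]; field_simp
  have hlt : v * τ ≤ 11 / 20 := by
    rw [hvτ, div_le_iff₀ (by linarith)]; linarith
  have h1 := lintegral_exp_norm_sq_le hZ hmgf (τ := τ)
    (by rw [← NNReal.coe_pos, hτr]; positivity) (by linarith)
  have h2 : (1 - v * τ) ^ (-(d / 2) : ℝ) ≤ 20 / 9 := by
    -- Bernoulli's inequality needs the exponent `d / 2` to be at least `1`; it bounds the moment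
    -- independently of `d`.
    have hB := one_add_mul_self_le_rpow_one_add (s := -(v * τ)) (by linarith)
      (p := (d / 2 : ℝ)) (by linarith)
    have h3 : (d / 2 : ℝ) * -(v * τ) = -(11 / 20) := by rw [hvτ]; field_simp; norm_num
    rw [h3] at hB
    rw [Real.rpow_neg (by linarith), show (20 / 9 : ℝ) = (9 / 20)⁻¹ by norm_num]
    refine inv_anti₀ (by norm_num) ?_
    rw [sub_eq_add_neg]
    linarith
  have h3 : {ω | 2 * d * v * l < 11 / 10 * ‖Z ω‖ ^ 2} ⊆
      {ω | ENNReal.ofReal (Real.exp l) ≤ ENNReal.ofReal (Real.exp (τ * ‖Z ω‖ ^ 2 / 2))} := by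
    intro ω hω
    refine ENNReal.ofReal_le_ofReal (Real.exp_le_exp.2 ?_)
    have hω' : 2 * d * v * l < 11 / 10 * ‖Z ω‖ ^ 2 := hω
    rw [hτr, div_mul_eq_mul_div, div_div, le_div_iff₀ (by positivity)]
    linarith
  have h4 := meas_ge_le_lintegral_div (μ := μ)
    (f := fun ω => ENNReal.ofReal (Real.exp (τ * ‖Z ω‖ ^ 2 / 2)))
    (by fun_prop) (ε := ENNReal.ofReal (Real.exp l)) (by simp [Real.exp_pos])
    ENNReal.ofReal_ne_top
  refine (measure_mono h3).trans (h4.trans ?_)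
  rw [Real.exp_neg, ← div_eq_mul_inv, ENNReal.ofReal_div_of_pos (Real.exp_pos l)]
  gcongr
  exact h1.trans (ENNReal.ofReal_le_ofReal h2)

/-! ### The Gram matrix of the exploration actions -/

lemma gram_mulVec (b : Fin d → Vec d) (w : Fin d → ℝ) :
    (gram b).mulVec w = ∑ k, ((b k).ofLp ⬝ᵥ w) • (b k).ofLp := by
  rw [gram, Matrix.sum_mulVec]
  exact Finset.sum_congr rfl fun k _ => by rw [Matrix.vecMulVec_mulVec]; ext; simp [mul_comm]

lemma dotProduct_gram_mulVec (b : Fin d → Vec d) (w : Fin d → ℝ) :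
    w ⬝ᵥ (gram b).mulVec w = ∑ k, (w ⬝ᵥ (b k).ofLp) ^ 2 := by
  rw [gram_mulVec, dotProduct_sum]
  refine Finset.sum_congr rfl fun k _ => ?_
  rw [dotProduct_smul, smul_eq_mul, sq, dotProduct_comm]

lemma isHermitian_gram (b : Fin d → Vec d) : (gram b).IsHermitian := by
  rw [Matrix.IsHermitian, gram, Matrix.conjTranspose_sum]
  refine Finset.sum_congr rfl fun k _ => ?_
  rw [Matrix.conjTranspose_vecMulVec]
  simp

lemma posDef_gram {b : Fin d → Vec d} (h : IsUnit (gram b)) : (gram b).PosDef := by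
  refine Matrix.PosSemidef.posDef_iff_isUnit ?_ |>.2 h
  refine .of_dotProduct_mulVec_nonneg (isHermitian_gram b) fun w => ?_
  rw [star_trivial, dotProduct_gram_mulVec]
  exact Finset.sum_nonneg fun k _ => sq_nonneg _

lemma bddBelow_spectrum_gram (b : Fin d → Vec d) : BddBelow (spectrum ℝ (gram b)) := by
  rw [(isHermitian_gram b).spectrum_real_eq_range_eigenvalues]
  exact (Set.finite_range _).bddBelow

lemma lambdaZero_le_eigenvalues (b : Fin d → Vec d) (i : Fin d) :
    lambdaZero b ≤ (isHermitian_gram b).eigenvalues i := by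
  refine csInf_le (bddBelow_spectrum_gram b) ?_
  rw [(isHermitian_gram b).spectrum_real_eq_range_eigenvalues]
  exact ⟨i, rfl⟩

lemma lambdaZero_pos {b : Fin d → Vec d} (hd : 0 < d) (h : IsUnit (gram b)) :
    0 < lambdaZero b := by
  have : Nonempty (Fin d) := ⟨⟨0, hd⟩⟩
  have h1 : lambdaZero b ∈ spectrum ℝ (gram b) := by
    rw [lambdaZero, (isHermitian_gram b).spectrum_real_eq_range_eigenvalues]
    exact (Set.range_nonempty _).csInf_mem (Set.finite_range _)
  rw [(isHermitian_gram b).spectrum_real_eq_range_eigenvalues] at h1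
  obtain ⟨i, hi⟩ := h1
  rw [← hi]
  exact (posDef_gram h).eigenvalues_pos i

lemma mul_lambdaZero_le_trace (b : Fin d → Vec d) : d * lambdaZero b ≤ (gram b).trace := by
  rw [(isHermitian_gram b).trace_eq_sum_eigenvalues]
  calc (d : ℝ) * lambdaZero b = ∑ _i : Fin d, lambdaZero b := by simp
    _ ≤ _ := Finset.sum_le_sum fun i _ => lambdaZero_le_eigenvalues b i

lemma lambdaZero_mul_le_dotProduct (b : Fin d → Vec d) (w : Fin d → ℝ) :
    lambdaZero b * (w ⬝ᵥ w) ≤ w ⬝ᵥ (gram b).mulVec w := by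
  have h1 : (gram b - algebraMap ℝ _ (lambdaZero b)).PosSemidef := by
    rw [Matrix.posSemidef_iff_isHermitian_and_spectrum_nonneg]
    refine ⟨(isHermitian_gram b).sub ?_, ?_⟩
    · rw [Matrix.algebraMap_eq_diagonal]
      exact Matrix.isHermitian_diagonal _
    · rw [← spectrum.sub_singleton_eq]
      rintro _ ⟨r, hr, s, hs, rfl⟩
      rw [Set.mem_singleton_iff] at hs
      subst hs
      exact sub_nonneg.2 (csInf_le (bddBelow_spectrum_gram b) hr)
  have h2 := h1.dotProduct_mulVec_nonneg w
  rw [star_trivial, Matrix.sub_mulVec, dotProduct_sub, Algebra.algebraMap_eq_smul_one,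
    Matrix.smul_mulVec, Matrix.one_mulVec, dotProduct_smul, smul_eq_mul] at h2
  linarith

lemma dotProduct_self_eq_norm_sq (w : Fin d → ℝ) : w ⬝ᵥ w = ‖(WithLp.toLp 2 w : Vec d)‖ ^ 2 := by
  rw [EuclideanSpace.norm_sq_eq]
  simp [dotProduct, sq]

/-! ### The least squares error in a fixed direction -/

/-- The weights with which the noise enters the least squares estimate in the direction `u`. -/
def olsWeight (b : Fin d → Vec d) (c : ℕ) (u : Vec d) (k : Fin d) : ℝ :=
  (((c : ℝ) • gram b)⁻¹.mulVec u.ofLp) ⬝ᵥ (b k).ofLp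

lemma isUnit_det_smul_gram {b : Fin d → Vec d} (h : IsUnit (gram b)) {c : ℕ} (hc : 1 ≤ c) :
    IsUnit ((c : ℝ) • gram b).det := by
  rw [Matrix.det_smul]
  refine IsUnit.mul ?_ ((Matrix.isUnit_iff_isUnit_det _).1 h)
  have : (c : ℝ) ≠ 0 := by positivity
  exact (this.isUnit).pow _

/-- The estimation error in the direction `u` is a weighted sum of the noise. -/
lemma inner_olsEstimate_sub {b : Fin d → Vec d} (h : IsUnit (gram b)) {θ u : Vec d}
    {x : ℕ → Vec d} {η : ℕ → ℝ} {start : ℕ → ℕ} {c : ℕ} (hc : 1 ≤ c)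
    (hx : ∀ s, 1 ≤ s → ∀ k : Fin d, x (start s + k) = b k) :
    inner ℝ u (olsEstimate b (fun t => inner ℝ θ (x t) + η t) start c - θ)
      = ∑ s ∈ Finset.Icc 1 c, ∑ k, olsWeight b c u k * η (start s + k) := by
  set M := (c : ℝ) • gram b with hM
  have hdet := isUnit_det_smul_gram h hc
  have h1 : (∑ s ∈ Finset.Icc 1 c, ∑ k : Fin d,
      (inner ℝ θ (x (start s + k)) + η (start s + k)) • (b k).ofLp)
      = M.mulVec θ.ofLp + ∑ s ∈ Finset.Icc 1 c, ∑ k : Fin d, η (start s + k) • (b k).ofLp := by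
    rw [hM, Matrix.smul_mulVec, gram_mulVec]
    have : ∀ s ∈ Finset.Icc 1 c, ∑ k : Fin d,
        (inner ℝ θ (x (start s + k)) + η (start s + k)) • (b k).ofLp
        = ∑ k, ((b k).ofLp ⬝ᵥ θ.ofLp) • (b k).ofLp + ∑ k : Fin d, η (start s + k) • (b k).ofLp := by
      intro s hs
      rw [← Finset.sum_add_distrib]
      refine Finset.sum_congr rfl fun k _ => ?_
      rw [hx s (Finset.mem_Icc.1 hs).1 k, add_smul]
      congr 2
    rw [Finset.sum_congr rfl this, Finset.sum_add_distrib, Finset.sum_const, Nat.card_Icc,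
      Nat.add_sub_cancel, Nat.cast_smul_eq_nsmul]
  have h2 : olsEstimate b (fun t => inner ℝ θ (x t) + η t) start c - θ
      = WithLp.toLp 2 (M⁻¹.mulVec
        (∑ s ∈ Finset.Icc 1 c, ∑ k : Fin d, η (start s + k) • (b k).ofLp)) := by
    rw [olsEstimate, ← hM, h1, Matrix.mulVec_add, Matrix.mulVec_mulVec,
      Matrix.nonsing_inv_mul _ hdet, Matrix.one_mulVec]
    ext i
    simp
  have hsymm : M⁻¹.transpose = M⁻¹ := by
    rw [Matrix.transpose_nonsing_inv, hM, Matrix.transpose_smul]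
    congr 2
    simpa using (isHermitian_gram b).eq
  have h3 : ∀ V : Fin d → ℝ, inner ℝ u (WithLp.toLp 2 (M⁻¹.mulVec V) : Vec d)
      = (M⁻¹.mulVec u.ofLp) ⬝ᵥ V := by
    intro V
    have : inner ℝ u (WithLp.toLp 2 (M⁻¹.mulVec V) : Vec d) = u.ofLp ⬝ᵥ M⁻¹.mulVec V := by
      simp [PiLp.inner_apply, dotProduct, mul_comm]
    rw [this, Matrix.dotProduct_mulVec, ← Matrix.mulVec_transpose, hsymm]
  rw [h2, h3, dotProduct_sum]
  refine Finset.sum_congr rfl fun s _ => ?_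
  rw [dotProduct_sum]
  refine Finset.sum_congr rfl fun k _ => ?_
  rw [dotProduct_smul, smul_eq_mul, mul_comm]
  rfl

/-- With `M = c B` and `w = M⁻¹ u` the left side is `wᵀ M w = wᵀ u`. It is at least `c λ₀ ‖w‖²` and
at most `‖w‖ ‖u‖`, which bounds first `‖w‖` and then the product. -/
lemma mul_sum_olsWeight_sq_le {b : Fin d → Vec d} (hd : 0 < d) (h : IsUnit (gram b)) {c : ℕ}
    (hc : 1 ≤ c) (u : Vec d) :
    c * ∑ k, olsWeight b c u k ^ 2 ≤ ‖u‖ ^ 2 / (c * lambdaZero b) := by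
  set M := (c : ℝ) • gram b with hM
  have hdet := isUnit_det_smul_gram h hc
  have hc' : (0 : ℝ) < c := by exact_mod_cast hc
  have hl := lambdaZero_pos hd h
  set w := M⁻¹.mulVec u.ofLp with hw
  have h1 : (c : ℝ) * ∑ k, olsWeight b c u k ^ 2 = w ⬝ᵥ u.ofLp := by
    have : (c : ℝ) * (w ⬝ᵥ (gram b).mulVec w) = w ⬝ᵥ M.mulVec w := by
      rw [hM, Matrix.smul_mulVec, dotProduct_smul, smul_eq_mul]
    have hMw : M.mulVec w = u.ofLp := by
      rw [hw, Matrix.mulVec_mulVec, Matrix.mul_nonsing_inv _ hdet, Matrix.one_mulVec]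
    rw [hMw, dotProduct_gram_mulVec] at this
    exact this
  have h2 : c * lambdaZero b * (w ⬝ᵥ w) ≤ w ⬝ᵥ u.ofLp := by
    rw [← h1, mul_assoc]
    refine mul_le_mul_of_nonneg_left ?_ hc'.le
    have := lambdaZero_mul_le_dotProduct b w
    rwa [dotProduct_gram_mulVec] at this
  have h3 : w ⬝ᵥ u.ofLp ≤ ‖(WithLp.toLp 2 w : Vec d)‖ * ‖u‖ := by
    have := real_inner_le_norm (WithLp.toLp 2 w : Vec d) u
    rw [PiLp.inner_apply] at this
    simpa [dotProduct, mul_comm (u.ofLp _)] using this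
  rw [h1]
  rw [dotProduct_self_eq_norm_sq] at h2
  set n := ‖(WithLp.toLp 2 w : Vec d)‖
  have hn : 0 ≤ n := norm_nonneg _
  have hu : 0 ≤ ‖u‖ := norm_nonneg _
  have hcl : 0 < c * lambdaZero b := by positivity
  have h4 : c * lambdaZero b * n ≤ ‖u‖ := by
    rcases hn.eq_or_lt with h0 | hpos
    · rw [← h0]; simp
    · refine le_of_mul_le_mul_right ?_ hpos
      linarith
  rw [le_div_iff₀ hcl]
  nlinarith

lemma hOne_nonneg {b : Fin d → Vec d} (h : IsUnit (gram b)) (σ : ℝ) : 0 ≤ hOne b σ := by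
  have : 0 ≤ (gram b).trace := by
    rw [(isHermitian_gram b).trace_eq_sum_eigenvalues]
    exact Finset.sum_nonneg fun i _ => ((posDef_gram h).eigenvalues_pos i).le
  rw [hOne]
  positivity

/-- Since `Tr B ≥ d λ₀`, the constant `h₁` already contains the dimension factor of the norm tail
bound. -/
lemma mul_sq_div_lambdaZero_le_hOne {b : Fin d → Vec d} (hd : 0 < d) (h : IsUnit (gram b))
    (σ : ℝ) : 2 * d * (σ ^ 2 / lambdaZero b) ≤ hOne b σ := by
  have hl := lambdaZero_pos hd h
  rw [hOne, le_div_iff₀ (by positivity)]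
  calc 2 * d * (σ ^ 2 / lambdaZero b) * lambdaZero b ^ 2
      = 2 * σ ^ 2 * (d * lambdaZero b) := by field_simp
    _ ≤ _ := by gcongr; exact mul_lambdaZero_le_trace b

/-! ### Exponential supermartingales with predictable weights -/

/-- The conditional bound is a comparison of measures on the smaller `σ`-algebra: density `Y`
against `K` times `μ`. Integrating `f` against both needs no integrability of `f`. -/
lemma lintegral_mul_ofReal_le {Ω : Type*} {m m0 : MeasurableSpace Ω} (hm : m ≤ m0)
    {μ : Measure Ω} [IsProbabilityMeasure μ] {Y : Ω → ℝ} (hY : Measurable Y)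
    (hint : Integrable Y μ) (hpos : ∀ ω, 0 ≤ Y ω) {K : ℝ} (hK : μ[Y | m] ≤ᵐ[μ] fun _ => K)
    {f : Ω → ENNReal} (hf : Measurable[m] f) :
    ∫⁻ ω, f ω * ENNReal.ofReal (Y ω) ∂μ ≤ ENNReal.ofReal K * ∫⁻ ω, f ω ∂μ := by
  have hYm : Measurable fun ω => ENNReal.ofReal (Y ω) := ENNReal.measurable_ofReal.comp hY
  have h1 : (μ.withDensity fun ω => ENNReal.ofReal (Y ω)).trim hm
      ≤ ENNReal.ofReal K • μ.trim hm := by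
    rw [Measure.le_iff]
    intro s hs
    rw [trim_measurableSet_eq hm hs, Measure.smul_apply, trim_measurableSet_eq hm hs,
      withDensity_apply _ (hm s hs),
      ← ofReal_integral_eq_lintegral_ofReal hint.integrableOn
        (Filter.Eventually.of_forall hpos), ← setIntegral_condExp hm hint hs, smul_eq_mul]
    have h2 : ∫ ω in s, (μ[Y | m]) ω ∂μ ≤ ∫ _ω in s, K ∂μ :=
      setIntegral_mono_ae integrable_condExp.integrableOn (integrable_const K).integrableOn hK
    rw [setIntegral_const, smul_eq_mul, mul_comm] at h2
    refine (ENNReal.ofReal_le_ofReal h2).trans ?_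
    by_cases hK0 : 0 ≤ K
    · rw [ENNReal.ofReal_mul hK0, Measure.real, ENNReal.ofReal_toReal (measure_ne_top _ _)]
    · rw [ENNReal.ofReal_of_nonpos (mul_nonpos_of_nonpos_of_nonneg (by linarith)
        measureReal_nonneg)]
      exact zero_le
  calc ∫⁻ ω, f ω * ENNReal.ofReal (Y ω) ∂μ
      = ∫⁻ ω, f ω ∂(μ.withDensity fun ω => ENNReal.ofReal (Y ω)) := by
        rw [lintegral_withDensity_eq_lintegral_mul _ hYm (hf.mono hm le_rfl)]
        simp_rw [Pi.mul_apply, mul_comm]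
    _ = ∫⁻ ω, f ω ∂((μ.withDensity fun ω => ENNReal.ofReal (Y ω)).trim hm) :=
        (lintegral_trim hm hf).symm
    _ ≤ ∫⁻ ω, f ω ∂(ENNReal.ofReal K • μ.trim hm) := lintegral_mono' h1 le_rfl
    _ = _ := by rw [lintegral_smul_measure, lintegral_trim hm hf, smul_eq_mul]

section History

variable {Ω : Type*} {x : ℕ → Ω → Vec d} {η : ℕ → Ω → ℝ}

lemma history_mono {s t : ℕ} (h : s ≤ t) : history x η s ≤ history x η t :=
  sup_le_sup (biSup_mono fun _ hi => le_trans hi h) (biSup_mono fun _ hi => lt_of_lt_of_le hi h)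

lemma measurable_action_history {s t : ℕ} (h : s ≤ t) : Measurable[history x η t] (x s) := by
  refine Measurable.mono (comap_measurable (x s)) ?_ le_rfl
  exact le_sup_of_le_left (le_biSup (fun s => MeasurableSpace.comap (x s) inferInstance) h)

lemma measurable_noise_history {s t : ℕ} (h : s < t) : Measurable[history x η t] (η s) := by
  refine Measurable.mono (comap_measurable (η s)) ?_ le_rfl
  exact le_sup_of_le_right (le_biSup (fun s => MeasurableSpace.comap (η s) inferInstance) h)

variable [m0 : MeasurableSpace Ω]

lemma history_le (hx : ∀ t, Measurable (x t)) (hη : ∀ t, Measurable (η t)) (t : ℕ) :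
    history x η t ≤ m0 :=
  sup_le (iSup₂_le fun s _ => (hx s).comap_le) (iSup₂_le fun s _ => (hη s).comap_le)

/-- One step of the exponential supermartingale. -/
lemma lintegral_mul_exp_le {μ : Measure Ω} [IsProbabilityMeasure μ] {σ : ℝ}
    (hx : ∀ t, Measurable (x t)) (hη : ∀ t, Measurable (η t))
    (hsub : IsCondSubGaussian μ x η σ) (t : ℕ) {β : Ω → ℝ} (hβ : Measurable[history x η t] β)
    (hfin : (Set.range β).Finite) {f : Ω → ENNReal} (hf : Measurable[history x η t] f) :
    ∫⁻ ω, f ω * ENNReal.ofReal (Real.exp (β ω * η t ω - β ω ^ 2 * σ ^ 2 / 2)) ∂μ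
      ≤ ∫⁻ ω, f ω ∂μ := by
  have hle := history_le hx hη t
  -- Splitting by the finitely many values of `β` reduces to constant exponents, for which `mgf_le`
  -- is available.
  set V := hfin.toFinset with hV
  have hmem : ∀ ω, β ω ∈ V := fun ω => by simp [hV]
  have hind : ∀ a, Measurable[history x η t] fun ω => if β ω = a then f ω else 0 := fun a => by
    refine Measurable.ite ?_ hf measurable_const
    exact hβ (measurableSet_singleton a)
  have hsplit : ∀ (F : ℝ → Ω → ENNReal) ω, F (β ω) ω = ∑ a ∈ V, if β ω = a then F a ω else 0 := by
    intro F ω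
    rw [Finset.sum_ite_eq, if_pos (hmem ω)]
  have hstep : ∀ a, ∫⁻ ω, (if β ω = a then f ω else 0) *
      ENNReal.ofReal (Real.exp (a * η t ω - a ^ 2 * σ ^ 2 / 2)) ∂μ
      ≤ ∫⁻ ω, (if β ω = a then f ω else 0) ∂μ := by
    intro a
    have h1 := lintegral_mul_ofReal_le hle (K := Real.exp (a ^ 2 * σ ^ 2 / 2))
      (Y := fun ω => Real.exp (a * η t ω)) (by have := hη t; fun_prop)
      (hsub.integrable_exp t a) (fun ω => (Real.exp_pos _).le) (hsub.mgf_le t a) (hind a)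
    have h2 : ∀ ω, (if β ω = a then f ω else 0) *
        ENNReal.ofReal (Real.exp (a * η t ω - a ^ 2 * σ ^ 2 / 2))
        = ENNReal.ofReal (Real.exp (-(a ^ 2 * σ ^ 2 / 2))) *
          ((if β ω = a then f ω else 0) * ENNReal.ofReal (Real.exp (a * η t ω))) := by
      intro ω
      rw [sub_eq_add_neg, Real.exp_add, ENNReal.ofReal_mul (Real.exp_pos _).le]
      ring
    simp_rw [h2]
    rw [lintegral_const_mul' _ _ ENNReal.ofReal_ne_top]
    calc _ ≤ ENNReal.ofReal (Real.exp (-(a ^ 2 * σ ^ 2 / 2))) *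
          (ENNReal.ofReal (Real.exp (a ^ 2 * σ ^ 2 / 2)) *
            ∫⁻ ω, (if β ω = a then f ω else 0) ∂μ) := by gcongr
      _ = _ := by
          rw [← mul_assoc, ← ENNReal.ofReal_mul (Real.exp_pos _).le, ← Real.exp_add]
          simp
  have hmeas : ∀ a, Measurable fun ω => (if β ω = a then f ω else 0) := fun a =>
    (hind a).mono hle le_rfl
  calc ∫⁻ ω, f ω * ENNReal.ofReal (Real.exp (β ω * η t ω - β ω ^ 2 * σ ^ 2 / 2)) ∂μ
      = ∫⁻ ω, ∑ a ∈ V, (if β ω = a then f ω else 0) *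
          ENNReal.ofReal (Real.exp (a * η t ω - a ^ 2 * σ ^ 2 / 2)) ∂μ := by
        refine lintegral_congr fun ω => ?_
        rw [hsplit (fun a ω => f ω * ENNReal.ofReal (Real.exp (a * η t ω - a ^ 2 * σ ^ 2 / 2)))]
        exact Finset.sum_congr rfl fun a _ => by split_ifs <;> simp
    _ = ∑ a ∈ V, ∫⁻ ω, (if β ω = a then f ω else 0) *
          ENNReal.ofReal (Real.exp (a * η t ω - a ^ 2 * σ ^ 2 / 2)) ∂μ := by
        refine lintegral_finsetSum _ fun a _ => (hmeas a).mul ?_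
        have := hη t
        fun_prop
    _ ≤ ∑ a ∈ V, ∫⁻ ω, (if β ω = a then f ω else 0) ∂μ := Finset.sum_le_sum fun a _ => hstep a
    _ = ∫⁻ ω, f ω ∂μ := by
        rw [← lintegral_finsetSum _ fun a _ => hmeas a]
        exact lintegral_congr fun ω => (hsplit (fun _ ω => f ω) ω).symm

lemma lintegral_exp_sum_le_one {μ : Measure Ω} [IsProbabilityMeasure μ] {σ : ℝ}
    (hx : ∀ t, Measurable (x t)) (hη : ∀ t, Measurable (η t))
    (hsub : IsCondSubGaussian μ x η σ) {β : ℕ → Ω → ℝ}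
    (hβ : ∀ t, Measurable[history x η t] (β t)) (hfin : ∀ t, (Set.range (β t)).Finite) (N : ℕ) :
    ∫⁻ ω, ENNReal.ofReal (Real.exp
      (∑ t ∈ Finset.range N, (β t ω * η t ω - β t ω ^ 2 * σ ^ 2 / 2))) ∂μ ≤ 1 := by
  induction N with
  | zero => simp
  | succ N ih =>
    refine le_trans ?_ ih
    simp_rw [Finset.sum_range_succ, Real.exp_add, ENNReal.ofReal_mul (Real.exp_pos _).le]
    refine lintegral_mul_exp_le hx hη hsub N (hβ N) (hfin N) ?_
    refine ENNReal.measurable_ofReal.comp (Real.measurable_exp.comp ?_)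
    refine Finset.measurable_sum _ fun t ht => ?_
    have h1 : t < N := Finset.mem_range.1 ht
    have h2 : Measurable[history x η N] (β t) := (hβ t).mono (history_mono h1.le) le_rfl
    exact (h2.mul (measurable_noise_history h1)).sub (((h2.pow_const 2).mul_const _).div_const _)

lemma sum_ite_eq_sq {ι : Type*} [DecidableEq ι] {s : Finset ι} {f : ι → ℕ}
    (hf : Set.InjOn f s) (a : ι → ℝ) (t : ℕ) :
    (∑ p ∈ s, if f p = t then a p else 0) ^ 2 = ∑ p ∈ s, if f p = t then a p ^ 2 else 0 := by
  by_cases h : ∃ p ∈ s, f p = t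
  · obtain ⟨p, hp, rfl⟩ := h
    have h1 : ∀ q ∈ s, q ≠ p → ¬ f q = f p := fun q hq hne he => hne (hf hq hp he)
    rw [Finset.sum_eq_single_of_mem p hp fun q hq hne => if_neg (h1 q hq hne),
      Finset.sum_eq_single_of_mem p hp fun q hq hne => if_neg (h1 q hq hne), if_pos rfl, if_pos rfl]
  · push Not at h
    rw [Finset.sum_eq_zero fun p hp => if_neg (h p hp),
      Finset.sum_eq_zero fun p hp => if_neg (h p hp)]
    simp

/-- Noise which is sampled at predictable, pairwise different times is jointly sub-Gaussian. -/
lemma lintegral_exp_sampled_le {μ : Measure Ω} [IsProbabilityMeasure μ] {σ : ℝ}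
    (hx : ∀ t, Measurable (x t)) (hη : ∀ t, Measurable (η t))
    (hsub : IsCondSubGaussian μ x η σ) {ι : Type*} [DecidableEq ι] (s : Finset ι)
    {τ : ι → Ω → ℕ} (hτ : ∀ p ∈ s, ∀ t, MeasurableSet[history x η t] {ω | τ p ω = t})
    (hinj : ∀ ω, Set.InjOn (fun p => τ p ω) s) {N : ℕ} (hN : ∀ p ∈ s, ∀ ω, τ p ω < N)
    (a : ι → ℝ) :
    ∫⁻ ω, ENNReal.ofReal (Real.exp (∑ p ∈ s, a p * η (τ p ω) ω)) ∂μ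
      ≤ ENNReal.ofReal (Real.exp (σ ^ 2 * (∑ p ∈ s, a p ^ 2) / 2)) := by
  -- At time `t` the noise carries the weight of the index sampled then, if any. This is known from
  -- the history at `t`, and as the times are distinct no cross terms appear in `β t ω ^ 2`.
  set β : ℕ → Ω → ℝ := fun t ω => ∑ p ∈ s, if τ p ω = t then a p else 0 with hβ
  have h1 : ∀ ω, ∑ t ∈ Finset.range N, (β t ω * η t ω - β t ω ^ 2 * σ ^ 2 / 2)
      = ∑ p ∈ s, a p * η (τ p ω) ω - σ ^ 2 * (∑ p ∈ s, a p ^ 2) / 2 := by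
    intro ω
    have e1 : ∑ t ∈ Finset.range N, β t ω * η t ω = ∑ p ∈ s, a p * η (τ p ω) ω := by
      simp_rw [hβ, Finset.sum_mul]
      rw [Finset.sum_comm]
      refine Finset.sum_congr rfl fun p hp => ?_
      simp_rw [ite_mul, zero_mul]
      rw [Finset.sum_ite_eq, if_pos (Finset.mem_range.2 (hN p hp ω))]
    have e2 : ∑ t ∈ Finset.range N, β t ω ^ 2 = ∑ p ∈ s, a p ^ 2 := by
      simp_rw [hβ, sum_ite_eq_sq (hinj ω)]
      rw [Finset.sum_comm]
      refine Finset.sum_congr rfl fun p hp => ?_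
      rw [Finset.sum_ite_eq, if_pos (Finset.mem_range.2 (hN p hp ω))]
    rw [Finset.sum_sub_distrib, e1, ← Finset.sum_div, ← Finset.sum_mul, e2, mul_comm (σ ^ 2)]
  have h2 := lintegral_exp_sum_le_one hx hη hsub (β := β) (fun t => ?_) (fun t => ?_) N
  · simp_rw [h1, sub_eq_add_neg, Real.exp_add, ENNReal.ofReal_mul (Real.exp_pos _).le] at h2
    rw [lintegral_mul_const' _ _ ENNReal.ofReal_ne_top, Real.exp_neg,
      ENNReal.ofReal_inv_of_pos (Real.exp_pos _), ← div_eq_mul_inv] at h2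
    rwa [ENNReal.div_le_iff (by simp [Real.exp_pos]) ENNReal.ofReal_ne_top, one_mul] at h2
  · refine Finset.measurable_sum _ fun p hp => ?_
    exact Measurable.ite (hτ p hp t) measurable_const measurable_const
  -- The value of `β t` depends only on which indices of `s` are sampled at time `t`, so its range
  -- is finite.
  · refine (Set.finite_range fun P : s → Prop =>
      ∑ p ∈ s.attach, (open Classical in if P p then a p else 0)).subset ?_
    rintro _ ⟨ω, rfl⟩
    refine ⟨fun p => τ p ω = t, ?_⟩
    simp only [hβ]
    rw [← Finset.sum_attach s]
    exact Finset.sum_congr rfl fun p _ => by congr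

end History

/-! ### The course of a run -/

lemma errBound_nonneg (b : Fin d → Vec d) (σ δ : ℝ) (c : ℕ) : 0 ≤ errBound b σ δ c :=
  Real.sqrt_nonneg _

lemma olsEstimate_congr (b : Fin d → Vec d) (Y : ℕ → ℝ) {start start' : ℕ → ℕ} {c : ℕ}
    (h : ∀ s ∈ Finset.Icc 1 c, start s = start' s) :
    olsEstimate b Y start c = olsEstimate b Y start' c := by
  rw [olsEstimate, olsEstimate, Finset.sum_congr rfl fun s hs => by rw [h s hs]]

/-- The estimate of cycle `c` in a run which has not found a support before. -/
def warmEstimate (b : Fin d → Vec d) (Y : ℕ → ℝ) (c : ℕ) : Vec d :=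
  olsEstimate b Y (fun s => (s - 1) * d) c

namespace APSEEGRun

variable {X : Set (Vec d)} {b : Fin d → Vec d} {H : ℕ} {σ δ : ℝ} {x : ℕ → Vec d} {Y : ℕ → ℝ}
  (run : APSEEGRun X b H σ δ x Y)

lemma supp_eq_none_of_succ {c : ℕ} (h : run.supp (c + 1) = none) : run.supp c = none := by
  by_contra hne
  obtain ⟨S, hS⟩ := Option.ne_none_iff_exists'.1 hne
  rw [run.supp_locked c S hS] at h
  exact absurd h (by simp)

lemma start_eq_of_none {c : ℕ} (h : run.supp c = none) :
    ∀ s ∈ Finset.Icc 1 (c + 1), run.start s = (s - 1) * d := by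
  induction c with
  | zero =>
    intro s hs
    obtain rfl : s = 1 := by simpa using hs
    simp [run.start_one]
  | succ c ih =>
    intro s hs
    have ih' := ih (run.supp_eq_none_of_succ h)
    rw [Finset.mem_Icc] at hs
    rcases Nat.lt_or_ge s (c + 2) with h1 | h1
    · exact ih' s (Finset.mem_Icc.2 ⟨hs.1, by omega⟩)
    · obtain rfl : s = c + 1 + 1 := by omega
      rw [run.start_succ (c + 1) (by omega), ih' (c + 1) (Finset.mem_Icc.2 ⟨by omega, le_rfl⟩), h]
      simp [Nat.succ_mul]

lemma est_eq_warmEstimate {c : ℕ} (h : run.supp c = none) :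
    run.est (c + 1) = warmEstimate b Y (c + 1) := by
  rw [run.est_eq (c + 1) (by omega), warmEstimate]
  exact olsEstimate_congr b Y (run.start_eq_of_none h)

/-- Until a support is fixed every cycle lasts exactly `d` steps, so the actual estimates are the
warm estimates; afterwards the support is locked. Thus the status after cycle `c` is a function of
data at deterministic times. -/
lemma isSome_supp_iff (hb : Bornology.IsBounded X) (h0 : (0 : Vec d) ∈ X) (c : ℕ) :
    (run.supp c).isSome ↔ ∃ j ∈ Finset.Icc 1 c,
      warmEstimate b Y j ∈ gapSet X H (2 * lmax X * errBound b σ δ j) := by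
  induction c with
  | zero => simp [run.supp_zero]
  | succ c ih =>
    rw [← Finset.insert_Icc_right_eq_Icc_add_one (show 1 ≤ c + 1 by omega)]
    simp only [Finset.mem_insert, exists_eq_or_imp]
    rw [← ih]
    cases hs : run.supp c with
    | some S => simp [run.supp_locked c S hs]
    | none =>
      rw [← run.est_eq_warmEstimate hs, mem_gapSet_iff hb h0
        (mul_nonneg (mul_nonneg zero_le_two (lmax_nonneg X)) (errBound_nonneg b σ δ _))
        (run.pick_greedy (c + 1) (by omega))]
      by_cases hc : ((2 * lmax X * errBound b σ δ (c + 1) : ℝ) : EReal)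
        < greedyGap X H (run.est (c + 1)) (run.pick (c + 1))
      · simp [run.supp_found c hs hc, hc, -EReal.coe_mul]
      · simp [run.supp_not_found c hs hc, hc, -EReal.coe_mul, -not_lt]

lemma start_eq_sum {s : ℕ} (hs : 1 ≤ s) :
    run.start s = (s - 1) * d + ∑ i ∈ Finset.Ico 1 s, if (run.supp i).isSome then i else 0 := by
  induction s, hs using Nat.le_induction with
  | base => simp [run.start_one]
  | succ s hs ih =>
    rw [run.start_succ s hs, ih, Finset.sum_Ico_succ_top hs]
    obtain ⟨r, rfl⟩ : ∃ r, s = r + 1 := ⟨s - 1, by omega⟩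
    simp only [Nat.add_sub_cancel]
    ring

lemma le_start {s : ℕ} (hs : 1 ≤ s) : (s - 1) * d ≤ run.start s := by
  rw [run.start_eq_sum hs]; omega

/-- A deterministic horizon for all samples of the first `c` cycles, as the supermartingale argument
requires. -/
lemma start_add_lt {c s : ℕ} (hs : s ∈ Finset.Icc 1 c) (k : Fin d) :
    run.start s + k < c * d + c * c := by
  rw [Finset.mem_Icc] at hs
  rw [run.start_eq_sum hs.1]
  have h1 : ∑ i ∈ Finset.Ico 1 s, (if (run.supp i).isSome then i else 0)
      ≤ ∑ _i ∈ Finset.Ico 1 s, c :=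
    Finset.sum_le_sum fun i hi => by
      have := Finset.mem_Ico.1 hi
      split_ifs <;> omega
  rw [Finset.sum_const, Nat.card_Ico, smul_eq_mul] at h1
  have h2 : (s - 1) * c ≤ c * c := Nat.mul_le_mul_right _ (by omega)
  have h3 : (s - 1) * d + d ≤ c * d := by
    calc (s - 1) * d + d = (s - 1 + 1) * d := by ring
      _ ≤ c * d := Nat.mul_le_mul_right _ (by omega)
  have := k.2
  omega

lemma start_add_le_start {s t : ℕ} (hs : 1 ≤ s) (hst : s < t) :
    run.start s + d ≤ run.start t := by
  induction t, hst using Nat.le_induction with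
  | base => rw [Nat.succ_eq_add_one, run.start_succ s hs]; omega
  | succ t ht ih =>
    have : 1 ≤ t := by simp at ht; omega
    rw [run.start_succ t this]; omega

lemma injOn_start_add (c : ℕ) :
    Set.InjOn (fun p : ℕ × Fin d => run.start p.1 + p.2) (Finset.Icc 1 c ×ˢ Finset.univ : Finset (ℕ × Fin d)) := by
  rintro ⟨s, k⟩ hs ⟨t, l⟩ ht h
  simp only [Finset.coe_product, Finset.coe_Icc, Finset.coe_univ, Set.mem_prod, Set.mem_Icc,
    Set.mem_univ, and_true] at hs ht h
  have hk := k.2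
  have hl := l.2
  rcases lt_trichotomy s t with hst | rfl | hst
  · have := run.start_add_le_start hs.1 hst; omega
  · simp only [Nat.add_left_cancel_iff] at h
    rw [Fin.ext h]
  · have := run.start_add_le_start ht.1 hst; omega

end APSEEGRun

/-! ### Predictability of the exploration times -/

section Concentration

variable {Ω : Type*} {X : Set (Vec d)} {b : Fin d → Vec d} {H : ℕ} {σ δ : ℝ}
  {θ : Vec d} {x : ℕ → Ω → Vec d} {η : ℕ → Ω → ℝ}

lemma measurable_olsEstimate {m : MeasurableSpace Ω} {Y : ℕ → Ω → ℝ} {start : ℕ → ℕ} {c : ℕ}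
    (h : ∀ s ∈ Finset.Icc 1 c, ∀ k : Fin d, Measurable (Y (start s + k))) :
    Measurable fun ω => olsEstimate b (fun t => Y t ω) start c := by
  refine (WithLp.measurable_toLp 2 _).comp ?_
  refine (Continuous.matrix_mulVec continuous_const continuous_id).measurable.comp ?_
  refine Finset.measurable_sum _ fun s hs => Finset.measurable_sum _ fun k _ => ?_
  exact (h s hs k).smul_const _

lemma measurable_warmEstimate (c : ℕ) : Measurable[history x η (c * d)]
    fun ω => warmEstimate b (fun t => inner ℝ θ (x t ω) + η t ω) c := by
  refine measurable_olsEstimate (Y := fun t ω => inner ℝ θ (x t ω) + η t ω)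
    (m := history x η (c * d)) fun s hs k => ?_
  have hlt : (s - 1) * d + k < c * d := by
    rw [Finset.mem_Icc] at hs
    calc (s - 1) * d + k < (s - 1) * d + d := by omega
      _ = (s - 1 + 1) * d := by ring
      _ ≤ c * d := Nat.mul_le_mul_right _ (by omega)
  refine Measurable.add ?_ (measurable_noise_history hlt)
  exact (Continuous.inner continuous_const continuous_id).measurable.comp
    (measurable_action_history hlt.le)

variable (run : ∀ ω, APSEEGRun X b H σ δ (fun t => x t ω)
  (fun t => inner ℝ θ (x t ω) + η t ω))

lemma measurableSet_isSome_supp (hb : Bornology.IsBounded X) (h0 : (0 : Vec d) ∈ X)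
    (hd : 0 < d) (c : ℕ) :
    MeasurableSet[history x η (c * d)] {ω | ((run ω).supp c).isSome} := by
  have h1 : {ω | ((run ω).supp c).isSome} = ⋃ j ∈ Finset.Icc 1 c,
      (fun ω => warmEstimate b (fun t => inner ℝ θ (x t ω) + η t ω) j) ⁻¹'
        gapSet X H (2 * lmax X * errBound b σ δ j) := by
    ext ω
    simp only [Set.mem_ofPred_eq, Set.mem_iUnion, Set.mem_preimage, exists_prop]
    exact (run ω).isSome_supp_iff hb h0 c
  rw [h1]
  refine Finset.measurableSet_biUnion _ fun j hj => ?_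
  have hjc : j * d ≤ c * d := Nat.mul_le_mul_right _ (Finset.mem_Icc.1 hj).2
  refine (measurable_warmEstimate j).mono (history_mono hjc) le_rfl ?_
  exact (isOpen_gapSet hb h0 hd H (mul_nonneg (mul_nonneg zero_le_two (lmax_nonneg X))
    (errBound_nonneg b σ δ _))).measurableSet

lemma measurable_start (hb : Bornology.IsBounded X) (h0 : (0 : Vec d) ∈ X) (hd : 0 < d) {s : ℕ}
    (hs : 1 ≤ s) : Measurable[history x η ((s - 1) * d)] fun ω => (run ω).start s := by
  simp_rw [(run _).start_eq_sum hs]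
  refine measurable_const.add (Finset.measurable_sum _ fun i hi => ?_)
  have hi' : i * d ≤ (s - 1) * d :=
    Nat.mul_le_mul_right _ (by have := Finset.mem_Ico.1 hi; omega)
  exact Measurable.ite (history_mono hi' _ (measurableSet_isSome_supp run hb h0 hd i))
    measurable_const measurable_const

/-- The start of cycle `s` is determined by the history at `(s - 1) * d` and never occurs earlier,
so it is known by the time it happens. -/
lemma measurableSet_start_add_eq (hb : Bornology.IsBounded X) (h0 : (0 : Vec d) ∈ X)
    (hd : 0 < d) {s : ℕ} (hs : 1 ≤ s) (k : Fin d) (t : ℕ) :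
    MeasurableSet[history x η t] {ω | (run ω).start s + k = t} := by
  by_cases h : (s - 1) * d ≤ t
  · have h1 : MeasurableSet[history x η ((s - 1) * d)] {ω | (run ω).start s + k = t} :=
      ((measurable_start run hb h0 hd hs).add_const (k : ℕ)) (measurableSet_singleton t)
    exact history_mono h _ h1
  · have : {ω | (run ω).start s + k = t} = ∅ := by
      ext ω
      have := (run ω).le_start hs
      simp only [Set.mem_ofPred_eq, Set.mem_empty_iff_false, iff_false]
      omega
    rw [this]
    exact @MeasurableSet.empty _ (history x η t)

/-! ### Concentration of the estimates -/

variable [MeasurableSpace Ω] {μ : Measure Ω} [IsProbabilityMeasure μ]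

lemma measurable_est (hx : ∀ t, Measurable (x t)) (hη : ∀ t, Measurable (η t))
    (hb : Bornology.IsBounded X) (h0 : (0 : Vec d) ∈ X) (hd : 0 < d) {c : ℕ} (hc : 1 ≤ c) :
    Measurable fun ω => (run ω).est c := by
  simp_rw [(run _).est_eq c hc]
  refine (WithLp.measurable_toLp 2 _).comp ?_
  refine (Continuous.matrix_mulVec continuous_const continuous_id).measurable.comp ?_
  refine Finset.measurable_sum _ fun s hs => Finset.measurable_sum _ fun k _ => ?_
  refine Measurable.smul_const ?_ _
  have hs' : Measurable fun ω => (run ω).start s + (k : ℕ) :=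
    ((measurable_start run hb h0 hd (Finset.mem_Icc.1 hs).1).mono (history_le hx hη _)
      le_rfl).add_const _
  -- Rewards at random times are measurable because the time index is countable.
  have h1 : Measurable fun p : ℕ × Ω => inner ℝ θ (x p.1 p.2) + η p.1 p.2 :=
    measurable_from_prod_countable_right fun t =>
      ((Continuous.inner continuous_const continuous_id).measurable.comp (hx t)).add (hη t)
  exact h1.comp (hs'.prodMk measurable_id)

/-- The estimation error of cycle `c` is sub-Gaussian with variance proxy `σ² / (c λ₀)`. -/
lemma lintegral_exp_inner_est_sub_le (hx : ∀ t, Measurable (x t)) (hη : ∀ t, Measurable (η t))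
    (hsub : IsCondSubGaussian μ x η σ) (hB : IsUnit (gram b))
    (hb : Bornology.IsBounded X) (h0 : (0 : Vec d) ∈ X) (hd : 0 < d) {c : ℕ} (hc : 1 ≤ c)
    (u : Vec d) :
    ∫⁻ ω, ENNReal.ofReal (Real.exp (inner ℝ u ((run ω).est c - θ))) ∂μ
      ≤ ENNReal.ofReal (Real.exp (σ ^ 2 / (c * lambdaZero b) * ‖u‖ ^ 2 / 2)) := by
  have h1 : ∀ ω, inner ℝ u ((run ω).est c - θ) = ∑ p ∈ Finset.Icc 1 c ×ˢ Finset.univ,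
      olsWeight b c u p.2 * η ((run ω).start p.1 + p.2) ω := fun ω => by
    rw [(run ω).est_eq c hc, inner_olsEstimate_sub hB hc (η := fun t => η t ω)
      (run ω).explore, Finset.sum_product]
  simp_rw [h1]
  refine (lintegral_exp_sampled_le hx hη hsub
    (Finset.Icc 1 c ×ˢ Finset.univ : Finset (ℕ × Fin d)) (τ := fun p ω => (run ω).start p.1 + p.2) (N := c * d + c * c) ?_
    (fun ω => (run ω).injOn_start_add c) ?_ fun p => olsWeight b c u p.2).trans ?_
  · rintro ⟨s, k⟩ hp t
    exact measurableSet_start_add_eq run hb h0 hd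
      (Finset.mem_Icc.1 (Finset.mem_product.1 hp).1).1 k t
  · rintro ⟨s, k⟩ hp ω
    exact (run ω).start_add_lt (Finset.mem_product.1 hp).1 k
  · refine ENNReal.ofReal_le_ofReal (Real.exp_le_exp.2 ?_)
    have h2 : ∑ p ∈ Finset.Icc 1 c ×ˢ (Finset.univ : Finset (Fin d)), olsWeight b c u p.2 ^ 2
        = c * ∑ k, olsWeight b c u k ^ 2 := by
      rw [Finset.sum_product]
      simp
    rw [h2]
    have h3 := mul_sum_olsWeight_sq_le hd hB hc u
    calc σ ^ 2 * (c * ∑ k, olsWeight b c u k ^ 2) / 2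
        ≤ σ ^ 2 * (‖u‖ ^ 2 / (c * lambdaZero b)) / 2 := by gcongr
      _ = _ := by ring

/-- The tail bound is used at level `log (2 d c² / δ)`; `d ≥ 2` turns `20/9 * δ / (2 d c²)` into a
summable `5/9 * δ / c²`. -/
lemma measure_est_error_le (hx : ∀ t, Measurable (x t)) (hη : ∀ t, Measurable (η t))
    (hsub : IsCondSubGaussian μ x η σ) (hB : IsUnit (gram b)) (hσ : 0 < σ)
    (hb : Bornology.IsBounded X) (h0 : (0 : Vec d) ∈ X) (hd : 2 ≤ d) (hδ0 : 0 < δ) (hδ1 : δ < 1)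
    {c : ℕ} (hc : 1 ≤ c) :
    μ {ω | errBound b σ δ c ^ 2 < 11 / 10 * ‖(run ω).est c - θ‖ ^ 2}
      ≤ ENNReal.ofReal (5 / 9 * δ * (1 / (c : ℝ) ^ 2)) := by
  have hd0 : 0 < d := by omega
  have hd' : (2 : ℝ) ≤ d := by exact_mod_cast hd
  have hc' : (1 : ℝ) ≤ c := by exact_mod_cast hc
  have hl := lambdaZero_pos hd0 hB
  set v := σ ^ 2 / (c * lambdaZero b) with hv
  have hv0 : 0 < v := by positivity
  set l := Real.log (2 * d * (c : ℝ) ^ 2 / δ) with hl'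
  have harg : 1 ≤ 2 * d * (c : ℝ) ^ 2 / δ := by
    rw [le_div_iff₀ hδ0]
    nlinarith
  have hl0 : 0 ≤ l := Real.log_nonneg harg
  have h1 : 2 * d * v * l ≤ errBound b σ δ c ^ 2 := by
    have hh := mul_sq_div_lambdaZero_le_hOne hd0 hB σ
    rw [errBound, Real.sq_sqrt (by have := hOne_nonneg hB σ; positivity), ← hl']
    have : 2 * d * v * l = 2 * d * (σ ^ 2 / lambdaZero b) * l / c := by
      rw [hv]; field_simp
    rw [this]
    gcongr
  have hm : Measurable fun ω => (run ω).est c - θ :=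
    (measurable_est run hx hη hb h0 hd0 hc).sub_const θ
  have h2 := measure_norm_sq_gt_le hd hm hv0
    (lintegral_exp_inner_est_sub_le run hx hη hsub hB hb h0 hd0 hc) l
  refine (measure_mono fun ω hω => ?_).trans (h2.trans (ENNReal.ofReal_le_ofReal ?_))
  · exact lt_of_le_of_lt h1 hω
  · rw [Real.exp_neg, hl', Real.exp_log (by linarith), inv_div]
    have : δ / (2 * d * (c : ℝ) ^ 2) ≤ δ / (2 * 2 * (c : ℝ) ^ 2) := by gcongr
    calc 20 / 9 * (δ / (2 * d * (c : ℝ) ^ 2)) ≤ 20 / 9 * (δ / (2 * 2 * (c : ℝ) ^ 2)) := by gcongr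
      _ = _ := by field_simp; norm_num

/-- With probability at least `1 - δ` all estimates are accurate. -/
lemma exists_good_event (hx : ∀ t, Measurable (x t)) (hη : ∀ t, Measurable (η t))
    (hsub : IsCondSubGaussian μ x η σ) (hB : IsUnit (gram b)) (hσ : 0 < σ)
    (hb : Bornology.IsBounded X) (h0 : (0 : Vec d) ∈ X) (hd : 2 ≤ d) (hδ0 : 0 < δ)
    (hδ1 : δ < 1) :
    ∃ E : Set Ω, MeasurableSet E ∧ ENNReal.ofReal (1 - δ) ≤ μ E ∧
      ∀ ω ∈ E, ∀ c, 1 ≤ c → 11 / 10 * ‖(run ω).est c - θ‖ ^ 2 ≤ errBound b σ δ c ^ 2 := by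
  set bad : ℕ → Set Ω := fun c =>
    {ω | errBound b σ δ (c + 1) ^ 2 < 11 / 10 * ‖(run ω).est (c + 1) - θ‖ ^ 2} with hbad
  have hm : ∀ c, MeasurableSet (bad c) := fun c => by
    have := measurable_est run hx hη hb h0 (by omega : 0 < d) (show 1 ≤ c + 1 by omega)
    exact measurableSet_lt measurable_const (by fun_prop)
  have hsum : HasSum (fun c : ℕ => 5 / 9 * δ * (1 / ((c + 1 : ℕ) : ℝ) ^ 2))
      (5 / 9 * δ * (Real.pi ^ 2 / 6)) := by
    have h1 := (hasSum_nat_add_iff' 1).2 hasSum_zeta_two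
    simp only [Finset.range_one, Finset.sum_singleton, Nat.cast_zero, ne_eq, OfNat.ofNat_ne_zero,
      not_false_eq_true, zero_pow, div_zero, sub_zero] at h1
    exact h1.mul_left _
  have hle : μ (⋃ c, bad c) ≤ ENNReal.ofReal δ := by
    calc μ (⋃ c, bad c) ≤ ∑' c, μ (bad c) := measure_iUnion_le _
      _ ≤ ∑' c : ℕ, ENNReal.ofReal (5 / 9 * δ * (1 / ((c + 1 : ℕ) : ℝ) ^ 2)) :=
          ENNReal.tsum_le_tsum fun c =>
            measure_est_error_le run hx hη hsub hB hσ hb h0 hd hδ0 hδ1 (by omega)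
      _ = ENNReal.ofReal (5 / 9 * δ * (Real.pi ^ 2 / 6)) := by
          rw [← ENNReal.ofReal_tsum_of_nonneg (fun c => by positivity) hsum.summable,
            hsum.tsum_eq]
      _ ≤ ENNReal.ofReal δ := by
          refine ENNReal.ofReal_le_ofReal ?_
          have h1 := Real.pi_lt_d2
          have h2 := Real.pi_pos
          -- Enough for `5/9 * π² / 6 ≤ 1`.
          have : Real.pi ^ 2 ≤ 10 := by nlinarith
          nlinarith
  refine ⟨(⋃ c, bad c)ᶜ, (MeasurableSet.iUnion hm).compl, ?_, fun ω hω c hc => ?_⟩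
  · rw [prob_compl_eq_one_sub (MeasurableSet.iUnion hm), ENNReal.ofReal_sub _ hδ0.le,
      ENNReal.ofReal_one]
    exact tsub_le_tsub_left hle 1
  · by_contra h
    push Not at h
    refine hω (Set.mem_iUnion.2 ⟨c - 1, ?_⟩)
    simp only [hbad, Set.mem_ofPred_eq]
    rwa [Nat.sub_add_cancel hc]

end Concentration

/-! ### The error bound -/

lemma errBound_sq {b : Fin d → Vec d} (hB : IsUnit (gram b)) (σ : ℝ) {δ : ℝ} (hd : 2 ≤ d)
    (hδ0 : 0 < δ) (hδ1 : δ < 1) {c : ℕ} (hc : 1 ≤ c) :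
    errBound b σ δ c ^ 2 = hOne b σ * Real.log (2 * d * (c : ℝ) ^ 2 / δ) / c := by
  have hd' : (2 : ℝ) ≤ d := by exact_mod_cast hd
  have hc' : (1 : ℝ) ≤ c := by exact_mod_cast hc
  have h1 : 1 ≤ 2 * d * (c : ℝ) ^ 2 / δ := by
    rw [le_div_iff₀ hδ0]; nlinarith
  have h2 := Real.log_nonneg h1
  have h3 := hOne_nonneg hB σ
  rw [errBound, Real.sq_sqrt (by positivity)]

/-- This is the condition for `log (A c²) / c` not to increase from `c` to `c + 1`. At `c = 1` it
reads `log 4 ≤ log A`; for `c ≥ 2` the left side is at most `2 < log 16`. -/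
lemma two_mul_log_one_add_inv_le {c : ℕ} (hc : 1 ≤ c) {A : ℝ} (hA : 4 ≤ A) :
    c * (2 * Real.log ((c + 1) / c)) ≤ Real.log (A * (c : ℝ) ^ 2) := by
  have hl2 := Real.log_two_gt_d9
  have hl4 : Real.log 4 = 2 * Real.log 2 := by
    rw [show (4 : ℝ) = 2 ^ 2 by norm_num, Real.log_pow]; norm_num
  rcases hc.eq_or_lt with rfl | h
  · norm_num
    rw [← hl4]
    exact Real.log_le_log (by norm_num) hA
  · have hc' : (2 : ℝ) ≤ c := by exact_mod_cast h
    have h1 : Real.log ((c + 1) / c) ≤ 1 / c := by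
      refine (Real.log_le_sub_one_of_pos (by positivity)).trans (le_of_eq ?_)
      field_simp; ring
    have h2 : Real.log 16 ≤ Real.log (A * (c : ℝ) ^ 2) :=
      Real.log_le_log (by norm_num) (by nlinarith)
    have h3 : Real.log 16 = 4 * Real.log 2 := by
      rw [show (16 : ℝ) = 2 ^ 4 by norm_num, Real.log_pow]; norm_num
    calc c * (2 * Real.log ((c + 1) / c)) ≤ c * (2 * (1 / c)) := by gcongr
      _ = 2 := by field_simp
      _ ≤ _ := by linarith

lemma errBound_antitone {b : Fin d → Vec d} (hB : IsUnit (gram b)) (σ : ℝ) {δ : ℝ} (hd : 2 ≤ d)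
    (hδ0 : 0 < δ) (hδ1 : δ < 1) {c c' : ℕ} (hc : 1 ≤ c) (hcc : c ≤ c') :
    errBound b σ δ c' ≤ errBound b σ δ c := by
  induction c', hcc using Nat.le_induction with
  | base => rfl
  | succ n hn ih =>
    refine le_trans (Real.sqrt_le_sqrt ?_) ih
    have hn1 : 1 ≤ n := hc.trans hn
    have hn' : (1 : ℝ) ≤ n := by exact_mod_cast hn1
    have hd' : (2 : ℝ) ≤ d := by exact_mod_cast hd
    have hA : 4 ≤ 2 * d / δ := by rw [le_div_iff₀ hδ0]; nlinarith
    have h1 := two_mul_log_one_add_inv_le hn1 hA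
    have h2 : Real.log (2 * d * ((n + 1 : ℕ) : ℝ) ^ 2 / δ)
        = Real.log (2 * d / δ * (n : ℝ) ^ 2) + 2 * Real.log ((n + 1) / n) := by
      rw [show 2 * d * ((n + 1 : ℕ) : ℝ) ^ 2 / δ
        = (2 * d / δ * (n : ℝ) ^ 2) * ((n + 1) / n) ^ 2 by push_cast; field_simp,
        Real.log_mul (by positivity) (by positivity), Real.log_pow]
      norm_num
    have h3 : (2 * d * (n : ℝ) ^ 2 / δ) = 2 * d / δ * (n : ℝ) ^ 2 := by ring
    rw [h2, h3, mul_div_assoc (hOne b σ), mul_div_assoc (hOne b σ)]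
    refine mul_le_mul_of_nonneg_left ?_ (hOne_nonneg hB σ)
    rw [div_le_div_iff₀ (by positivity) (by positivity)]
    push_cast
    linarith

/-! ### The warm-up phase -/

namespace APSEEGRun

variable {X : Set (Vec d)} {b : Fin d → Vec d} {H : ℕ} {σ δ : ℝ} {x : ℕ → Vec d} {Y : ℕ → ℝ}
  (run : APSEEGRun X b H σ δ x Y) {θ : Vec d} {g : ℕ → Fin d}

/-- All estimates of the run have an error slightly below the error bound. -/
def Accurate (θ : Vec d) : Prop :=
  ∀ c, 1 ≤ c → ‖run.est c - θ‖ ≤ 24 / 25 * errBound b σ δ c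

variable {run}

/-- Because `(24/25)² * (11/10) > 1`. -/
lemma accurate_of_sq_le
    (h : ∀ c, 1 ≤ c → 11 / 10 * ‖run.est c - θ‖ ^ 2 ≤ errBound b σ δ c ^ 2) :
    run.Accurate θ := fun c hc => by
  have h1 := errBound_nonneg b σ δ c
  refine abs_le_of_sq_le_sq' ?_ (by positivity) |>.2
  nlinarith [h c hc, norm_nonneg (run.est c - θ)]

lemma Accurate.norm_le (hE : run.Accurate θ) {c : ℕ} (hc : 1 ≤ c) :
    ‖run.est c - θ‖ ≤ errBound b σ δ c := by
  linarith [hE c hc, errBound_nonneg b σ δ c]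

lemma isSome_supp_mono {c c' : ℕ} {S : Finset (Fin d)} (h : run.supp c = some S) (hcc : c ≤ c') :
    run.supp c' = some S := by
  induction c', hcc using Nat.le_induction with
  | base => exact h
  | succ n _ ih => exact run.supp_locked n S ih

lemma IsWarmUp.spec {C₀ : ℕ} (hW : run.IsWarmUp C₀) :
    1 ≤ C₀ ∧ (∀ c < C₀, run.supp c = none) ∧
      ((2 * lmax X * errBound b σ δ C₀ : ℝ) : EReal)
        < greedyGap X H (run.est C₀) (run.pick C₀) ∧
      ∀ c, C₀ ≤ c → run.supp c = some (picked (run.pick C₀) H) := by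
  have h1 : ∀ c < C₀, run.supp c = none := fun c hc => by
    by_contra hne
    exact absurd (hW.2 (Option.isSome_iff_ne_none.2 hne)) (by omega)
  have hsome : (run.supp C₀).isSome := hW.1
  obtain ⟨k, rfl⟩ : ∃ k, C₀ = k + 1 := by
    refine Nat.exists_eq_succ_of_ne_zero ?_
    rintro rfl
    rw [run.supp_zero] at hsome
    simp at hsome
  have hk := h1 k (by omega)
  by_cases hc : ((2 * lmax X * errBound b σ δ (k + 1) : ℝ) : EReal)
      < greedyGap X H (run.est (k + 1)) (run.pick (k + 1))
  · exact ⟨by omega, h1, hc, fun c hcc => isSome_supp_mono (run.supp_found k hk hc) hcc⟩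
  · rw [run.supp_not_found k hk hc] at hsome
    simp at hsome

lemma IsWarmUp.pick_eq (hb : Bornology.IsBounded X) (h0 : (0 : Vec d) ∈ X)
    (hg : IsGreedy X H θ g) (hE : run.Accurate θ) {C₀ : ℕ} (hW : run.IsWarmUp C₀) :
    ∀ k < H, run.pick C₀ k = g k := by
  obtain ⟨h1, -, hgap, -⟩ := hW.spec
  refine IsGreedy.eq_of_gap hb h0 hg (run.pick_greedy C₀ h1)
    (r := 2 * lmax X * errBound b σ δ C₀) ?_ (lt_greedyGap_iff.1 hgap)
  have := lmax_nonneg X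
  gcongr
  exact hE.norm_le h1

/-- The support found at the end of the warm-up is the greedy support of the true parameter. -/
lemma IsWarmUp.supp_eq (hb : Bornology.IsBounded X) (h0 : (0 : Vec d) ∈ X)
    (hg : IsGreedy X H θ g) (hE : run.Accurate θ) {C₀ : ℕ} (hW : run.IsWarmUp C₀) {c : ℕ}
    (hc : C₀ ≤ c) : run.supp c = some (picked g H) := by
  rw [hW.spec.2.2.2 c hc, picked_congr (hW.pick_eq hb h0 hg hE)]

/-- The gap condition on the estimate carries over to the true parameter. -/
lemma IsWarmUp.gap_est (hb : Bornology.IsBounded X) (h0 : (0 : Vec d) ∈ X)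
    (hg : IsGreedy X H θ g) (hE : run.Accurate θ) {C₀ : ℕ} (hW : run.IsWarmUp C₀) :
    ∀ k < H, ∀ v, v ∉ picked g k → v ≠ g k →
      gain X (run.est C₀) (picked g k) v + 2 * lmax X * errBound b σ δ C₀
        < gain X (run.est C₀) (picked g k) (g k) := by
  have hp := hW.pick_eq hb h0 hg hE
  intro k hk v hv hne
  have h1 : picked (run.pick C₀) k = picked g k := picked_congr fun j hj => hp j (hj.trans hk)
  have h2 := lt_greedyGap_iff.1 hW.spec.2.2.1 k hk v (h1 ▸ hv) (hp k hk ▸ hne)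
  rwa [h1, hp k hk] at h2

/-- At a step where the gap of `θ` is attained, the estimate has a gap above `2 L ε`, where `L =
lmax X` and `ε` is the error bound. Passing to `θ` loses at most `2 L (24/25) ε`, so `2 L ε / 25`
survives. -/
lemma IsWarmUp.lmax_mul_errBound_le (hb : Bornology.IsBounded X) (h0 : (0 : Vec d) ∈ X)
    (hg : IsGreedy X H θ g) (hE : run.Accurate θ) {C₀ : ℕ} (hW : run.IsWarmUp C₀) {Δ : ℝ}
    (hΔ : greedyGap X H θ g = Δ) : 2 / 25 * (lmax X * errBound b σ δ C₀) ≤ Δ := by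
  obtain ⟨k, hk, v, hv, hne, heq⟩ := (greedyGap_eq_coe hΔ).2
  have h1 := hW.gap_est hb h0 hg hE k hk v hv hne
  have h2 := gain_sub_gain_le hb h0 (run.est C₀) θ (picked g k) (g k) v
  have h3 := hE C₀ hW.spec.1
  rw [norm_sub_rev] at h3
  have h4 : lmax X * ‖θ - run.est C₀‖ ≤ lmax X * (24 / 25 * errBound b σ δ C₀) :=
    mul_le_mul_of_nonneg_left h3 (lmax_nonneg X)
  linarith

/-- The estimate keeps a gap of at least `Δ - 2 L ε > 2 L ε`, so the test succeeds in cycle `c` at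
the latest. -/
lemma exists_isWarmUp (hb : Bornology.IsBounded X) (h0 : (0 : Vec d) ∈ X)
    (hg : IsGreedy X H θ g) (hE : run.Accurate θ) {Δ : ℝ} (hΔ : greedyGap X H θ g = Δ) {c : ℕ}
    (hc : 1 ≤ c) (hlt : 4 * (lmax X * errBound b σ δ c) < Δ) :
    ∃ C₀, run.IsWarmUp C₀ ∧ C₀ ≤ c := by
  have hL := lmax_nonneg X
  have he := errBound_nonneg b σ δ c
  have h1 : lmax X * ‖run.est c - θ‖ ≤ lmax X * errBound b σ δ c :=
    mul_le_mul_of_nonneg_left (hE.norm_le hc) hL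
  have h2 : 0 ≤ lmax X * errBound b σ δ c := mul_nonneg hL he
  have h3 := IsGreedy.gap_transfer hb h0 (run.pick_greedy c hc) (r := Δ) (by linarith)
    (greedyGap_eq_coe hΔ).1 hg
  have h4 : ((2 * lmax X * errBound b σ δ c : ℝ) : EReal)
      < greedyGap X H (run.est c) (run.pick c) := by
    refine lt_greedyGap_iff.2 fun k hk v hv hne => ?_
    have := h3 k hk v hv hne
    linarith
  have h5 : (run.supp c).isSome := by
    obtain ⟨k, rfl⟩ : ∃ k, c = k + 1 := ⟨c - 1, by omega⟩
    cases hs : run.supp k with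
    | none => simp [run.supp_found k hs h4]
    | some S => simp [run.supp_locked k S hs]
  have hex : ∃ c, (run.supp c).isSome := ⟨c, h5⟩
  classical
  exact ⟨Nat.find hex, ⟨Nat.find_spec hex, fun _ h => Nat.find_min' hex h⟩, Nat.find_min' hex h5⟩

end APSEEGRun

/-- With `A = log (x q) ≥ 1` and `c` about `511 q A`, the logarithm of `x c²` is at most `4 A + 21/2
≤ 15 A`, and `16 * 15 < 511`. The factor `16` is the square of the `4` in `4 L ε < Δ`. -/
lemma exists_cycle_count {q x : ℝ} (hq : 1 ≤ q) (hx : 4 ≤ x) :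
    ∃ c : ℕ, 1 ≤ c ∧ (c : ℝ) ≤ 512 * q * Real.log (x * q) ∧
      16 * q * Real.log (x * (c : ℝ) ^ 2) < c := by
  set A := Real.log (x * q) with hA
  have hl2 := Real.log_two_gt_d9
  have hl2' := Real.log_two_lt_d9
  have hA1 : 1 ≤ A := by
    have h1 : Real.log 4 ≤ A := Real.log_le_log (by norm_num) (by nlinarith)
    have h2 : Real.log 4 = 2 * Real.log 2 := by
      rw [show (4 : ℝ) = 2 ^ 2 by norm_num, Real.log_pow]; norm_num
    linarith
  have hqA : 1 ≤ q * A := by nlinarith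
  set c := ⌈511 * (q * A)⌉₊ with hc
  have hc1 : 511 * (q * A) ≤ c := Nat.le_ceil _
  have hc2 : (c : ℝ) ≤ 512 * (q * A) := by
    have := Nat.ceil_lt_add_one (show 0 ≤ 511 * (q * A) by linarith)
    linarith
  refine ⟨c, ?_, by linarith, ?_⟩
  · have : (1 : ℝ) ≤ c := by linarith
    exact_mod_cast this
  have hcpos : (0 : ℝ) < c := by linarith
  have h1 : Real.log (x * (c : ℝ) ^ 2) ≤ 4 * A + 21 / 2 := by
    have h2 : x * (c : ℝ) ^ 2 ≤ (x * q) ^ 2 * (512 ^ 2 * A ^ 2) := by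
      calc x * (c : ℝ) ^ 2 ≤ x * (512 * (q * A)) ^ 2 := by gcongr
        _ ≤ x * x * (512 * (q * A)) ^ 2 := by
            refine mul_le_mul_of_nonneg_right ?_ (sq_nonneg _)
            nlinarith
        _ = _ := by ring
    refine (Real.log_le_log (by positivity) h2).trans ?_
    have hq0 : x * q ≠ 0 := by positivity
    have hA0 : A ≠ 0 := by positivity
    rw [Real.log_mul (by positivity) (by positivity), Real.log_mul (by norm_num) (by positivity),
      Real.log_pow, Real.log_pow A, ← hA, show (512 : ℝ) ^ 2 = 2 ^ 18 by norm_num, Real.log_pow]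
    have h3 := Real.log_le_sub_one_of_pos (show 0 < A by linarith)
    push_cast
    linarith
  have h2 : Real.log (x * (c : ℝ) ^ 2) ≤ 15 * A := by linarith
  calc 16 * q * Real.log (x * (c : ℝ) ^ 2) ≤ 16 * q * (15 * A) := by gcongr
    _ < c := by linarith

/-! ### The regret of exploitation -/

/-- If `θ` has little mass on `S`, then it has a large coordinate outside `S`. -/
lemma exists_large_coord (hd : 2 ≤ d) {S : Finset (Fin d)} {θ : Vec d} (hθ : 0 < ‖θ‖)
    (hs : ‖proj S θ‖ ≤ ‖θ‖ / (2 * d)) : ∃ i, i ∉ S ∧ ‖θ‖ / (2 * d) ≤ |θ i| := by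
  by_contra! hcon
  have hd' : (2 : ℝ) ≤ d := by exact_mod_cast hd
  set m := ‖θ‖ / (2 * d) with hm
  have hm0 : 0 < m := by positivity
  have hn : ‖θ‖ = 2 * d * m := by rw [hm]; field_simp
  have h1 : ‖θ‖ ^ 2 = ∑ i ∈ S, θ i ^ 2 + ∑ i ∈ Sᶜ, θ i ^ 2 := by
    rw [EuclideanSpace.norm_sq_eq, Finset.sum_add_sum_compl]
    simp
  have h2 : ∑ i ∈ S, θ i ^ 2 ≤ m ^ 2 := by
    rw [← norm_proj_sq]
    exact pow_le_pow_left₀ (norm_nonneg _) hs 2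
  have h3 : ∑ i ∈ Sᶜ, θ i ^ 2 ≤ d * m ^ 2 := by
    calc ∑ i ∈ Sᶜ, θ i ^ 2 ≤ ∑ _i ∈ Sᶜ, m ^ 2 := Finset.sum_le_sum fun i hi => by
          rw [← sq_abs]
          exact pow_le_pow_left₀ (abs_nonneg _) (hcon i (Finset.mem_compl.1 hi)).le 2
      _ = (Sᶜ.card : ℝ) * m ^ 2 := by rw [Finset.sum_const, nsmul_eq_mul]
      _ ≤ d * m ^ 2 := by
          gcongr
          simpa using Finset.card_le_univ Sᶜ
  rw [hn] at h1
  have hm2 : 0 < m ^ 2 := by positivity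
  have : (2 * d * m) ^ 2 = 4 * d ^ 2 * m ^ 2 := by ring
  nlinarith

lemma gap_le_value_singleton {X : Set (Vec d)} (hb : Bornology.IsBounded X)
    (h0 : (0 : Vec d) ∈ X) (hd : 2 ≤ d) {H : ℕ} (hH : 1 ≤ H) {θ : Vec d} {g : ℕ → Fin d} {r : ℝ}
    (hgap : ∀ k < H, ∀ v, v ∉ picked g k → v ≠ g k →
      gain X θ (picked g k) v + r ≤ gain X θ (picked g k) (g k)) :
    r ≤ value X (picked g 1) θ := by
  have : Nontrivial (Fin d) := Fin.nontrivial_iff_two_le.2 hd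
  obtain ⟨v, hv⟩ := exists_ne (g 0)
  have h1 := hgap 0 hH v (by simp [picked_zero]) hv
  have h2 := gain_nonneg hb h0 θ (picked g 0) v
  rw [value_picked_succ, picked_zero, value_empty hb h0]
  rw [picked_zero] at h1 h2
  linarith

/-- If the greedy support captures little of `θ`, then the values of all supports on the greedy
path are small compared to the captured part. -/
lemma value_picked_one_sq_le {R : ℝ} {X : Set (Vec d)} (hX : IsStronglyConvexSet R X)
    (hR : 0 < R) (hc : IsClosed X) (hb : Bornology.IsBounded X) (h0 : (0 : Vec d) ∈ X)
    (hd : 2 ≤ d) {H : ℕ} (hH : 2 ≤ H) {θ : Vec d} {g : ℕ → Fin d} (hg : IsGreedy X H θ g)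
    {i : Fin d} (hi : i ∉ picked g H) (hθi : ‖θ‖ / (2 * d) ≤ |θ i|) :
    ∃ t, 0 ≤ t ∧ value X (picked g 1) θ ≤ t * ‖proj (picked g H) θ‖ ∧
      ‖θ‖ * t ^ 2 ≤ 16 * d * R * lmax X * ‖proj (picked g H) θ‖ := by
  obtain ⟨p, hp⟩ := exists_isBestAction hc hb h0 (picked g 1) θ
  have hd' : (2 : ℝ) ≤ d := by exact_mod_cast hd
  have hpH : p ∈ restrict X (picked g H) := restrict_mono X (picked_mono g (by omega)) hp.1
  refine ⟨‖p‖, norm_nonneg p, ?_, ?_⟩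
  · rw [hp.value_eq, inner_eq_inner_proj hpH.2, mul_comm]
    exact real_inner_le_norm _ _
  · have h1 := abs_coord_mul_le_value hX hb h0 hR hp.1
      (hp.value_eq ▸ value_nonneg hb h0 _ θ) i
    have h2 : value X (insert i (picked g 1)) θ ≤ value X (picked g H) θ := by
      have h3 := (hg 1 (by omega)).2 i fun h => hi (picked_mono g (by omega) h)
      have h4 := value_picked_succ X θ g 1
      have h5 := value_mono hb h0 (picked_mono g hH) θ
      rw [gain] at h3
      linarith
    have h3 : value X (picked g H) θ ≤ lmax X * ‖proj (picked g H) θ‖ :=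
      value_le h0 fun y hy => inner_le_lmax_mul_proj hb hy θ
    rw [div_le_iff₀ (by positivity)] at hθi
    calc ‖θ‖ * ‖p‖ ^ 2 ≤ |θ i| * (2 * d) * ‖p‖ ^ 2 := by gcongr
      _ = 2 * d * (|θ i| * ‖p‖ ^ 2) := by ring
      _ ≤ 2 * d * (8 * R * (lmax X * ‖proj (picked g H) θ‖)) := by
          refine mul_le_mul_of_nonneg_left (h1.trans ?_) (by positivity)
          exact mul_le_mul_of_nonneg_left (h2.trans h3) (by positivity)
      _ = _ := by ring

/-- If the greedy support captures little of `θ`, then exploitation on it is better than the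
`α`-fraction of the optimum as soon as the error is at most a multiple of the gap. -/
lemma exploit_of_small_proj {R : ℝ} {X : Set (Vec d)} (hX : IsStronglyConvexSet R X)
    (hR : 0 < R) (hc : IsClosed X) (hb : Bornology.IsBounded X) (h0 : (0 : Vec d) ∈ X)
    (hL : 0 < lmax X) (hd : 2 ≤ d) {H : ℕ} (hH : 2 ≤ H) {θ θ' a : Vec d} {g : ℕ → Fin d}
    (hg : IsGreedy X H θ g) {Δ : ℝ} (hΔ : 0 < Δ)
    (hgap : ∀ k < H, ∀ v, v ∉ picked g k → v ≠ g k →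
      gain X θ (picked g k) v + Δ ≤ gain X θ (picked g k) (g k))
    (hθ : 0 < ‖θ‖)
    (hs : ‖proj (picked g H) θ‖ * (225000000 * d * R ^ 3) ≤ lmax X ^ 3 * ‖θ‖)
    (ha : IsBestAction X (picked g H) θ' a) (herr : 2 / 25 * (lmax X * ‖θ' - θ‖) ≤ Δ) :
    greedyAlpha X θ * opt X H θ ≤ inner ℝ θ a := by
  have hd' : (2 : ℝ) ≤ d := by exact_mod_cast hd
  have hLR := hX.lmax_le (by omega) hb h0 hR
  set L := lmax X with hLdef
  set s := ‖proj (picked g H) θ‖ with hsdef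
  have hs0 : 0 ≤ s := norm_nonneg _
  have hL3 : L ^ 3 ≤ 8 * R ^ 3 := by
    calc L ^ 3 ≤ (2 * R) ^ 3 := by gcongr
      _ = _ := by ring
  have hs' : s ≤ ‖θ‖ / (2 * d) := by
    rw [le_div_iff₀ (by positivity)]
    have h1 : s * (225000000 * d * R ^ 3) ≤ 8 * R ^ 3 * ‖θ‖ :=
      hs.trans (by gcongr)
    have h2 : s * (225000000 * d) ≤ 8 * ‖θ‖ := by
      refine le_of_mul_le_mul_right ?_ (show 0 < R ^ 3 by positivity)
      linarith
    nlinarith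
  obtain ⟨i, hi, hθi⟩ := exists_large_coord hd hθ hs'
  obtain ⟨t, ht0, ht1, ht2⟩ := value_picked_one_sq_le hX hR hc hb h0 hd hH hg hi hθi
  rw [← hLdef, ← hsdef] at ht2
  rw [← hsdef] at ht1
  have hmargin := greedyAlpha_mul_opt_add_le hb h0 hH hg hΔ hgap hi
  have hΔt := (gap_le_value_singleton hb h0 hd (by omega) hgap).trans ht1
  have hspos : 0 < s := by
    rcases hs0.eq_or_lt with h | h
    · rw [← h, mul_zero] at hΔt; linarith
    · exact h
  -- The threshold constant is `225000000 = 15000²`, so taking roots of `ht2` gives `15000 R t ≤ 4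
  -- L²`.
  have ht3 : 3750 * R * t ≤ L ^ 2 := by
    have h1 : ‖θ‖ * t ^ 2 * (225000000 * R ^ 2) ≤ 16 * L ^ 4 * ‖θ‖ := by
      refine le_of_mul_le_mul_right ?_ (show 0 < d * R by positivity)
      calc ‖θ‖ * t ^ 2 * (225000000 * R ^ 2) * (d * R)
          = (‖θ‖ * t ^ 2) * (225000000 * d * R ^ 3) := by ring
        _ ≤ (16 * d * R * L * s) * (225000000 * d * R ^ 3) := by gcongr
        _ = 16 * d * R * L * (s * (225000000 * d * R ^ 3)) := by ring
        _ ≤ 16 * d * R * L * (L ^ 3 * ‖θ‖) := by gcongr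
        _ = _ := by ring
    have h2 : t ^ 2 * (225000000 * R ^ 2) ≤ 16 * L ^ 4 := by
      refine le_of_mul_le_mul_right ?_ hθ
      linarith
    refine abs_le_of_sq_le_sq' ?_ (by positivity) |>.2
    nlinarith
  obtain ⟨y, hy⟩ := exists_isBestAction hc hb h0 (picked g H) θ
  have hr := norm_proj_mul_regret_le hX hR hy ha
  rw [← hsdef] at hr
  rw [hy.value_eq] at hmargin
  rw [inner_sub_right] at hr
  set r := inner ℝ θ y - inner ℝ θ a with hrdef
  have hr2 : s * r * L ^ 2 ≤ 625 * R * Δ ^ 2 := by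
    have h1 : (2 / 25 * (L * ‖θ' - θ‖)) ^ 2 ≤ Δ ^ 2 := by gcongr
    have h2 : 4 * R * ‖θ' - θ‖ ^ 2 * L ^ 2 ≤ 625 * R * Δ ^ 2 := by
      have h3 : 625 * R * (2 / 25 * (L * ‖θ' - θ‖)) ^ 2 = 4 * R * ‖θ' - θ‖ ^ 2 * L ^ 2 := by ring
      rw [← h3]
      gcongr
    refine le_trans ?_ h2
    gcongr
  -- One factor `Δ` is replaced by its upper bound `t * s`: the small `s` that weakens the quadratic
  -- loss bound cancels, and the smallness of `t` remains.
  have hr3 : s * r * L ^ 2 ≤ s * (Δ / 2) * L ^ 2 := by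
    have h1 : 625 * R * Δ ^ 2 ≤ 625 * R * Δ * (t * s) := by
      rw [sq, ← mul_assoc]; gcongr
    have h2 : 0 < Δ * s := by positivity
    nlinarith
  have hr4 : r ≤ Δ / 2 := by
    refine le_of_mul_le_mul_left ?_ (show 0 < s * L ^ 2 by positivity)
    linarith
  linarith

/-- On a one-element support an estimate with an error below `|θ_i|` leads to an optimal
action. -/
lemma exploit_singleton {X : Set (Vec d)} {i : Fin d} {θ θ' y a : Vec d}
    (hy : IsBestAction X {i} θ y) (ha : IsBestAction X {i} θ' a) (herr : ‖θ' - θ‖ < |θ i|) :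
    inner ℝ θ y ≤ inner ℝ θ a := by
  have hin : ∀ w z : Vec d, SupportedOn z {i} → inner ℝ w z = w i * z i := by
    intro w z hz
    rw [PiLp.inner_apply, Finset.sum_eq_single i]
    · simp [mul_comm]
    · intro j _ hj
      simp [hz j (by simpa using hj)]
    · simp
  have h1 := ha.2 y hy.1
  rw [hin _ _ hy.1.2, hin _ _ ha.1.2] at h1 ⊢
  -- A strictly worse `a` means that `θ i` and `θ' i` order `y i` and `a i` in opposite ways, so the
  -- two coordinates differ by at least `|θ i|`.
  by_contra! hlt
  have h2 : |(θ' - θ) i| ≤ ‖θ' - θ‖ := by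
    simpa using PiLp.norm_apply_le (θ' - θ) i
  have h3 : |θ i| * |y i - a i| ≤ |(θ' - θ) i| * |y i - a i| := by
    rw [← abs_mul, ← abs_mul, abs_of_pos (by nlinarith : 0 < θ i * (y i - a i))]
    refine le_trans ?_ (neg_le_abs _)
    rw [PiLp.sub_apply]
    nlinarith
  have h4 : 0 < |y i - a i| := by
    rw [abs_pos]
    intro h
    have : y i = a i := by linarith
    rw [this] at hlt
    exact lt_irrefl _ hlt
  have := le_of_mul_le_mul_right h3 h4
  linarith

namespace APSEEGRun

variable {X : Set (Vec d)} {b : Fin d → Vec d} {H : ℕ} {σ δ : ℝ} {x : ℕ → Vec d} {Y : ℕ → ℝ}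
  {run : APSEEGRun X b H σ δ x Y} {θ : Vec d} {g : ℕ → Fin d}

/-- For `H = 1` the stopping test gives `|θ̂_{C₀} i| ≥ 2 ε_{C₀}` at the picked coordinate, hence `|θ
i| ≥ (26/25) ε_{C₀}`. All later errors are smaller unless `ε_{C₀} = 0`, in which case the estimate
is exact. -/
lemma IsWarmUp.exploit_of_eq_one (hc : IsClosed X) (hb : Bornology.IsBounded X)
    (h0 : (0 : Vec d) ∈ X) (hL : 0 < lmax X) (hd : 2 ≤ d) (hB : IsUnit (gram b)) (hδ0 : 0 < δ)
    (hδ1 : δ < 1) (hH : H = 1) (hg : IsGreedy X H θ g) {Δ : ℝ}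
    (hΔ : greedyGap X H θ g = Δ) (hΔ0 : 0 < Δ) (hE : run.Accurate θ) {C₀ : ℕ}
    (hW : run.IsWarmUp C₀) {c : ℕ} (hcc : C₀ ≤ c) :
    greedyAlpha X θ * opt X H θ ≤ inner ℝ θ (run.action c) := by
  have hC := hW.spec.1
  have ha := run.action_best c (by omega) _ (hW.supp_eq hb h0 hg hE hcc)
  have hgap := (greedyGap_eq_coe hΔ).1
  subst hH
  have hv : 0 < gain X θ (picked g 0) (g 0) := by
    have := gap_le_value_singleton hb h0 hd le_rfl hgap
    rw [value_picked_succ, picked_zero, value_empty hb h0] at this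
    rw [picked_zero]
    linarith
  have hα := greedyAlpha_mul_opt_le hb h0 le_rfl hg hv
  have hS : picked g 1 = {g 0} := by rw [picked_succ, picked_zero]; rfl
  obtain ⟨y, hy⟩ := exists_isBestAction hc hb h0 (picked g 1) θ
  rw [hy.value_eq] at hα
  refine hα.trans ?_
  have h1 := gap_le_value_singleton hb h0 hd le_rfl
    fun k hk v hv hne => (hW.gap_est hb h0 hg hE k hk v hv hne).le
  have h2 : value X (picked g 1) (run.est C₀) ≤ lmax X * |run.est C₀ (g 0)| := by
    refine value_le h0 fun z hz => (inner_le_lmax_mul_proj hb hz _).trans_eq ?_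
    congr 1
    rw [← sq_eq_sq₀ (norm_nonneg _) (abs_nonneg _), norm_proj_sq, hS, Finset.sum_singleton, sq_abs]
  have h3 : 2 * errBound b σ δ C₀ ≤ |run.est C₀ (g 0)| := by
    refine le_of_mul_le_mul_left ?_ hL
    linarith
  have h4 : |run.est C₀ (g 0)| ≤ |θ (g 0)| + ‖run.est C₀ - θ‖ := by
    have h5 : |(run.est C₀ - θ) (g 0)| ≤ ‖run.est C₀ - θ‖ := by
      simpa using PiLp.norm_apply_le (run.est C₀ - θ) (g 0)
    rw [PiLp.sub_apply] at h5
    have := abs_sub_abs_le_abs_sub (run.est C₀ (g 0)) (θ (g 0))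
    linarith
  have h5 := hE C₀ hC
  have h6 := hE c (by omega)
  have h7 := errBound_antitone hB σ hd hδ0 hδ1 hC hcc
  have h8 := errBound_nonneg b σ δ c
  have h9 : ‖run.est c - θ‖ < |θ (g 0)| ∨ errBound b σ δ C₀ = 0 := by
    rcases (h8.trans h7).eq_or_lt with h | h
    · exact Or.inr h.symm
    · left; linarith
  rw [hS] at hy ha
  rcases h9 with h9 | h9
  · exact exploit_singleton hy ha h9
  · have h10 : run.est c = θ := by
      rw [← sub_eq_zero, ← norm_le_zero_iff]
      linarith
    rw [h10] at ha
    exact ha.2 y hy.1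

/-- The regret of one exploitation block. -/
lemma IsWarmUp.exploit_regret_le {R : ℝ} (hX : IsStronglyConvexSet R X) (hR : 0 < R)
    (hc : IsClosed X) (hb : Bornology.IsBounded X)
    (h0 : (0 : Vec d) ∈ X) (hL : 0 < lmax X) (hd : 2 ≤ d) (hB : IsUnit (gram b)) (hδ0 : 0 < δ)
    (hδ1 : δ < 1) (hH : 1 ≤ H) (hg : IsGreedy X H θ g) {Δ : ℝ}
    (hΔ : greedyGap X H θ g = Δ) (hΔ0 : 0 < Δ) (hE : run.Accurate θ) {C₀ : ℕ}
    (hW : run.IsWarmUp C₀) {c : ℕ} (hcc : C₀ ≤ c) (hθ : 0 < ‖θ‖) :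
    c * (greedyAlpha X θ * opt X H θ - inner ℝ θ (run.action c))
      ≤ 900000000 * (R ^ 4 / lmax X ^ 3) * d * (hOne b σ / ‖θ‖)
        * Real.log (2 * d * (c : ℝ) ^ 2 / δ) := by
  have hC := hW.spec.1
  have hc1 : 1 ≤ c := by omega
  have hd' : (2 : ℝ) ≤ d := by exact_mod_cast hd
  have hc' : (1 : ℝ) ≤ c := by exact_mod_cast hc1
  have hh := hOne_nonneg hB σ
  have hlog : 0 ≤ Real.log (2 * d * (c : ℝ) ^ 2 / δ) := by
    refine Real.log_nonneg ?_
    rw [le_div_iff₀ hδ0]; nlinarith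
  have ha := run.action_best c hc1 _ (hW.supp_eq hb h0 hg hE hcc)
  have hgap := (greedyGap_eq_coe hΔ).1
  suffices hsuff : greedyAlpha X θ * opt X H θ ≤ inner ℝ θ (run.action c) ∨
      lmax X ^ 3 * ‖θ‖ * (greedyAlpha X θ * opt X H θ - inner ℝ θ (run.action c))
        ≤ 900000000 * R ^ 4 * d * errBound b σ δ c ^ 2 by
    rcases hsuff with h | h
    · refine le_trans ?_ (show 0 ≤ _ by positivity)
      exact mul_nonpos_of_nonneg_of_nonpos (by linarith) (by linarith)
    · rw [errBound_sq hB σ hd hδ0 hδ1 hc1] at h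
      have h1 : greedyAlpha X θ * opt X H θ - inner ℝ θ (run.action c) ≤
          900000000 * R ^ 4 * d * (hOne b σ * Real.log (2 * d * (c : ℝ) ^ 2 / δ) / c)
            / (lmax X ^ 3 * ‖θ‖) := by
        rw [le_div_iff₀ (by positivity)]; linarith
      calc c * (greedyAlpha X θ * opt X H θ - inner ℝ θ (run.action c))
          ≤ c * (900000000 * R ^ 4 * d * (hOne b σ * Real.log (2 * d * (c : ℝ) ^ 2 / δ) / c)
            / (lmax X ^ 3 * ‖θ‖)) := by gcongr
        _ = _ := by field_simp
  by_cases hH1 : H = 1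
  · exact Or.inl (hW.exploit_of_eq_one hc hb h0 hL hd hB hδ0 hδ1 hH1 hg hΔ hΔ0 hE hcc)
  -- Either the captured part of `θ` is too small and the gap margin absorbs the loss, or it can
  -- replace `‖θ‖` in the quadratic bound at the price of a factor `d`; `900000000 = 4 * 225000000`.
  by_cases hs : ‖proj (picked g H) θ‖ * (225000000 * d * R ^ 3) ≤ lmax X ^ 3 * ‖θ‖
  · left
    refine exploit_of_small_proj hX hR hc hb h0 hL hd (by omega) hg hΔ0 hgap hθ hs ha ?_
    have h1 := hW.lmax_mul_errBound_le hb h0 hg hE hΔ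
    have h2 := (hE.norm_le hc1).trans (errBound_antitone hB σ hd hδ0 hδ1 hC hcc)
    have h3 := mul_le_mul_of_nonneg_left h2 hL.le
    linarith
  · right
    push Not at hs
    obtain ⟨y, hy⟩ := exists_isBestAction hc hb h0 (picked g H) θ
    have hv : 0 < gain X θ (picked g 0) (g 0) := by
      have := gap_le_value_singleton hb h0 hd hH hgap
      rw [value_picked_succ, picked_zero, value_empty hb h0] at this
      rw [picked_zero]
      linarith
    have hα := greedyAlpha_mul_opt_le hb h0 hH hg hv
    rw [hy.value_eq] at hα
    have hr := norm_proj_mul_regret_le hX hR hy ha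
    rw [inner_sub_right] at hr
    have hya := hy.2 _ ha.1
    calc lmax X ^ 3 * ‖θ‖ * (greedyAlpha X θ * opt X H θ - inner ℝ θ (run.action c))
        ≤ lmax X ^ 3 * ‖θ‖ * (inner ℝ θ y - inner ℝ θ (run.action c)) := by gcongr
      _ ≤ ‖proj (picked g H) θ‖ * (225000000 * d * R ^ 3)
          * (inner ℝ θ y - inner ℝ θ (run.action c)) := by
          gcongr
      _ = 225000000 * d * R ^ 3 *
          (‖proj (picked g H) θ‖ * (inner ℝ θ y - inner ℝ θ (run.action c))) := by ring
      _ ≤ 225000000 * d * R ^ 3 * (4 * R * ‖run.est c - θ‖ ^ 2) := by gcongr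
      _ = 900000000 * R ^ 4 * d * ‖run.est c - θ‖ ^ 2 := by ring
      _ ≤ _ := by
          gcongr
          exact hE.norm_le hc1

end APSEEGRun

/-! ### Summing the regret over cycles -/

namespace APSEEGRun

variable {X : Set (Vec d)} {b : Fin d → Vec d} {H : ℕ} {σ δ : ℝ} {x : ℕ → Vec d} {Y : ℕ → ℝ}
  {run : APSEEGRun X b H σ δ x Y} {θ : Vec d} {g : ℕ → Fin d}

lemma action_mem (run : APSEEGRun X b H σ δ x Y) (hX : ∀ k, b k ∈ X) {c : ℕ} (hc : 1 ≤ c)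
    {t : ℕ} (ht : t < run.start c) :
    x t ∈ X := by
  induction c, hc using Nat.le_induction with
  | base => rw [run.start_one] at ht; omega
  | succ c hc ih =>
    rcases lt_or_ge t (run.start c) with h | h
    · exact ih h
    rw [run.start_succ c hc] at ht
    rcases lt_or_ge t (run.start c + d) with h' | h'
    · have := run.explore c hc ⟨t - run.start c, by omega⟩
      rw [show run.start c + ((⟨t - run.start c, by omega⟩ : Fin d) : ℕ) = t by
        simp only; omega] at this
      exact this ▸ hX _
    · cases hs : run.supp c with
      | none => simp [hs] at ht; omega
      | some S =>
        simp only [hs, Option.isSome_some, if_true] at ht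
        have := run.exploit c hc (by simp [hs]) (t - (run.start c + d)) (by omega)
        rw [show run.start c + d + (t - (run.start c + d)) = t by omega] at this
        exact this ▸ (run.action_best c hc S hs).1.1

lemma action_mem_all (run : APSEEGRun X b H σ δ x Y) (hd : 0 < d) (hX : ∀ k, b k ∈ X) (t : ℕ) : x t ∈ X := by
  refine run.action_mem hX (c := t + 2) (by omega) ?_
  have h1 := run.le_start (s := t + 2) (by omega)
  have h2 : (t + 2 - 1) * 1 ≤ (t + 2 - 1) * d := Nat.mul_le_mul_left _ hd
  omega

lemma sum_start_succ_le (run : APSEEGRun X b H σ δ x Y) {f : ℕ → ℝ} {c : ℕ} (hc : 1 ≤ c)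
    {M D : ℝ} (hM : ∀ t, f t ≤ M)
    (hD : (run.supp c).isSome → ∑ j ∈ Finset.range c, f (run.start c + d + j) ≤ D) :
    ∑ t ∈ Finset.range (run.start (c + 1)), f t
      ≤ ∑ t ∈ Finset.range (run.start c), f t + d * M
        + if (run.supp c).isSome then D else 0 := by
  rw [run.start_succ c hc, Finset.sum_range_add, Finset.sum_range_add]
  have h1 : ∑ k ∈ Finset.range d, f (run.start c + k) ≤ d * M := by
    calc ∑ k ∈ Finset.range d, f (run.start c + k) ≤ ∑ _k ∈ Finset.range d, M :=
          Finset.sum_le_sum fun k _ => hM _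
      _ = d * M := by simp
  split_ifs with h
  · linarith [hD h]
  · simp only [Finset.range_zero, Finset.sum_empty]
    linarith

/-- The regret of the first `N` cycles. -/
lemma IsWarmUp.sum_le {C₀ : ℕ} (hW : run.IsWarmUp C₀) {f : ℕ → ℝ} {M D : ℝ}
    (hM : ∀ t, f t ≤ M) {N : ℕ}
    (hD : ∀ c, C₀ ≤ c → c ≤ N →
      ∑ j ∈ Finset.range c, f (run.start c + d + j) ≤ D) :
    ∑ t ∈ Finset.range (run.start (N + 1)), f t ≤ N * (d * M) + ((N + 1 - C₀ : ℕ) : ℝ) * D := by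
  have hC := hW.spec.1
  have key : ∀ c ≤ N, ∑ t ∈ Finset.range (run.start (c + 1)), f t
      ≤ c * (d * M) + ((c + 1 - C₀ : ℕ) : ℝ) * D := by
    intro c
    induction c with
    | zero =>
      intro _
      have : (0 + 1 - C₀ : ℕ) = 0 := by omega
      rw [this]
      simp [run.start_one]
    | succ c ih =>
      intro hcN
      have hsome : (run.supp (c + 1)).isSome ↔ C₀ ≤ c + 1 := by
        constructor
        · intro h; exact hW.2 h
        · intro h; rw [hW.spec.2.2.2 _ h]; rfl
      have h1 := run.sum_start_succ_le (c := c + 1) (by omega) hM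
        fun h => hD (c + 1) (hsome.1 h) hcN
      have h2 := ih (by omega)
      by_cases h : C₀ ≤ c + 1
      · rw [if_pos (hsome.2 h)] at h1
        rw [show c + 1 + 1 - C₀ = (c + 1 - C₀) + 1 by omega]
        push_cast
        linarith
      · rw [if_neg fun h' => h (hsome.1 h')] at h1
        rw [show c + 1 + 1 - C₀ = c + 1 - C₀ by omega]
        push_cast
        linarith
  exact key N le_rfl

/-- The `m` cycles from `C₀` on contain exploitation blocks of lengths at least `1, …, m`. -/
lemma IsWarmUp.sq_le_two_mul_start {C₀ : ℕ} (hW : run.IsWarmUp C₀) (m : ℕ) :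
    m ^ 2 ≤ 2 * run.start (C₀ + m) := by
  have hC := hW.spec.1
  induction m with
  | zero => simp
  | succ m ih =>
    rw [← add_assoc, run.start_succ (C₀ + m) (by omega), hW.spec.2.2.2 (C₀ + m) (by omega)]
    simp only [Option.isSome_some, if_true]
    nlinarith

lemma exists_cycle (run : APSEEGRun X b H σ δ x Y) (hd : 0 < d) {T : ℕ} (hT : 1 ≤ T) :
    ∃ N, 1 ≤ N ∧ run.start N < T ∧ T ≤ run.start (N + 1) := by
  have hex : ∃ N, T ≤ run.start (N + 1) := ⟨T, by
    have h1 := run.le_start (s := T + 1) (by omega)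
    have h2 : (T + 1 - 1) * 1 ≤ (T + 1 - 1) * d := Nat.mul_le_mul_left _ hd
    omega⟩
  classical
  have h1 := Nat.find_spec hex
  have h2 : 1 ≤ Nat.find hex := by
    by_contra h
    rw [show Nat.find hex = 0 by omega, run.start_one] at h1
    omega
  refine ⟨Nat.find hex, h2, ?_, h1⟩
  have := Nat.find_min hex (m := Nat.find hex - 1) (by omega)
  rw [Nat.sub_add_cancel h2] at this
  omega

end APSEEGRun

lemma alphaRegret_eq_sum (X : Set (Vec d)) (H : ℕ) (θ : Vec d) (α : ℝ) (x : ℕ → Vec d) (T : ℕ) :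
    alphaRegret X H θ α x T = ∑ t ∈ Finset.range T, (α * opt X H θ - inner ℝ θ (x t)) := by
  rw [alphaRegret, Finset.sum_sub_distrib, Finset.mul_sum]

lemma greedyAlpha_le_one (X : Set (Vec d)) (θ : Vec d) : greedyAlpha X θ ≤ 1 := by
  rw [greedyAlpha]
  linarith [Real.exp_pos (-submodularityRatio fun S => value X S θ)]

lemma step_regret_le {X : Set (Vec d)} (hb : Bornology.IsBounded X) (h0 : (0 : Vec d) ∈ X)
    (H : ℕ) (θ : Vec d) {y : Vec d} (hy : y ∈ X) :
    greedyAlpha X θ * opt X H θ - inner ℝ θ y ≤ 2 * (lmax X * ‖θ‖) := by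
  have h1 := greedyAlpha_le_one X θ
  have h2 := opt_nonneg hb h0 H θ
  have h3 := opt_le_lmax_mul hb h0 H θ
  have h4 := neg_lmax_mul_le_inner hb hy θ
  nlinarith

namespace APSEEGRun

variable {X : Set (Vec d)} {b : Fin d → Vec d} {H : ℕ} {σ δ : ℝ} {x : ℕ → Vec d} {Y : ℕ → ℝ}
  {run : APSEEGRun X b H σ δ x Y} {θ : Vec d} {g : ℕ → Fin d}

lemma alphaRegret_le_trivial (run : APSEEGRun X b H σ δ x Y) (hb : Bornology.IsBounded X)
    (h0 : (0 : Vec d) ∈ X) (hd : 0 < d) (hX : ∀ k, b k ∈ X) (T : ℕ) :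
    alphaRegret X H θ (greedyAlpha X θ) x T ≤ 2 * (lmax X * ‖θ‖) * T := by
  rw [alphaRegret_eq_sum]
  calc _ ≤ ∑ _t ∈ Finset.range T, 2 * (lmax X * ‖θ‖) :=
        Finset.sum_le_sum fun t _ => step_regret_le hb h0 H θ (run.action_mem_all hd hX t)
    _ = _ := by simp [mul_comm]

/-- The regret after the warm-up, split into exploration and exploitation. -/
lemma IsWarmUp.alphaRegret_le {R : ℝ} (hX : IsStronglyConvexSet R X) (hR : 0 < R)
    (hc : IsClosed X) (hb : Bornology.IsBounded X)
    (h0 : (0 : Vec d) ∈ X) (hL : 0 < lmax X) (hd : 2 ≤ d) (hB : IsUnit (gram b))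
    (hbX : ∀ k, b k ∈ X) (hδ0 : 0 < δ)
    (hδ1 : δ < 1) (hH : 1 ≤ H) (hg : IsGreedy X H θ g) {Δ : ℝ}
    (hΔ : greedyGap X H θ g = Δ) (hΔ0 : 0 < Δ) (hE : run.Accurate θ) {C₀ : ℕ}
    (hW : run.IsWarmUp C₀) (hθ : 0 < ‖θ‖) {T : ℕ} (hT : 1 ≤ T) :
    alphaRegret X H θ (greedyAlpha X θ) x T
      ≤ (C₀ + 2 * Real.sqrt T) * (d * (2 * (lmax X * ‖θ‖))) + 3 * Real.sqrt T *
        (900000000 * (R ^ 4 / lmax X ^ 3) * d * (hOne b σ / ‖θ‖)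
          * Real.log (2 * d * (T : ℝ) ^ 2 / δ)) := by
  have hC := hW.spec.1
  have hd' : (2 : ℝ) ≤ d := by exact_mod_cast hd
  have hT' : (1 : ℝ) ≤ T := by exact_mod_cast hT
  have hh := hOne_nonneg hB σ
  obtain ⟨N, hN, hN1, hN2⟩ := run.exists_cycle (by omega : 0 < d) hT
  have hNT : N ≤ T := by
    have h1 := run.le_start hN
    have h2 : (N - 1) * 1 ≤ (N - 1) * d := Nat.mul_le_mul_left _ (by omega)
    omega
  have hlog : 0 ≤ Real.log (2 * d * (T : ℝ) ^ 2 / δ) := by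
    refine Real.log_nonneg ?_
    rw [le_div_iff₀ hδ0]; nlinarith
  set D := 900000000 * (R ^ 4 / lmax X ^ 3) * d * (hOne b σ / ‖θ‖)
    * Real.log (2 * d * (T : ℝ) ^ 2 / δ) with hD
  have hD0 : 0 ≤ D := by positivity
  -- With positive parts the sum may be extended to the end of the cycle containing `T`, so an
  -- unfinished block is charged in full. A block plays one action, so the positive part passes
  -- through its sum.
  set f : ℕ → ℝ := fun t => max 0 (greedyAlpha X θ * opt X H θ - inner ℝ θ (x t)) with hf
  have h1 : alphaRegret X H θ (greedyAlpha X θ) x T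
      ≤ ∑ t ∈ Finset.range (run.start (N + 1)), f t := by
    rw [alphaRegret_eq_sum]
    calc _ ≤ ∑ t ∈ Finset.range T, f t := Finset.sum_le_sum fun t _ => le_max_right _ _
      _ ≤ _ := Finset.sum_le_sum_of_subset_of_nonneg (Finset.range_mono hN2)
          fun t _ _ => le_max_left _ _
  have h2 : ∀ t, f t ≤ 2 * (lmax X * ‖θ‖) := fun t =>
    max_le (by positivity) (step_regret_le hb h0 H θ (run.action_mem_all (by omega) hbX t))
  have h3 : ∀ c, C₀ ≤ c → c ≤ N →
      ∑ j ∈ Finset.range c, f (run.start c + d + j) ≤ D := by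
    intro c hc1 hc2
    have hc0 : 1 ≤ c := by omega
    have hc' : (1 : ℝ) ≤ c := by exact_mod_cast hc0
    have hcT : (c : ℝ) ≤ T := by exact_mod_cast hc2.trans hNT
    have h4 : ∀ j ∈ Finset.range c, f (run.start c + d + j)
        = max 0 (greedyAlpha X θ * opt X H θ - inner ℝ θ (run.action c)) := fun j hj => by
      rw [hf]
      simp only
      rw [run.exploit c hc0 (by rw [hW.spec.2.2.2 c hc1]; rfl) j (Finset.mem_range.1 hj)]
    rw [Finset.sum_congr rfl h4, Finset.sum_const, Finset.card_range, nsmul_eq_mul,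
      mul_max_of_nonneg _ _ (by linarith), mul_zero]
    refine max_le hD0 ((hW.exploit_regret_le hX hR hc hb h0 hL hd hB hδ0 hδ1 hH hg hΔ hΔ0 hE
      hc1 hθ).trans ?_)
    rw [hD]
    gcongr
  have h4 := hW.sum_le h2 h3
  have hS : 1 ≤ Real.sqrt T := by rwa [Real.one_le_sqrt]
  have h5 : ((N - C₀ : ℕ) : ℝ) ≤ 2 * Real.sqrt T := by
    rcases le_total N C₀ with h | h
    · rw [Nat.sub_eq_zero_of_le h]; simp
    have h6 := hW.sq_le_two_mul_start (N - C₀)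
    rw [Nat.add_sub_cancel' h] at h6
    have h7 : ((N - C₀ : ℕ) : ℝ) ^ 2 ≤ 2 * T := by
      have : (N - C₀) ^ 2 ≤ 2 * T := by omega
      exact_mod_cast this
    refine abs_le_of_sq_le_sq' ?_ (by positivity) |>.2
    rw [mul_pow, Real.sq_sqrt (by linarith)]
    linarith
  have h6 : (N : ℝ) ≤ C₀ + 2 * Real.sqrt T := by
    have : (N : ℝ) ≤ C₀ + ((N - C₀ : ℕ) : ℝ) := by
      have : N ≤ C₀ + (N - C₀) := by omega
      exact_mod_cast this
    linarith
  have h7 : ((N + 1 - C₀ : ℕ) : ℝ) ≤ 3 * Real.sqrt T := by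
    have : ((N + 1 - C₀ : ℕ) : ℝ) ≤ ((N - C₀ : ℕ) : ℝ) + 1 := by
      have : N + 1 - C₀ ≤ (N - C₀) + 1 := by omega
      exact_mod_cast this
    linarith
  calc _ ≤ _ := h1
    _ ≤ _ := h4
    _ ≤ _ := by gcongr

end APSEEGRun

/-! ### The final estimates -/

lemma lmax_pos {X : Set (Vec d)} (hb : Bornology.IsBounded X) (hd : 0 < d) {b : Fin d → Vec d}
    (hbX : ∀ k, b k ∈ X) (hB : IsUnit (gram b)) : 0 < lmax X := by
  refine (lmax_nonneg X).lt_of_ne fun h => ?_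
  have hzero : gram b = 0 := by
    rw [gram]
    refine Finset.sum_eq_zero fun k _ => ?_
    have : b k = 0 := by
      rw [← norm_le_zero_iff, h]
      exact norm_le_lmax hb (hbX k)
    rw [this]
    ext i j
    simp [Matrix.vecMulVec_apply]
  have : Nonempty (Fin d) := ⟨⟨0, hd⟩⟩
  rw [hzero] at hB
  exact not_isUnit_zero hB

lemma two_le_of_greedyGap_eq {X : Set (Vec d)} {H : ℕ} {θ : Vec d} {g : ℕ → Fin d} {Δ : ℝ}
    (h : greedyGap X H θ g = Δ) : 2 ≤ d := by
  obtain ⟨k, -, v, -, hne, -⟩ := (greedyGap_eq_coe h).2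
  rw [← Fin.nontrivial_iff_two_le]
  exact ⟨⟨v, g k, hne⟩⟩

/-- If `q ≤ T²` the logarithm in `q` is at most that in `T²`; otherwise `T ≤ q` and the logarithm is
at least `1`. -/
lemma short_horizon_le {dd q T C₀ δ : ℝ} (hd : 2 ≤ dd) (hq : 1 ≤ q) (hδ0 : 0 < δ) (hδ1 : δ < 1)
    (hT : 1 ≤ T) (hC : C₀ ≤ 512 * q * Real.log (2 * dd * q / δ)) (hTC : T ≤ dd * C₀) :
    T ≤ 512 * (dd * q) * Real.log (2 * dd * T ^ 2 / δ) := by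
  have h4 : 4 ≤ 2 * dd / δ := by rw [le_div_iff₀ hδ0]; nlinarith
  by_cases h : q ≤ T ^ 2
  · calc T ≤ dd * C₀ := hTC
      _ ≤ dd * (512 * q * Real.log (2 * dd * q / δ)) := by gcongr
      _ ≤ dd * (512 * q * Real.log (2 * dd * T ^ 2 / δ)) := by gcongr
      _ = _ := by ring
  · push Not at h
    have h1 : 1 ≤ Real.log (2 * dd * T ^ 2 / δ) := by
      have h2 : Real.log 4 ≤ Real.log (2 * dd * T ^ 2 / δ) := by
        refine Real.log_le_log (by norm_num) ?_
        calc (4 : ℝ) ≤ 2 * dd / δ := h4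
          _ ≤ 2 * dd / δ * T ^ 2 := by
            refine le_mul_of_one_le_right (by linarith) ?_
            nlinarith
          _ = _ := by ring
      have h3 : Real.log 4 = 2 * Real.log 2 := by
        rw [show (4 : ℝ) = 2 ^ 2 by norm_num, Real.log_pow]; norm_num
      linarith [Real.log_two_gt_d9]
    have h2 : T ≤ q := by nlinarith
    have h3 : q ≤ 512 * (dd * q) := by nlinarith
    calc T ≤ 512 * (dd * q) * 1 := by linarith
      _ ≤ _ := by gcongr

/-- The leading constant of the regret bound for long horizons. -/
def regretConst (L R : ℝ) : ℝ := 1028 * (L + L ^ 3) + 2700000000 * (R ^ 4 / L ^ 3)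

/-- Here `n` stands for `‖θ‖` and `S` for `√T`. If `q ≤ T²`, the warm-up logarithm is absorbed by
the one in `T²` and `q ≤ 1 + Q`. If `q > T²`, then `q = Q ≥ T` and the trivial linear bound is
covered by the `1 / Δ²` term. -/
lemma long_horizon_le {dd L R n h₁ Δ q T S C₀ δ reg : ℝ} (hd : 2 ≤ dd) (hL : 0 < L)
    (hR : 0 < R) (hn : 0 < n) (hh : 0 ≤ h₁) (hΔ : 0 < Δ) (hδ0 : 0 < δ) (hδ1 : δ < 1)
    (hT : 1 ≤ T) (hS : 1 ≤ S) (hq : q = max 1 (L ^ 2 * h₁ / Δ ^ 2))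
    (hC : C₀ ≤ 512 * q * Real.log (2 * dd * q / δ))
    (htriv : reg ≤ 2 * (L * n) * T)
    (hreg : reg ≤ (C₀ + 2 * S) * (dd * (2 * (L * n))) + 3 * S *
      (900000000 * (R ^ 4 / L ^ 3) * dd * (h₁ / n) * Real.log (2 * dd * T ^ 2 / δ))) :
    reg ≤ regretConst L R * (dd * S * (n + h₁ / n) + dd * n * h₁ / Δ ^ 2)
      * Real.log (2 * dd * T ^ 2 / δ) := by
  set Λ := Real.log (2 * dd * T ^ 2 / δ) with hΛ
  have hΛ1 : 1 ≤ Λ := by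
    have h2 : Real.log 4 ≤ Λ := by
      refine Real.log_le_log (by norm_num) ?_
      rw [le_div_iff₀ hδ0]
      nlinarith
    have h3 : Real.log 4 = 2 * Real.log 2 := by
      rw [show (4 : ℝ) = 2 ^ 2 by norm_num, Real.log_pow]; norm_num
    linarith [Real.log_two_gt_d9]
  have hq1 : 1 ≤ q := hq ▸ le_max_left _ _
  set Q := L ^ 2 * h₁ / Δ ^ 2 with hQ
  have hQ0 : 0 ≤ Q := by positivity
  set P := n * h₁ / Δ ^ 2 with hP
  have hP0 : 0 ≤ P := by positivity
  have hQP : n * Q = L ^ 2 * P := by rw [hQ, hP]; ring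
  have hPd : dd * n * h₁ / Δ ^ 2 = dd * P := by rw [hP]; ring
  set Z := h₁ / n with hZ
  have hZ0 : 0 ≤ Z := by positivity
  set W := R ^ 4 / L ^ 3 with hW
  have hW0 : 0 ≤ W := by positivity
  rw [hPd, regretConst, ← hW]
  have hdS : 0 ≤ dd * S := by positivity
  -- The first three products are the ones used; the others are nonnegative and discarded.
  have hexp : (1028 * (L + L ^ 3) + 2700000000 * W) * (dd * S * (n + Z) + dd * P) * Λ
      = 1028 * L * (dd * S * n) * Λ + 1028 * L ^ 3 * (dd * P) * Λ
        + 2700000000 * W * (dd * S * Z) * Λ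
        + (1028 * L ^ 3 * (dd * S * n) + 1028 * (L + L ^ 3) * (dd * S * Z) + 1028 * L * (dd * P)
          + 2700000000 * W * (dd * S * n) + 2700000000 * W * (dd * P)) * Λ := by ring
  have hrest : 0 ≤ (1028 * L ^ 3 * (dd * S * n) + 1028 * (L + L ^ 3) * (dd * S * Z)
      + 1028 * L * (dd * P)
      + 2700000000 * W * (dd * S * n) + 2700000000 * W * (dd * P)) * Λ := by positivity
  rw [hexp]
  by_cases hcase : q ≤ T ^ 2
  · have h1 : C₀ ≤ 512 * q * Λ := hC.trans (by rw [hΛ]; gcongr)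
    have h2 : q ≤ 1 + Q := hq ▸ max_le (by linarith) (by linarith)
    have h3 : C₀ ≤ 512 * (1 + Q) * Λ := h1.trans (by gcongr)
    have h4 : (C₀ + 2 * S) * (dd * (2 * (L * n)))
        ≤ (512 * (1 + Q) * Λ + 2 * S * Λ) * (dd * (2 * (L * n))) := by
      have h10 : 2 * S ≤ 2 * S * Λ := le_mul_of_one_le_right (by linarith) hΛ1
      exact mul_le_mul_of_nonneg_right (add_le_add h3 h10) (by positivity)
    have h5 : (512 * (1 + Q) * Λ + 2 * S * Λ) * (dd * (2 * (L * n)))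
        = 1024 * L * (dd * n) * Λ + 1024 * L * dd * (n * Q) * Λ
          + 4 * L * (dd * S * n) * Λ := by ring
    have h6 : 1024 * L * (dd * n) * Λ ≤ 1024 * L * (dd * S * n) * Λ := by
      have h10 : dd * n ≤ dd * S * n := by
        rw [mul_right_comm]; exact le_mul_of_one_le_right (by positivity) hS
      gcongr
    have h7 : 1024 * L * dd * (n * Q) * Λ = 1024 * L ^ 3 * (dd * P) * Λ := by rw [hQP]; ring
    have h8 : 0 ≤ L ^ 3 * (dd * P) * Λ := by positivity
    have h9 : 3 * S * (900000000 * W * dd * Z * Λ) = 2700000000 * W * (dd * S * Z) * Λ := by ring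
    linarith
  · push Not at hcase
    have hqQ : q = Q := by
      rcases max_choice 1 Q with h | h
      · rw [hq, h] at hcase
        exact absurd hcase (not_lt.2 (one_le_pow₀ hT))
      · rw [hq, h]
    have h1 : T ≤ Q := by
      rw [← hqQ]
      exact (le_self_pow₀ hT two_ne_zero).trans hcase.le
    have h2 : 2 * (L * n) * T ≤ 2 * L ^ 3 * P := by
      calc 2 * (L * n) * T ≤ 2 * (L * n) * Q := by gcongr
        _ = 2 * L * (n * Q) := by ring
        _ = _ := by rw [hQP]; ring
    have h3 : L ^ 3 * P ≤ L ^ 3 * (dd * P) * Λ := by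
      have h4 : P ≤ dd * P := le_mul_of_one_le_left hP0 (by linarith)
      calc L ^ 3 * P ≤ L ^ 3 * (dd * P) := by gcongr
        _ ≤ _ := le_mul_of_one_le_right (by positivity) hΛ1
    have h5 : 0 ≤ 1028 * L * (dd * S * n) * Λ := by positivity
    have h6 : 0 ≤ 2700000000 * W * (dd * S * Z) * Λ := by positivity
    have h7 : 0 ≤ L ^ 3 * (dd * P) * Λ := by positivity
    linarith

end SparseBandit

end

/-! ### The regret bounds -/

theorem mainTheorem2 :
    ∃ C : ℝ, ∃ C₁ : ℝ → ℝ → ℝ,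
      ∀ (d H : ℕ) (X : Set (SparseBandit.Vec d)) (R : ℝ) (b : Fin d → SparseBandit.Vec d)
        (θ : SparseBandit.Vec d) (g : ℕ → Fin d) (Δ σ δ : ℝ)
        (Ω : Type*) [MeasurableSpace Ω] (μ : Measure Ω) [IsProbabilityMeasure μ]
        (x : ℕ → Ω → SparseBandit.Vec d) (η : ℕ → Ω → ℝ)
        (run : ∀ ω, SparseBandit.APSEEGRun X b H σ δ
          (fun t => x t ω) (fun t => inner ℝ θ (x t ω) + η t ω)),
        -- sparsity level and action set
        1 ≤ H → H ≤ d →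
        IsClosed X → Bornology.IsBounded X → 0 ∈ X →
        0 < R → SparseBandit.IsStronglyConvexSet R X →
        -- exploration actions
        (∀ k, b k ∈ X ∧ SparseBandit.IsSparse H (b k)) → IsUnit (SparseBandit.gram b) →
        -- noise
        0 < σ → (∀ t, Measurable (x t)) → (∀ t, Measurable (η t)) →
        SparseBandit.IsCondSubGaussian μ x η σ →
        -- minimum greedy gap of the true parameter
        SparseBandit.IsGreedy X H θ g → SparseBandit.greedyGap X H θ g = (Δ : EReal) → 0 < Δ →
        0 < δ → δ < 1 →
        ∃ E : Set Ω, MeasurableSet E ∧ ENNReal.ofReal (1 - δ) ≤ μ E ∧ ∀ ω ∈ E,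
          ∃ C₀ : ℕ, (run ω).IsWarmUp C₀ ∧
            (C₀ : ℝ) ≤ C * SparseBandit.hardness X b σ Δ *
              Real.log (2 * d * SparseBandit.hardness X b σ Δ / δ) ∧
            ∀ T : ℕ, 1 ≤ T →
              -- long horizon
              (d * C₀ < T →
                SparseBandit.alphaRegret X H θ (SparseBandit.greedyAlpha X θ) (fun t => x t ω) T
                  ≤ C₁ (SparseBandit.lmax X) R *
                    (d * Real.sqrt T * (‖θ‖ + SparseBandit.hOne b σ / ‖θ‖)
                      + d * ‖θ‖ * SparseBandit.hOne b σ / Δ ^ 2) *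
                    Real.log (2 * d * (T : ℝ) ^ 2 / δ)) ∧
              -- short horizon
              (T ≤ d * C₀ →
                SparseBandit.alphaRegret X H θ (SparseBandit.greedyAlpha X θ) (fun t => x t ω) T
                  ≤ C * (d * SparseBandit.lmax X * ‖θ‖ * SparseBandit.hardness X b σ Δ) *
                    Real.log (2 * d * (T : ℝ) ^ 2 / δ)) := by
  -- `512` suffices for the warm-up; the short horizon doubles it, since one step costs at most `2
  -- L_max ‖θ‖`.
  refine ⟨1024, SparseBandit.regretConst, ?_⟩
  intro d H X R b θ g Δ σ δ Ω _ μ _ x η run hH _ hc hb h0 hR hX hbX hB hσ hx hη hsub hg hΔ hΔ0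
    hδ0 hδ1
  have hd : 2 ≤ d := SparseBandit.two_le_of_greedyGap_eq hΔ
  have hd' : (2 : ℝ) ≤ d := by exact_mod_cast hd
  have hbX' : ∀ k, b k ∈ X := fun k => (hbX k).1
  have hL := SparseBandit.lmax_pos hb (by omega) hbX' hB
  have hh := SparseBandit.hOne_nonneg hB σ
  -- The first greedy step gives `Δ ≤ L_max ‖θ‖`, so the division by `‖θ‖` is legitimate.
  have hθ : 0 < ‖θ‖ := by
    have h1 := SparseBandit.gap_le_value_singleton hb h0 hd hH
      (SparseBandit.greedyGap_eq_coe hΔ).1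
    have h2 : SparseBandit.value X (SparseBandit.picked g 1) θ ≤ SparseBandit.lmax X * ‖θ‖ :=
      SparseBandit.value_le h0 fun y hy => SparseBandit.inner_le_lmax_mul hb hy.1 θ
    exact pos_of_mul_pos_right (by linarith) hL.le
  obtain ⟨E, hEm, hEμ, hE⟩ :=
    SparseBandit.exists_good_event run hx hη hsub hB hσ hb h0 hd hδ0 hδ1
  refine ⟨E, hEm, hEμ, fun ω hω => ?_⟩
  have hacc := SparseBandit.APSEEGRun.accurate_of_sq_le (hE ω hω)
  set q := SparseBandit.hardness X b σ Δ with hq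
  have hq1 : 1 ≤ q := le_max_left _ _
  have hqQ : SparseBandit.lmax X ^ 2 * SparseBandit.hOne b σ / Δ ^ 2 ≤ q := le_max_right _ _
  obtain ⟨c, hc1, hcle, hclt⟩ := SparseBandit.exists_cycle_count hq1
    (show 4 ≤ 2 * d / δ by rw [le_div_iff₀ hδ0]; nlinarith)
  have hsmall : 4 * (SparseBandit.lmax X * SparseBandit.errBound b σ δ c) < Δ := by
    have hc' : (1 : ℝ) ≤ c := by exact_mod_cast hc1
    have hlog : 0 ≤ Real.log (2 * d / δ * (c : ℝ) ^ 2) := by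
      refine Real.log_nonneg ?_
      rw [div_mul_eq_mul_div, le_div_iff₀ hδ0]; nlinarith
    refine lt_of_pow_lt_pow_left₀ 2 hΔ0.le ?_
    rw [mul_pow, mul_pow, SparseBandit.errBound_sq hB σ hd hδ0 hδ1 hc1,
      show 2 * d * (c : ℝ) ^ 2 / δ = 2 * d / δ * (c : ℝ) ^ 2 by ring]
    rw [div_le_iff₀ (by positivity)] at hqQ
    have h1 : 16 * (SparseBandit.lmax X ^ 2 * SparseBandit.hOne b σ)
        * Real.log (2 * d / δ * (c : ℝ) ^ 2) < Δ ^ 2 * c := by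
      calc _ ≤ 16 * (q * Δ ^ 2) * Real.log (2 * d / δ * (c : ℝ) ^ 2) := by gcongr
        _ = Δ ^ 2 * (16 * q * Real.log (2 * d / δ * (c : ℝ) ^ 2)) := by ring
        _ < Δ ^ 2 * c := by gcongr
    calc _ = 16 * (SparseBandit.lmax X ^ 2 * SparseBandit.hOne b σ)
        * Real.log (2 * d / δ * (c : ℝ) ^ 2) / c := by ring
      _ < Δ ^ 2 := by rwa [div_lt_iff₀ (by linarith)]
  obtain ⟨C₀, hW, hC₀⟩ := SparseBandit.APSEEGRun.exists_isWarmUp hb h0 hg hacc hΔ hc1 hsmall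
  have hC : (C₀ : ℝ) ≤ 512 * q * Real.log (2 * d * q / δ) := by
    rw [show 2 * d * q / δ = 2 * d / δ * q by ring]
    exact le_trans (by exact_mod_cast hC₀) hcle
  have hlogq : 0 ≤ Real.log (2 * d * q / δ) := by
    refine Real.log_nonneg ?_
    rw [le_div_iff₀ hδ0]; nlinarith
  refine ⟨C₀, hW, hC.trans (by gcongr; norm_num), fun T hT => ⟨fun _ => ?_, fun hTC => ?_⟩⟩
  · have hT' : (1 : ℝ) ≤ T := by exact_mod_cast hT
    exact SparseBandit.long_horizon_le hd' hL hR hθ hh hΔ0 hδ0 hδ1 hT'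
      (Real.one_le_sqrt.2 hT') hq hC
      ((run ω).alphaRegret_le_trivial hb h0 (by omega) hbX' T)
      (hW.alphaRegret_le hX hR hc hb h0 hL hd hB hbX' hδ0 hδ1 hH hg hΔ hΔ0 hacc hθ hT)
  · have hT' : (1 : ℝ) ≤ T := by exact_mod_cast hT
    have h1 := SparseBandit.short_horizon_le hd' hq1 hδ0 hδ1 hT' hC (by exact_mod_cast hTC)
    refine ((run ω).alphaRegret_le_trivial hb h0 (by omega) hbX' T).trans ?_
    calc 2 * (SparseBandit.lmax X * ‖θ‖) * (T : ℝ)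
        ≤ 2 * (SparseBandit.lmax X * ‖θ‖)
          * (512 * (d * q) * Real.log (2 * d * (T : ℝ) ^ 2 / δ)) := by gcongr
      _ = _ := by ring
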